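/- \textbf{Setting.} Let $H$ be a Hermitian matrix on $\mathbb{C}^d$ and $\rho_\beta = e^{-\beta H}/\operatorname{Tr} e^{-\beta H}$ with $0\le\beta<\infty$. Let $\mathcal{A}$ be a nonempty finite set of $d\times d$ matrices with $-A\in\mathcal{A}$ and $A^\dagger\in\mathcal{A}$ for every $A\in\mathcal{A}$; $\mathbb{E}_A$ is the average over $\mathcal{A}$. Let $g$ be a probability density on $\mathbb{R}$, let $\sigma,T,\alpha>0$ and $f(t)=(2\pi)^{-1/4}\sigma^{-1/2}e^{-t^2/(4\sigma^2)}$. On the system and one qubit put $H_E=-\omega Z/2$, $B_E=|1\rangle\langle 0|$, $\rho_E=e^{-\beta H_E}/\operatorname{Tr}e^{-\beta H_E}$ and $$H_\alpha(t)=H+H_E+\alpha f(t)\,(A\otimes B_E+A^\dagger\otimes B_E^\dagger),\qquad U=\mathcal{T}\exp\Big(-i\int_{-T}^{T}H_\alpha(s)\,ds\Big),$$ $$\Phi_\alpha(\rho)=\mathbb{E}_A\int g(\omega)\operatorname{Tr}_E\big[U(\rho\otimes\rho_E)U^\dagger\big]\,d\omega .$$ Let $\|\cdot\|_1$ be the trace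 norm and $\|\cdot\|$ the operator norm. Assume that $\Phi_\alpha$ has a unique fixed state $\rho_{\rm fix}$; for $\epsilon>0$ let $\tau_{\rm mix}(\epsilon)=\min\{t\in\mathbb{N}:\sup_\rho\|\Phi_\alpha^t(\rho)-\rho_{\rm fix}\|_1\le\epsilon\}$ (supremum over states) and $t_{\rm mix}(\epsilon)=\alpha^2\tau_{\rm mix}(\epsilon)$. The mixing times that occur below are assumed to be finite. Put $\gamma(\omega)=\dfrac{g(\omega)+g(-\omega)}{1+e^{\beta\omega}}$, $R=\displaystyle\int_0^\infty\Big|\int_{\mathbb{R}}\gamma(\omega)e^{i\omega\sigma q}\,d\omega\Big|e^{-q^2/8}\,dq$, $A(t)=e^{iHt}Ae^{-iHt}$, $\mathcal{D}_V(\rho)=V\rho V^\dagger-\frac12\{V^\dagger V,\rho\}$, $\widetilde V_A(\omega)=\int f(t)A(t)e^{-i\omega t}\,dt$, $\widetilde{\mathcal{G}}_A(\omega)=\int_{\mathbb{R}}\int_{-\infty}^{s_1}f(s_2)f(s_1)A(s_2)^\dagger A(s_1)e^{i\omega(s_2-s_1)}\,ds_2\,ds_1$, and $$E=\mathbb{E}_A\Big(\Big\|\Big[\rho_\beta,\int\gamma\,\widetilde{\mathcal{G}}_A\,d\omega\Big]\Big\|_1+\Big\|\Big[\rho_\beta,\int\gamma\,\widetilde{\mathcal{G}}_A^\dagger\,d\omega\Big]\Big\|_1\Big)+\Big\|\mathbb{E}_A\int\gamma(\omega)\,\mathcal{D}_{\widetilde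 V_A(\omega)}(\rho_\beta)\,d\omega\Big\|_1,$$ $$E'=\sigma e^{-T^2/(4\sigma^2)}\,\mathbb{E}_A\|A\|^2+\alpha^2T^4\sigma^{-2}\,\mathbb{E}_A\|A\|^4 .$$ \textbf{(1) General $g$.} There is a universal constant $C>0$ such that, whenever $\sigma>\beta$, for every $\epsilon>0$, $$\|\rho_{\rm fix}-\rho_\beta\|_1\le (E+CE')\,\alpha^2\tau_{\rm mix}(\epsilon)+\epsilon ,$$ and, if $\|\gamma\|_\infty<\infty$, then $E\le C\Big(R+\frac{\|\gamma\|_\infty}{\sigma}\sqrt{1+\log(\sigma/\beta)}\Big)\beta\,\mathbb{E}_A\|A\|^2$ and $$\|\rho_{\rm fix}-\rho_\beta\|_1\le C\left[\Big(R+\frac{\|\gamma\|_\infty}{\sigma}\sqrt{1+\log(\sigma/\beta)}\Big)\beta\,\mathbb{E}_A\|A\|^2+E'\right]\alpha^2\tau_{\rm mix}(\epsilon)+\epsilon$$ (the terms carrying the factor $\beta$ are $0$ at $\beta=0$). \textbf{(2) Uniform $g$.} There is a universal constant $C>0$ such that the following holds if $\|A\|\le1$ for all $A\in\mathcal{A}$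 and $g=\omega_{\max}^{-1}\mathbf{1}_{[0,\omega_{\max}]}$ with $\omega_{\max}>0$. Let $\epsilon>0$ and $t_{\rm mix}=t_{\rm mix}(\min(\epsilon,\tfrac12))$. If $$\sigma\ge C\,\frac{\beta\,t_{\rm mix}}{\omega_{\max}\,\epsilon}\left(\log\Big(2+\frac{\beta\,t_{\rm mix}}{\epsilon}\Big)+\log\Big(2+\frac{t_{\rm mix}}{\omega_{\max}\,\epsilon}\Big)\right),\qquad T\ge C\,\sigma\log\Big(2+\frac{\sigma\,t_{\rm mix}}{\epsilon}\Big),$$ $$\alpha\,t_{\rm mix}^{1/2}\le C^{-1}\,\sigma\,T^{-2}\,\epsilon^{1/2},$$ then $\|\rho_{\rm fix}-\rho_\beta\|_1<\epsilon$. -/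

import Mathlib

open MeasureTheory
open scoped Matrix Kronecker ComplexOrder Matrix.Norms.L2Operator

/-! Throughout, `‖A‖` for a matrix `A` is the operator norm with respect to the Euclidean norm. -/

noncomputable section

namespace ThermalPrep

/-- Trace norm `‖A‖₁ = Tr √(Aᴴ A)`: the sum of the singular values of `A`. -/
def traceNorm {d : ℕ} (A : Matrix (Fin d) (Fin d) ℂ) : ℝ :=
  ∑ i, √((Matrix.isHermitian_conjTranspose_mul_self A).eigenvalues i)

/-- Density matrices (quantum states). -/
def IsState {d : ℕ} (ρ : Matrix (Fin d) (Fin d) ℂ) : Prop :=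
  ρ.PosSemidef ∧ ρ.trace = 1

/-- The Gibbs state `exp(-βH) / Tr exp(-βH)`. -/
def gibbs {ι : Type*} [Fintype ι] [DecidableEq ι] (β : ℝ) (H : Matrix ι ι ℂ) : Matrix ι ι ℂ :=
  (NormedSpace.exp (-(β : ℂ) • H)).trace⁻¹ • NormedSpace.exp (-(β : ℂ) • H)

/-- Terms of the Dyson series: `D₀(t) = 1`, `Dₙ₊₁(t) = ∫_{t₀}^t -i 𝓗(s) Dₙ(s) ds`. -/
def dysonTerm {ι : Type*} [Fintype ι] [DecidableEq ι] (𝓗 : ℝ → Matrix ι ι ℂ) (t₀ : ℝ) :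
    ℕ → ℝ → Matrix ι ι ℂ
  | 0, _ => 1
  | n + 1, t => ∫ s in t₀..t, (-Complex.I) • (𝓗 s * dysonTerm 𝓗 t₀ n s)

/-- The time-ordered exponential `𝒯 exp(-i ∫_{t₀}^t 𝓗(s) ds)`. -/
def timeOrderedExp {ι : Type*} [Fintype ι] [DecidableEq ι] (𝓗 : ℝ → Matrix ι ι ℂ) (t₀ t : ℝ) :
    Matrix ι ι ℂ :=
  ∑' n, dysonTerm 𝓗 t₀ n t

/-- The Gaussian filter `f(t) = (2π)^{-1/4} σ^{-1/2} exp(-t²/(4σ²))`. -/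
def gaussFilter (σ t : ℝ) : ℝ :=
  ((2 * Real.pi) ^ (1 / 4 : ℝ) * σ ^ (1 / 2 : ℝ))⁻¹ * Real.exp (-t ^ 2 / (4 * σ ^ 2))

/-- Bath Hamiltonian `H_E = -ωZ/2` on one qubit. -/
def bathHam (ω : ℝ) : Matrix (Fin 2) (Fin 2) ℂ :=
  !![-(ω : ℂ) / 2, 0; 0, (ω : ℂ) / 2]

/-- Bath coupling operator `B_E = |1⟩⟨0|`. -/
def bathCoupling : Matrix (Fin 2) (Fin 2) ℂ :=
  !![0, 0; 1, 0]

/-- `H_α(t) = H + H_E + α f(t) (A ⊗ B_E + Aᴴ ⊗ B_Eᴴ)`. -/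
def totalHam {d : ℕ} (H A : Matrix (Fin d) (Fin d) ℂ) (σ α ω t : ℝ) :
    Matrix (Fin d × Fin 2) (Fin d × Fin 2) ℂ :=
  H ⊗ₖ (1 : Matrix (Fin 2) (Fin 2) ℂ) + (1 : Matrix (Fin d) (Fin d) ℂ) ⊗ₖ bathHam ω
    + ((α * gaussFilter σ t : ℝ) : ℂ) • (A ⊗ₖ bathCoupling + Aᴴ ⊗ₖ bathCouplingᴴ)

/-- Partial trace over the bath qubit. -/
def traceBath {d : ℕ} (M : Matrix (Fin d × Fin 2) (Fin d × Fin 2) ℂ) : Matrix (Fin d) (Fin d) ℂ :=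
  Matrix.of fun i j => ∑ k, M (i, k) (j, k)

/-- One step of the protocol for a fixed draw of `A` and `ω`, the joint system evolving from
time `-T` to time `T`. -/
def stepMap {d : ℕ} (H A : Matrix (Fin d) (Fin d) ℂ) (β σ T α ω : ℝ)
    (ρ : Matrix (Fin d) (Fin d) ℂ) : Matrix (Fin d) (Fin d) ℂ :=
  let U := timeOrderedExp (totalHam H A σ α ω) (-T) T
  traceBath (U * (ρ ⊗ₖ gibbs β (bathHam ω)) * Uᴴ)

/-- Expectation over a uniformly distributed element of a finite set. -/
def uniformMean {ι E : Type*} [AddCommGroup E] [Module ℝ E] (𝒜 : Finset ι) (F : ι → E) : E :=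
  (𝒜.card : ℝ)⁻¹ • ∑ A ∈ 𝒜, F A

/-- The channel `Φ_α`: the expectation of the step over `A` uniform in `𝒜` and `ω` with
density `g`. -/
def channel {d : ℕ} (H : Matrix (Fin d) (Fin d) ℂ) (𝒜 : Finset (Matrix (Fin d) (Fin d) ℂ))
    (g : ℝ → ℝ) (β σ T α : ℝ) (ρ : Matrix (Fin d) (Fin d) ℂ) : Matrix (Fin d) (Fin d) ℂ :=
  uniformMean 𝒜 fun A => ∫ ω, g ω • stepMap H A β σ T α ω ρ

/-- Sets of coupling operators `{A^i, -A^i}ᵢ` with `{(A^i)ᴴ}ᵢ = {A^i}ᵢ`. -/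
def IsCouplingSet {d : ℕ} (𝒜 : Finset (Matrix (Fin d) (Fin d) ℂ)) : Prop :=
  𝒜.Nonempty ∧ ∀ A ∈ 𝒜, -A ∈ 𝒜 ∧ Aᴴ ∈ 𝒜

/-- Probability densities on the real line. -/
def IsProbDensity (g : ℝ → ℝ) : Prop :=
  (∀ ω, 0 ≤ g ω) ∧ Integrable g ∧ ∫ ω, g ω = 1

/-- The density of the uniform distribution on `[0, ωmax]`. -/
def uniformDensity (ωmax : ℝ) : ℝ → ℝ :=
  Set.indicator (Set.Icc 0 ωmax) fun _ => ωmax⁻¹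

/-- `ρfix` is the unique state fixed by `Φ`. -/
def IsUniqueFixedState {d : ℕ} (Φ : Matrix (Fin d) (Fin d) ℂ → Matrix (Fin d) (Fin d) ℂ)
    (ρfix : Matrix (Fin d) (Fin d) ℂ) : Prop :=
  IsState ρfix ∧ Φ ρfix = ρfix ∧ ∀ ρ, IsState ρ → Φ ρ = ρ → ρ = ρfix

/-- After `t` steps every initial state is within trace-norm distance `ε` of `ρfix`. -/
def IsMixedAt {d : ℕ} (Φ : Matrix (Fin d) (Fin d) ℂ → Matrix (Fin d) (Fin d) ℂ)
    (ρfix : Matrix (Fin d) (Fin d) ℂ) (ε : ℝ) (t : ℕ) : Prop :=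
  ∀ ρ, IsState ρ → traceNorm (Φ^[t] ρ - ρfix) ≤ ε

/-- The integer mixing time `τ_mix(ε)`: the least `t` with `IsMixedAt Φ ρfix ε t` (meaningful
when such a `t` exists). -/
def mixingTime {d : ℕ} (Φ : Matrix (Fin d) (Fin d) ℂ → Matrix (Fin d) (Fin d) ℂ)
    (ρfix : Matrix (Fin d) (Fin d) ℂ) (ε : ℝ) : ℕ :=
  sInf {t : ℕ | IsMixedAt Φ ρfix ε t}

/-- `γ(ω) = (g(ω) + g(-ω)) / (1 + exp(βω))`. -/
def rate (g : ℝ → ℝ) (β ω : ℝ) : ℝ :=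
  (g ω + g (-ω)) / (1 + Real.exp (β * ω))

/-- `R = ∫₀^∞ |∫ γ(ω) exp(iωσq) dω| exp(-q²/8) dq`. -/
def lambR (g : ℝ → ℝ) (β σ : ℝ) : ℝ :=
  ∫ q in Set.Ioi (0 : ℝ),
    ‖∫ ω, (rate g β ω : ℂ) * Complex.exp (Complex.I * ((ω * σ * q : ℝ) : ℂ))‖
      * Real.exp (-q ^ 2 / 8)

/-- Heisenberg evolution `A(t) = exp(iHt) A exp(-iHt)`. -/
def heis {d : ℕ} (H A : Matrix (Fin d) (Fin d) ℂ) (t : ℝ) : Matrix (Fin d) (Fin d) ℂ :=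
  NormedSpace.exp ((Complex.I * (t : ℂ)) • H) * A * NormedSpace.exp ((-Complex.I * (t : ℂ)) • H)

/-- `Ṽ_A(ω) = ∫ f(t) A(t) exp(-iωt) dt`. -/
def jumpOp {d : ℕ} (H A : Matrix (Fin d) (Fin d) ℂ) (σ ω : ℝ) : Matrix (Fin d) (Fin d) ℂ :=
  ∫ t : ℝ, ((gaussFilter σ t : ℂ) * Complex.exp (-Complex.I * ((ω * t : ℝ) : ℂ))) • heis H A t

/-- `G̃_A(ω) = ∫_{s₁ ∈ ℝ} ∫_{s₂ ≤ s₁} f(s₂) f(s₁) A(s₂)ᴴ A(s₁) exp(iω(s₂ - s₁)) ds₂ ds₁`. -/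
def lambOp {d : ℕ} (H A : Matrix (Fin d) (Fin d) ℂ) (σ ω : ℝ) : Matrix (Fin d) (Fin d) ℂ :=
  ∫ s₁ : ℝ, ∫ s₂ in Set.Iic s₁,
    (((gaussFilter σ s₂ * gaussFilter σ s₁ : ℝ) : ℂ)
      * Complex.exp (Complex.I * ((ω * (s₂ - s₁) : ℝ) : ℂ))) • ((heis H A s₂)ᴴ * heis H A s₁)

/-- The dissipator `𝒟_V(ρ) = V ρ Vᴴ - ½ {Vᴴ V, ρ}`. -/
def dissipator {d : ℕ} (V ρ : Matrix (Fin d) (Fin d) ℂ) : Matrix (Fin d) (Fin d) ℂ :=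
  V * ρ * Vᴴ - (1 / 2 : ℂ) • (Vᴴ * V * ρ + ρ * (Vᴴ * V))

/-- Failure of the Lamb shift to commute with the Gibbs state:
`𝔼_A (‖[ρ_β, ∫ γ(ω) G̃_A(ω) dω]‖₁ + ‖[ρ_β, ∫ γ(ω) G̃_A(ω)ᴴ dω]‖₁)`. -/
def lambError {d : ℕ} (H : Matrix (Fin d) (Fin d) ℂ) (𝒜 : Finset (Matrix (Fin d) (Fin d) ℂ))
    (g : ℝ → ℝ) (β σ : ℝ) : ℝ :=
  uniformMean 𝒜 fun A =>
    traceNorm ⁅gibbs β H, ∫ ω, rate g β ω • lambOp H A σ ω⁆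
      + traceNorm ⁅gibbs β H, ∫ ω, rate g β ω • (lambOp H A σ ω)ᴴ⁆

/-- Failure of the dissipative part to preserve the Gibbs state:
`‖𝔼_A ∫ γ(ω) 𝒟_{Ṽ_A(ω)}(ρ_β) dω‖₁`. -/
def dissError {d : ℕ} (H : Matrix (Fin d) (Fin d) ℂ) (𝒜 : Finset (Matrix (Fin d) (Fin d) ℂ))
    (g : ℝ → ℝ) (β σ : ℝ) : ℝ :=
  traceNorm (uniformMean 𝒜 fun A => ∫ ω, rate g β ω • dissipator (jumpOp H A σ ω) (gibbs β H))

/-- The finite-time and higher-order error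
`σ exp(-T²/(4σ²)) 𝔼‖A‖² + α² T⁴ σ⁻² 𝔼‖A‖⁴`. -/
def truncError {d : ℕ} (𝒜 : Finset (Matrix (Fin d) (Fin d) ℂ)) (σ T α : ℝ) : ℝ :=
  σ * Real.exp (-T ^ 2 / (4 * σ ^ 2)) * uniformMean 𝒜 (fun A => ‖A‖ ^ 2)
    + α ^ 2 * T ^ 4 / σ ^ 2 * uniformMean 𝒜 (fun A => ‖A‖ ^ 4)

/-- `(R + ‖γ‖_∞ σ⁻¹ √(1 + log(σ/β))) β 𝔼‖A‖²`. -/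
def gibbsBound {d : ℕ} (𝒜 : Finset (Matrix (Fin d) (Fin d) ℂ)) (g : ℝ → ℝ) (β σ : ℝ) : ℝ :=
  (lambR g β σ + (eLpNorm (rate g β) ⊤ volume).toReal * (1 / σ) * √(1 + Real.log (σ / β)))
    * β * uniformMean 𝒜 (fun A => ‖A‖ ^ 2)

end ThermalPrep

end

/-! The Gibbs state is almost fixed by one step of the channel. If a single step moves $\rho_\beta$
by at most $\delta$ in trace norm, then contractivity and a telescoping sum show that $\tau$ steps
move it by at most $\tau\delta$. After $\tau_{\rm mix}(\epsilon)$ steps it is also within $\epsilon$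
of $\rho_{\rm fix}$, which gives (1). For (2) the additive $\epsilon$ is replaced by a factor:
$\rho_{\rm fix}-\rho_\beta$ is a multiple of a difference of two states, so mixing at level $1/2$ at
least halves it, and the distance is at most twice the drift
(`traceNorm_fixed_sub_gibbs_le_two_mul`).

The drift $\delta$ comes from a Dyson expansion in the interaction picture
(`traceBound_stepMap_gibbs_expansion`). The coupling is odd under $Z$ on the bath and the initial
state is even, so odd orders vanish under the partial trace and the remainder is of order
$\alpha^4$. The second order term, extended from $[-T,T]$ to the whole line at the cost of a
Gaussian tail, is a Lindblad-type generator (`integral_secondOrder`). Averaging over the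
adjoint-closed set of couplings and over $\omega$ turns the two bath populations into the single
rate $\gamma$. The generator then splits into a dissipator and commutators with the Lamb operator
(`generator_eq`), whose values at $\rho_\beta$ make up $E$.

Commutators: in the energy basis $|p_i-p_j|\le\beta|E_i-E_j|(p_i+p_j)$, so
$\|[\rho_\beta,N]\|_1\le2\beta\|[H,N]\|$ without any dimension factor (`traceBound_lie_gibbs`). The
Lamb operator is an integral of $\hat\gamma(q)$ against time averages of Heisenberg-evolved
operators; commuting with $H$ is differentiating in time, and integration by parts moves the
derivative to the slowly varying filter, gaining $1/\sigma$ (`norm_lie_corrOp_le`). The result is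
$\beta R$.

Dissipator: $\gamma(-\omega)=e^{\beta\omega}\gamma(\omega)$ would give exact detailed balance if
each jump of frequency $\nu$ were seen only at $\omega=\nu$. The filter blurs $\omega$ by about
$1/\sigma$, leaving the factor $1-e^{\beta(\omega-\nu)}$, of size $\beta/\sigma$ in $L^2$ against
the Gaussian. A Hilbert–Schmidt Cauchy–Schwarz inequality then gives $\|\gamma\|_\infty\beta/\sigma$
(`dissError_le`), which is stronger than required since the logarithmic factor is at least 1.

For uniform $g$, integration by parts bounds $\hat\gamma$ and gives
$R\lesssim\log(1+\omega_{\max}\sigma)/(\omega_{\max}\sigma)$. The parameter conditions then keep the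
total error below $\epsilon$. -/

namespace ThermalPrep

/-! ### Trace norm bounds by duality with the operator norm -/

section TraceDuality

variable {ι : Type*} [Fintype ι] [DecidableEq ι]

/-- `M` has trace norm at most `c`, expressed by duality with the operator norm. -/
def TraceBound (M : Matrix ι ι ℂ) (c : ℝ) : Prop :=
  ∀ W : Matrix ι ι ℂ, ‖W‖ ≤ 1 → ‖(W * M).trace‖ ≤ c

theorem TraceBound.nonneg {M : Matrix ι ι ℂ} {c : ℝ} (h : TraceBound M c) : 0 ≤ c := by
  simpa using h 0 (by simp)

theorem TraceBound.mono {M : Matrix ι ι ℂ} {c c' : ℝ} (h : TraceBound M c) (hc : c ≤ c') :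
    TraceBound M c' := fun W hW => (h W hW).trans hc

theorem TraceBound.norm_trace_mul_le {M : Matrix ι ι ℂ} {c : ℝ} (h : TraceBound M c)
    (W : Matrix ι ι ℂ) : ‖(W * M).trace‖ ≤ c * ‖W‖ := by
  by_cases hW : ‖W‖ = 0
  · have : W = 0 := norm_eq_zero.mp hW
    simp [this]
  · have hpos : 0 < ‖W‖ := lt_of_le_of_ne (norm_nonneg _) (Ne.symm hW)
    have h1 := h ((‖W‖⁻¹ : ℂ) • W) (by
      rw [norm_smul, norm_inv, Complex.norm_real, norm_norm, inv_mul_cancel₀ hW])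
    rw [Matrix.smul_mul, Matrix.trace_smul, norm_smul, norm_inv, Complex.norm_real, norm_norm,
      inv_mul_eq_div, div_le_iff₀ hpos] at h1
    exact h1

theorem TraceBound.add {M N : Matrix ι ι ℂ} {a b : ℝ} (hM : TraceBound M a)
    (hN : TraceBound N b) : TraceBound (M + N) (a + b) := fun W hW => by
  rw [Matrix.mul_add, Matrix.trace_add]
  exact (norm_add_le _ _).trans (add_le_add (hM W hW) (hN W hW))

theorem TraceBound.neg {M : Matrix ι ι ℂ} {a : ℝ} (hM : TraceBound M a) :
    TraceBound (-M) a := fun W hW => by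
  rw [Matrix.mul_neg, Matrix.trace_neg, norm_neg]
  exact hM W hW

theorem TraceBound.sub {M N : Matrix ι ι ℂ} {a b : ℝ} (hM : TraceBound M a)
    (hN : TraceBound N b) : TraceBound (M - N) (a + b) := by
  rw [sub_eq_add_neg]; exact hM.add hN.neg

theorem TraceBound.zero : TraceBound (0 : Matrix ι ι ℂ) 0 := fun W _ => by simp

theorem TraceBound.smul {M : Matrix ι ι ℂ} {a : ℝ} (hM : TraceBound M a) (c : ℂ) :
    TraceBound (c • M) (‖c‖ * a) := fun W hW => by
  rw [Matrix.mul_smul, Matrix.trace_smul, norm_smul]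
  exact mul_le_mul_of_nonneg_left (hM W hW) (norm_nonneg _)

theorem TraceBound.real_smul {M : Matrix ι ι ℂ} {a : ℝ} (hM : TraceBound M a) (c : ℝ) :
    TraceBound (c • M) (|c| * a) := fun W hW => by
  rw [Matrix.mul_smul, Matrix.trace_smul, norm_smul, Real.norm_eq_abs]
  exact mul_le_mul_of_nonneg_left (hM W hW) (abs_nonneg _)

theorem TraceBound.sum {κ : Type*} (s : Finset κ) {M : κ → Matrix ι ι ℂ} {a : κ → ℝ}
    (h : ∀ k ∈ s, TraceBound (M k) (a k)) : TraceBound (∑ k ∈ s, M k) (∑ k ∈ s, a k) :=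
  fun W hW => by
  rw [Matrix.mul_sum, Matrix.trace_sum]
  exact (norm_sum_le _ _).trans (Finset.sum_le_sum fun k hk => h k hk W hW)

theorem TraceBound.mul_left {M : Matrix ι ι ℂ} {c : ℝ} (h : TraceBound M c) (V : Matrix ι ι ℂ) :
    TraceBound (V * M) (‖V‖ * c) := fun W hW => by
  rw [← Matrix.mul_assoc]
  refine (h.norm_trace_mul_le _).trans ?_
  rw [mul_comm]
  exact mul_le_mul_of_nonneg_right ((norm_mul_le _ _).trans
    (mul_le_of_le_one_left (norm_nonneg _) hW)) h.nonneg

theorem TraceBound.mul_right {M : Matrix ι ι ℂ} {c : ℝ} (h : TraceBound M c) (V : Matrix ι ι ℂ) :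
    TraceBound (M * V) (c * ‖V‖) := fun W hW => by
  rw [← Matrix.mul_assoc, Matrix.trace_mul_comm, ← Matrix.mul_assoc]
  refine (h.norm_trace_mul_le _).trans ?_
  exact mul_le_mul_of_nonneg_left ((norm_mul_le _ _).trans
    (mul_le_of_le_one_right (norm_nonneg _) hW)) h.nonneg

/-- The continuous linear functional `M ↦ Tr (W M)`. -/
noncomputable def traceMulCLM (W : Matrix ι ι ℂ) : Matrix ι ι ℂ →L[ℂ] ℂ :=
  LinearMap.toContinuousLinearMap
    { toFun := fun M => (W * M).trace
      map_add' := fun M N => by rw [Matrix.mul_add, Matrix.trace_add]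
      map_smul' := fun c M => by simp [Matrix.trace_smul] }

theorem trace_mul_integral {X : Type*} [MeasurableSpace X] {μ : Measure X}
    {F : X → Matrix ι ι ℂ} (hF : Integrable F μ) (W : Matrix ι ι ℂ) :
    (W * ∫ x, F x ∂μ).trace = ∫ x, (W * F x).trace ∂μ :=
  ((traceMulCLM W).integral_comp_comm hF).symm

/-- Pairing with a fixed `W` leaves a scalar integral, so no regularity of the trace norm itself is
needed. -/
theorem TraceBound.integral {X : Type*} [MeasurableSpace X] {μ : Measure X}
    {F : X → Matrix ι ι ℂ} {c : X → ℝ} (hF : Integrable F μ) (hc : Integrable c μ)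
    (h : ∀ᵐ x ∂μ, TraceBound (F x) (c x)) : TraceBound (∫ x, F x ∂μ) (∫ x, c x ∂μ) :=
  fun W hW => by
  rw [trace_mul_integral hF]
  exact norm_integral_le_of_norm_le hc (h.mono fun x hx => hx W hW)

theorem norm_one_le_one : ‖(1 : Matrix ι ι ℂ)‖ ≤ 1 := by
  rw [← Matrix.diagonal_one, Matrix.l2_opNorm_diagonal]
  exact (pi_norm_le_iff_of_nonneg zero_le_one).2 fun _ => by simp

theorem norm_le_one_of_conjTranspose_mul_self {U : Matrix ι ι ℂ} (h : Uᴴ * U = 1) : ‖U‖ ≤ 1 := by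
  have h1 := Matrix.l2_opNorm_conjTranspose_mul_self U
  rw [h] at h1
  have h2 := norm_one_le_one (ι := ι)
  nlinarith [norm_nonneg U]

theorem norm_entry_le (M : Matrix ι ι ℂ) (i j : ι) : ‖M i j‖ ≤ ‖M‖ := by
  have h := Matrix.l2_opNorm_mulVec M (EuclideanSpace.single j 1)
  have h2 : M i j = (WithLp.toLp 2 (M.mulVec (EuclideanSpace.single j (1 : ℂ)).ofLp) :
      EuclideanSpace ℂ ι) i := by
    simp [Matrix.col]
  rw [h2]
  refine (PiLp.norm_apply_le _ i).trans (h.trans ?_)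
  simp

/-- The sum is a diagonal entry of `M * Mᴴ`. -/
theorem sum_row_norm_sq_le (M : Matrix ι ι ℂ) (i : ι) : ∑ j, ‖M i j‖ ^ 2 ≤ ‖M‖ ^ 2 := by
  have h := norm_entry_le (M * Mᴴ) i i
  have h1 : (M * Mᴴ) i i = ((∑ j, ‖M i j‖ ^ 2 : ℝ) : ℂ) := by
    simp [Matrix.mul_apply, Complex.mul_conj', Matrix.conjTranspose_apply]
  rw [h1, Complex.norm_real, Real.norm_of_nonneg (Finset.sum_nonneg fun _ _ => sq_nonneg _)] at h
  refine h.trans ((norm_mul_le _ _).trans ?_)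
  rw [Matrix.l2_opNorm_conjTranspose, sq]

theorem sum_col_norm_sq_le (M : Matrix ι ι ℂ) (j : ι) : ∑ i, ‖M i j‖ ^ 2 ≤ ‖M‖ ^ 2 := by
  have h := sum_row_norm_sq_le Mᴴ j
  simpa [Matrix.l2_opNorm_conjTranspose, Matrix.conjTranspose_apply] using h

theorem norm_diagonal_le {v : ι → ℂ} {c : ℝ} (hc : 0 ≤ c) (h : ∀ i, ‖v i‖ ≤ c) :
    ‖Matrix.diagonal v‖ ≤ c := by
  rw [Matrix.l2_opNorm_diagonal]
  exact (pi_norm_le_iff_of_nonneg hc).2 h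

end TraceDuality

/-! ### Unitary diagonalisation and positive matrices -/

section Spectral

variable {ι : Type*} [Fintype ι] [DecidableEq ι]

/-- A Hermitian matrix is diagonalised by a unitary. -/
theorem exists_unitary_diagonal {M : Matrix ι ι ℂ} (hM : M.IsHermitian) :
    ∃ Q : Matrix ι ι ℂ, Qᴴ * Q = 1 ∧ Q * Qᴴ = 1 ∧
      M = Q * Matrix.diagonal (fun i => (hM.eigenvalues i : ℂ)) * Qᴴ := by
  refine ⟨hM.eigenvectorUnitary, ?_, ?_, ?_⟩
  · exact Unitary.star_mul_self_of_mem hM.eigenvectorUnitary.2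
  · exact Unitary.mul_star_self_of_mem hM.eigenvectorUnitary.2
  · have := hM.spectral_theorem
    rw [Unitary.conjStarAlgAut_apply] at this
    exact this

theorem trace_conj_unitary {Q : Matrix ι ι ℂ} (hQ : Qᴴ * Q = 1) (M : Matrix ι ι ℂ) :
    (Q * M * Qᴴ).trace = M.trace := by
  rw [Matrix.trace_mul_comm, ← Matrix.mul_assoc, hQ, Matrix.one_mul]

theorem TraceBound.conj_unitary {Q M : Matrix ι ι ℂ} {c : ℝ} (hQ : Qᴴ * Q = 1)
    (h : TraceBound M c) : TraceBound (Q * M * Qᴴ) c := by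
  have hQ1 := norm_le_one_of_conjTranspose_mul_self hQ
  refine ((h.mul_left Q).mul_right Qᴴ).mono ?_
  rw [Matrix.l2_opNorm_conjTranspose]
  nlinarith [norm_nonneg Q, h.nonneg, mul_le_mul_of_nonneg_left hQ1 h.nonneg,
    mul_le_mul_of_nonneg_left hQ1 (mul_nonneg (norm_nonneg Q) h.nonneg)]

theorem traceBound_of_posSemidef {M : Matrix ι ι ℂ} (hM : M.PosSemidef) :
    TraceBound M M.trace.re := by
  obtain ⟨Q, hQ, -, hM'⟩ := exists_unitary_diagonal hM.isHermitian
  set e := hM.isHermitian.eigenvalues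
  have he : ∀ i, 0 ≤ e i := hM.eigenvalues_nonneg
  have htr : M.trace.re = ∑ i, e i := by
    rw [hM', trace_conj_unitary hQ, Matrix.trace_diagonal]
    simp
  rw [htr, hM']
  refine TraceBound.conj_unitary hQ fun W hW => ?_
  simp only [Matrix.trace, Matrix.diag, Matrix.mul_diagonal]
  refine (norm_sum_le _ _).trans (Finset.sum_le_sum fun i _ => ?_)
  rw [norm_mul, Complex.norm_real, Real.norm_of_nonneg (he i)]
  exact mul_le_of_le_one_left (he i) ((norm_entry_le W i i).trans hW)

end Spectral

/-! ### The trace norm agrees with its dual description -/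

section TraceNorm

variable {d : ℕ}

/-- In an eigenbasis `Q` of `Mᴴ * M` the columns of `M * Q` have lengths equal to the singular
values, while the rows of `Qᴴ * W` have length at most 1. Cauchy–Schwarz on each index gives the
claim. -/
theorem traceBound_traceNorm (M : Matrix (Fin d) (Fin d) ℂ) : TraceBound M (traceNorm M) := by
  intro W hW
  set hH := Matrix.isHermitian_conjTranspose_mul_self M
  obtain ⟨Q, hQ, hQ', hM⟩ := exists_unitary_diagonal hH
  set e := hH.eigenvalues with he
  have hcol : ∀ i, ∑ k, ‖(M * Q) k i‖ ^ 2 = e i := by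
    intro i
    have h1 : (M * Q)ᴴ * (M * Q) = Matrix.diagonal (fun i => (e i : ℂ)) := by
      rw [Matrix.conjTranspose_mul, Matrix.mul_assoc, ← Matrix.mul_assoc Mᴴ, hM]
      simp only [Matrix.mul_assoc, hQ, Matrix.mul_one]
      rw [← Matrix.mul_assoc, hQ, Matrix.one_mul]
    have h2 := congrFun (congrFun h1 i) i
    rw [Matrix.mul_apply, Matrix.diagonal_apply_eq] at h2
    simp only [Matrix.conjTranspose_apply] at h2
    have h3 : ((∑ k, ‖(M * Q) k i‖ ^ 2 : ℝ) : ℂ) = (e i : ℂ) := by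
      rw [← h2]; push_cast
      exact Finset.sum_congr rfl fun k _ => by simp [Complex.conj_mul']
    exact_mod_cast h3
  have htr : (W * M).trace = ∑ i, ∑ k, (Qᴴ * W) i k * (M * Q) k i := by
    rw [← trace_conj_unitary (Q := Qᴴ) (by simpa using hQ') (W * M)]
    simp only [Matrix.conjTranspose_conjTranspose, Matrix.trace, Matrix.diag]
    refine Finset.sum_congr rfl fun i _ => ?_
    rw [← Matrix.mul_apply, Matrix.mul_assoc, Matrix.mul_assoc, Matrix.mul_assoc]
  rw [htr]
  refine (norm_sum_le _ _).trans (Finset.sum_le_sum fun i _ => ?_)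
  refine (norm_sum_le _ _).trans ?_
  have hrow : ∑ k, ‖(Qᴴ * W) i k‖ ^ 2 ≤ 1 := by
    refine (sum_row_norm_sq_le _ i).trans ?_
    have h1 : ‖Qᴴ * W‖ ≤ 1 := by
      refine (norm_mul_le _ _).trans ?_
      have := norm_le_one_of_conjTranspose_mul_self hQ
      rw [Matrix.l2_opNorm_conjTranspose]
      nlinarith [norm_nonneg W, norm_nonneg Q]
    nlinarith [norm_nonneg (Qᴴ * W)]
  simp only [norm_mul]
  refine (Real.sum_mul_le_sqrt_mul_sqrt _ _ _).trans ?_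
  rw [hcol i]
  exact mul_le_of_le_one_left (Real.sqrt_nonneg _) (Real.sqrt_le_one.mpr hrow)

/-- The supremum in the duality is attained at the adjoint of the partial isometry in the polar
decomposition, written `Q * Bᴴ` with `B` the normalised columns of `M * Q`. -/
theorem exists_trace_mul_eq_traceNorm (M : Matrix (Fin d) (Fin d) ℂ) :
    ∃ W : Matrix (Fin d) (Fin d) ℂ, ‖W‖ ≤ 1 ∧ (W * M).trace = (traceNorm M : ℂ) := by
  set hH := Matrix.isHermitian_conjTranspose_mul_self M
  obtain ⟨Q, hQ, hQ', hM⟩ := exists_unitary_diagonal hH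
  set e := hH.eigenvalues with he
  have hpos : ∀ i, 0 ≤ e i := (Matrix.posSemidef_conjTranspose_mul_self M).eigenvalues_nonneg
  -- Where the singular value vanishes, `0⁻¹ = 0` drops that column; this is why a partial isometry
  -- results.
  set D : Matrix (Fin d) (Fin d) ℂ := Matrix.diagonal fun i => (((√(e i))⁻¹ : ℝ) : ℂ) with hD
  have hDh : Dᴴ = D := by
    rw [hD, Matrix.diagonal_conjTranspose]; congr 1; funext i; simp
  set B := M * Q * D with hB
  have hBB : Bᴴ * B = Matrix.diagonal fun i => (((√(e i))⁻¹ * e i * (√(e i))⁻¹ : ℝ) : ℂ) := by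
    have h1 : Bᴴ * B = D * (Qᴴ * (Mᴴ * M) * Q) * D := by
      simp only [hB, Matrix.conjTranspose_mul, hDh, Matrix.mul_assoc]
    have h2 : Qᴴ * (Mᴴ * M) * Q = Matrix.diagonal (fun i => (e i : ℂ)) := by
      rw [hM]
      simp only [Matrix.mul_assoc, hQ, Matrix.mul_one]
      rw [← Matrix.mul_assoc, hQ, Matrix.one_mul]
    rw [h1, h2, hD, Matrix.diagonal_mul_diagonal, Matrix.diagonal_mul_diagonal]
    congr 1; funext i; push_cast; ring
  have hB1 : ‖B‖ ≤ 1 := by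
    have h1 : ‖Bᴴ * B‖ ≤ 1 := by
      rw [hBB]
      refine norm_diagonal_le zero_le_one fun i => ?_
      rw [Complex.norm_real, Real.norm_eq_abs]
      by_cases h0 : √(e i) = 0
      · simp [h0]
      · rw [← Real.sq_sqrt (hpos i)]
        rw [Real.sqrt_sq (Real.sqrt_nonneg _)]
        field_simp; simp
    rw [Matrix.l2_opNorm_conjTranspose_mul_self] at h1
    nlinarith [norm_nonneg B]
  refine ⟨Q * Bᴴ, ?_, ?_⟩
  · refine (norm_mul_le _ _).trans ?_
    rw [Matrix.l2_opNorm_conjTranspose]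
    have := norm_le_one_of_conjTranspose_mul_self hQ
    nlinarith [norm_nonneg B, norm_nonneg Q]
  · have h1 : Q * Bᴴ * M = Q * (D * Matrix.diagonal (fun i => (e i : ℂ))) * Qᴴ := by
      have : Q * Bᴴ * M = Q * D * Qᴴ * (Mᴴ * M) := by
        simp only [hB, Matrix.conjTranspose_mul, hDh, Matrix.mul_assoc]
      rw [this, hM]
      simp only [Matrix.mul_assoc]
      rw [← Matrix.mul_assoc Qᴴ Q, hQ, Matrix.one_mul]
    rw [h1, trace_conj_unitary hQ, hD, Matrix.diagonal_mul_diagonal, Matrix.trace_diagonal]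
    unfold traceNorm
    push_cast
    refine Finset.sum_congr rfl fun i _ => ?_
    have h3 : (√(e i))⁻¹ * e i = √(e i) := by
      by_cases h0 : √(e i) = 0
      · simp [h0]
      · nth_rewrite 2 [← Real.mul_self_sqrt (hpos i)]
        field_simp
    rw [← Complex.ofReal_inv, ← Complex.ofReal_mul, h3]

theorem traceNorm_nonneg (M : Matrix (Fin d) (Fin d) ℂ) : 0 ≤ traceNorm M :=
  (traceBound_traceNorm M).nonneg

theorem traceNorm_le_iff {M : Matrix (Fin d) (Fin d) ℂ} {c : ℝ} :
    traceNorm M ≤ c ↔ TraceBound M c := by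
  refine ⟨fun h => (traceBound_traceNorm M).mono h, fun h => ?_⟩
  obtain ⟨W, hW, hWM⟩ := exists_trace_mul_eq_traceNorm M
  have := h W hW
  rwa [hWM, Complex.norm_real, Real.norm_of_nonneg (traceNorm_nonneg M)] at this

theorem traceNorm_add_le (M N : Matrix (Fin d) (Fin d) ℂ) :
    traceNorm (M + N) ≤ traceNorm M + traceNorm N :=
  traceNorm_le_iff.2 ((traceBound_traceNorm M).add (traceBound_traceNorm N))

theorem traceNorm_sub_comm (M N : Matrix (Fin d) (Fin d) ℂ) :
    traceNorm (M - N) = traceNorm (N - M) := by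
  have key : ∀ A B : Matrix (Fin d) (Fin d) ℂ, traceNorm (A - B) ≤ traceNorm (B - A) := by
    intro A B
    rw [traceNorm_le_iff, ← neg_sub]
    exact (traceBound_traceNorm _).neg
  exact le_antisymm (key M N) (key N M)

/-- A traceless Hermitian matrix is a multiple of a difference of two states. -/
theorem exists_states_of_traceless [NeZero d] {X : Matrix (Fin d) (Fin d) ℂ} (hX : X.IsHermitian)
    (h0 : X.trace = 0) : ∃ ρ₁ ρ₂ : Matrix (Fin d) (Fin d) ℂ, ∃ c : ℝ, IsState ρ₁ ∧ IsState ρ₂ ∧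
      0 ≤ c ∧ 2 * c ≤ traceNorm X ∧ X = (c : ℂ) • (ρ₁ - ρ₂) := by
  obtain ⟨Q, hQ, hQ', hXQ⟩ := exists_unitary_diagonal hX
  set e := hX.eigenvalues with he
  have hsum : ∑ i, e i = 0 := by
    rw [hXQ, trace_conj_unitary hQ, Matrix.trace_diagonal] at h0
    exact_mod_cast h0
  set c := ∑ i, max (e i) 0 with hc
  have hc' : ∑ i, max (-e i) 0 = c := by
    have : ∑ i, (max (e i) 0 - max (-e i) 0) = ∑ i, e i := by
      refine Finset.sum_congr rfl fun i _ => ?_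
      rcases le_total (e i) 0 with h | h
      · rw [max_eq_right h, max_eq_left (by linarith)]; ring
      · rw [max_eq_left h, max_eq_right (by linarith)]; ring
    rw [Finset.sum_sub_distrib, hsum] at this
    linarith
  have hc0 : 0 ≤ c := Finset.sum_nonneg fun i _ => le_max_right _ _
  have hle : 2 * c ≤ traceNorm X := by
    -- The sign of `X` is a contraction whose pairing with `X` is the sum of the positive and
    -- negative parts, that is `2 * c`.
    set S : Matrix (Fin d) (Fin d) ℂ :=
      Q * Matrix.diagonal (fun i => if 0 ≤ e i then (1 : ℂ) else -1) * Qᴴ with hS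
    have hS1 : ‖S‖ ≤ 1 := by
      have h1 := norm_le_one_of_conjTranspose_mul_self hQ
      have h2 : ‖Matrix.diagonal (fun i => if 0 ≤ e i then (1 : ℂ) else -1)‖ ≤ 1 :=
        norm_diagonal_le zero_le_one fun i => by split_ifs <;> simp
      refine (norm_mul_le _ _).trans ?_
      rw [Matrix.l2_opNorm_conjTranspose]
      refine mul_le_one₀ ((norm_mul_le _ _).trans ?_) (norm_nonneg _) h1
      exact mul_le_one₀ h1 (norm_nonneg _) h2
    have h3 := traceBound_traceNorm X S hS1
    have h4 : (S * X).trace = ((2 * c : ℝ) : ℂ) := by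
      have : S * X = Q * (Matrix.diagonal (fun i => if 0 ≤ e i then (1 : ℂ) else -1)
          * Matrix.diagonal (fun i => (e i : ℂ))) * Qᴴ := by
        rw [hS]; nth_rewrite 1 [hXQ]
        simp only [Matrix.mul_assoc]
        rw [← Matrix.mul_assoc Qᴴ Q, hQ, Matrix.one_mul]
      rw [this, trace_conj_unitary hQ, Matrix.diagonal_mul_diagonal, Matrix.trace_diagonal]
      have h5 : 2 * c = ∑ i, (max (e i) 0 + max (-e i) 0) := by
        rw [Finset.sum_add_distrib, hc', ← hc]; ring
      rw [h5]; push_cast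
      refine Finset.sum_congr rfl fun i _ => ?_
      rcases lt_or_ge (e i) 0 with h | h
      · rw [if_neg (not_le.2 h)]
        norm_cast
        rw [max_eq_right h.le, max_eq_left (by linarith)]; push_cast; ring
      · rw [if_pos h]
        norm_cast
        rw [max_eq_left h, max_eq_right (by linarith)]; ring
    rw [h4, Complex.norm_real, Real.norm_of_nonneg (by positivity)] at h3
    exact h3
  have hposd : ∀ v : Fin d → ℝ, (∀ i, 0 ≤ v i) →
      (Q * Matrix.diagonal (fun i => (v i : ℂ)) * Qᴴ).PosSemidef := fun v hv =>
    (Matrix.PosSemidef.diagonal (fun i => by simpa using hv i)).mul_mul_conjTranspose_same Q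
  have hstate : ∀ v : Fin d → ℝ, (∀ i, 0 ≤ v i) → ∑ i, v i = 1 →
      IsState (Q * Matrix.diagonal (fun i => (v i : ℂ)) * Qᴴ) := fun v hv h1 =>
    ⟨hposd v hv, by
      rw [trace_conj_unitary hQ, Matrix.trace_diagonal]; exact_mod_cast h1⟩
  rcases hc0.eq_or_lt with h | h
  · have hz : ∀ i, e i = 0 := by
      intro i
      have h1 := (Finset.sum_eq_zero_iff_of_nonneg
        (fun i _ => le_max_right (e i) 0)).1 h.symm i (Finset.mem_univ i)
      have h2 := (Finset.sum_eq_zero_iff_of_nonneg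
        (fun i _ => le_max_right (-e i) 0)).1 (hc'.trans h.symm) i (Finset.mem_univ i)
      have h3 := le_max_left (e i) 0
      have h4 := le_max_left (-e i) 0
      linarith
    -- Here `X = 0` and `c = 0`, so any state serves; this one exists because `d ≠ 0`.
    have hst := hstate (Pi.single 0 1) (fun i => by
      by_cases hi : i = 0 <;> simp [hi]) (by simp)
    refine ⟨_, _, 0, hst, hst, le_rfl, by simpa using traceNorm_nonneg X, ?_⟩
    rw [hXQ]; simp [hz]
  · refine ⟨_, _, c, hstate (fun i => c⁻¹ * max (e i) 0)
      (fun i => by have := le_max_right (e i) 0; positivity) ?_,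
      hstate (fun i => c⁻¹ * max (-e i) 0)
      (fun i => by have := le_max_right (-e i) 0; positivity) ?_, hc0, hle, ?_⟩
    · rw [← Finset.mul_sum, ← hc, inv_mul_cancel₀ h.ne']
    · rw [← Finset.mul_sum, hc', inv_mul_cancel₀ h.ne']
    · rw [← Matrix.sub_mul, ← Matrix.mul_sub, Matrix.diagonal_sub, ← Matrix.smul_mul,
        ← Matrix.mul_smul, ← Matrix.diagonal_smul]
      nth_rewrite 1 [hXQ]
      congr 3; funext i
      simp only [Pi.smul_apply, smul_eq_mul]
      rw [← Complex.ofReal_sub, ← Complex.ofReal_mul]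
      congr 1
      rw [← mul_sub, mul_inv_cancel_left₀ h.ne']
      rcases le_total (e i) 0 with h | h
      · rw [max_eq_right h, max_eq_left (by linarith)]; ring
      · rw [max_eq_left h, max_eq_right (by linarith)]; ring

end TraceNorm

/-! ### The Dyson series: convergence, differential equation, unitarity, measurability -/

section Dyson

variable {ι : Type*} [Fintype ι] [DecidableEq ι]

/-- Joint continuity in a parameter is used later with the bath frequency as the parameter. -/
theorem continuous_dysonTerm_param {X : Type*} [TopologicalSpace X] [FirstCountableTopology X]
    {h : X → ℝ → Matrix ι ι ℂ} (hh : Continuous fun p : X × ℝ => h p.1 p.2) (t₀ : ℝ) (n : ℕ) :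
    Continuous fun p : X × ℝ => dysonTerm (h p.1) t₀ n p.2 := by
  induction n with
  | zero => exact continuous_const
  | succ n ih =>
    refine intervalIntegral.continuous_parametric_intervalIntegral_of_continuous
      (f := fun (p : X × ℝ) s => (-Complex.I) • (h p.1 s * dysonTerm (h p.1) t₀ n s)) ?_
      continuous_snd
    have h1 : Continuous fun q : (X × ℝ) × ℝ => (q.1.1, q.2) := by fun_prop
    exact ((hh.comp h1).mul (ih.comp h1)).const_smul (-Complex.I)

theorem continuous_dysonTerm {𝓗 : ℝ → Matrix ι ι ℂ} (h : Continuous 𝓗) (t₀ : ℝ) (n : ℕ) :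
    Continuous (dysonTerm 𝓗 t₀ n) := by
  have := continuous_dysonTerm_param (X := Unit) (h := fun _ => 𝓗) (h.comp continuous_snd) t₀ n
  exact this.comp (f := fun t : ℝ => ((), t)) (by fun_prop)

omit [DecidableEq ι] in
theorem continuous_dysonIntegrand {𝓗 D : ℝ → Matrix ι ι ℂ} (h : Continuous 𝓗)
    (hD : Continuous D) : Continuous fun s => (-Complex.I) • (𝓗 s * D s) := by
  fun_prop

theorem norm_dysonTerm_le {𝓗 : ℝ → Matrix ι ι ℂ} (h : Continuous 𝓗) {K : ℝ}
    (hK : ∀ s, ‖𝓗 s‖ ≤ K) (t₀ : ℝ) (n : ℕ) (t : ℝ) :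
    ‖dysonTerm 𝓗 t₀ n t‖ ≤ (K * |t - t₀|) ^ n / n.factorial := by
  have hK0 : 0 ≤ K := (norm_nonneg _).trans (hK 0)
  induction n generalizing t with
  | zero => simpa [dysonTerm] using norm_one_le_one
  | succ n ih =>
    have h1 : ‖dysonTerm 𝓗 t₀ (n + 1) t‖
        ≤ ∫ s in Set.uIoc t₀ t, K ^ (n + 1) / n.factorial * |s - t₀| ^ n := by
      have hc : Continuous fun s : ℝ => K ^ (n + 1) / n.factorial * |s - t₀| ^ n := by fun_prop
      refine (intervalIntegral.norm_integral_le_integral_norm_uIoc).trans ?_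
      refine setIntegral_mono_on ?_ ?_ measurableSet_uIoc fun s _ => ?_
      · exact ((continuous_dysonIntegrand h (continuous_dysonTerm h t₀ n)).norm.intervalIntegrable
          t₀ t).def'
      · exact (hc.intervalIntegrable t₀ t).def'
      · rw [norm_smul, norm_neg, Complex.norm_I, one_mul]
        refine (norm_mul_le _ _).trans ?_
        refine (mul_le_mul (hK s) (ih s) (norm_nonneg _) hK0).trans (le_of_eq ?_)
        rw [mul_pow]; ring
    refine h1.trans (le_of_eq ?_)
    rw [integral_const_mul, integral_pow_abs_sub_uIoc, Nat.factorial_succ]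
    push_cast
    field_simp
    ring

theorem summable_dysonBound (K : ℝ) : Summable fun n : ℕ => K ^ n / n.factorial :=
  Real.summable_pow_div_factorial K

theorem summable_dysonTerm {𝓗 : ℝ → Matrix ι ι ℂ} (h : Continuous 𝓗) {K : ℝ}
    (hK : ∀ s, ‖𝓗 s‖ ≤ K) (t₀ t : ℝ) : Summable fun n => dysonTerm 𝓗 t₀ n t :=
  Summable.of_norm_bounded (summable_dysonBound (K * |t - t₀|))
    fun n => norm_dysonTerm_le h hK t₀ n t

theorem continuous_timeOrderedExp {𝓗 : ℝ → Matrix ι ι ℂ} (h : Continuous 𝓗) {K : ℝ}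
    (hK : ∀ s, ‖𝓗 s‖ ≤ K) (t₀ : ℝ) : Continuous (timeOrderedExp 𝓗 t₀) := by
  have hK0 : 0 ≤ K := (norm_nonneg _).trans (hK 0)
  rw [continuous_iff_continuousAt]
  intro t
  have h1 : ContinuousOn (timeOrderedExp 𝓗 t₀) (Metric.ball t₀ (|t - t₀| + 1)) := by
    refine continuousOn_tsum (fun n => (continuous_dysonTerm h t₀ n).continuousOn)
      (summable_dysonBound (K * (|t - t₀| + 1))) fun n s hs => ?_
    refine (norm_dysonTerm_le h hK t₀ n s).trans ?_
    rw [Metric.mem_ball, Real.dist_eq] at hs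
    gcongr
  exact h1.continuousAt (Metric.isOpen_ball.mem_nhds (by simp [Real.dist_eq]))

theorem timeOrderedExp_eq_integral {𝓗 : ℝ → Matrix ι ι ℂ} (h : Continuous 𝓗) {K : ℝ}
    (hK : ∀ s, ‖𝓗 s‖ ≤ K) (t₀ t : ℝ) :
    timeOrderedExp 𝓗 t₀ t
      = 1 + ∫ s in t₀..t, (-Complex.I) • (𝓗 s * timeOrderedExp 𝓗 t₀ s) := by
  have hK0 : 0 ≤ K := (norm_nonneg _).trans (hK 0)
  have hs := summable_dysonTerm h hK t₀
  have h1 : HasSum (fun n => dysonTerm 𝓗 t₀ (n + 1) t)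
      (∫ s in t₀..t, (-Complex.I) • (𝓗 s * timeOrderedExp 𝓗 t₀ s)) := by
    refine intervalIntegral.hasSum_integral_of_dominated_convergence
      (F := fun n s => (-Complex.I) • (𝓗 s * dysonTerm 𝓗 t₀ n s))
      (fun n _ => K * ((K * |t - t₀|) ^ n / n.factorial)) (fun n => ?_) (fun n => ?_) ?_ ?_ ?_
    · exact (continuous_dysonIntegrand h (continuous_dysonTerm h t₀ n)).aestronglyMeasurable
    · refine ae_of_all _ fun s hs => ?_
      rw [norm_smul, norm_neg, Complex.norm_I, one_mul]
      refine (norm_mul_le _ _).trans (mul_le_mul (hK s) ?_ (norm_nonneg _) hK0)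
      refine (norm_dysonTerm_le h hK t₀ n s).trans ?_
      have : |s - t₀| ≤ |t - t₀| := by
        rcases Set.mem_uIoc.1 hs with hs | hs
        · rw [abs_of_nonneg (by linarith), abs_of_nonneg (by linarith)]; linarith
        · rw [abs_of_nonpos (by linarith), abs_of_nonpos (by linarith)]; linarith
      gcongr
    · exact ae_of_all _ fun s _ => (summable_dysonBound _).mul_left K
    · exact intervalIntegrable_const
    · refine ae_of_all _ fun s _ => ?_
      exact (((hs s).hasSum).mul_left (𝓗 s)).const_smul (-Complex.I)
  have h2 := (hs t).tsum_eq_zero_add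
  unfold timeOrderedExp
  rw [h2, h1.tsum_eq]
  rfl

theorem hasDerivAt_timeOrderedExp {𝓗 : ℝ → Matrix ι ι ℂ} (h : Continuous 𝓗) {K : ℝ}
    (hK : ∀ s, ‖𝓗 s‖ ≤ K) (t₀ t : ℝ) :
    HasDerivAt (timeOrderedExp 𝓗 t₀) ((-Complex.I) • (𝓗 t * timeOrderedExp 𝓗 t₀ t)) t := by
  have hc : Continuous fun s => (-Complex.I) • (𝓗 s * timeOrderedExp 𝓗 t₀ s) :=
    continuous_dysonIntegrand h (continuous_timeOrderedExp h hK t₀)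
  have h1 := (intervalIntegral.integral_hasDerivAt_right (hc.intervalIntegrable t₀ t)
    hc.aestronglyMeasurable.stronglyMeasurableAtFilter hc.continuousAt).const_add (1 : Matrix ι ι ℂ)
  exact h1.congr_of_eventuallyEq
    (Filter.Eventually.of_forall fun s => timeOrderedExp_eq_integral h hK t₀ s)

theorem timeOrderedExp_self {𝓗 : ℝ → Matrix ι ι ℂ} (h : Continuous 𝓗) {K : ℝ}
    (hK : ∀ s, ‖𝓗 s‖ ≤ K) (t₀ : ℝ) : timeOrderedExp 𝓗 t₀ t₀ = 1 := by
  rw [timeOrderedExp_eq_integral h hK]; simp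

theorem timeOrderedExp_unitary {𝓗 : ℝ → Matrix ι ι ℂ} (h : Continuous 𝓗) {K : ℝ}
    (hK : ∀ s, ‖𝓗 s‖ ≤ K) (hH : ∀ s, (𝓗 s).IsHermitian) (t₀ t : ℝ) :
    (timeOrderedExp 𝓗 t₀ t)ᴴ * timeOrderedExp 𝓗 t₀ t = 1 := by
  have hd : ∀ s, HasDerivAt (fun s => (timeOrderedExp 𝓗 t₀ s)ᴴ * timeOrderedExp 𝓗 t₀ s) 0 s := by
    intro s
    have h1 := hasDerivAt_timeOrderedExp h hK t₀ s
    have h2 : HasDerivAt (fun s => (timeOrderedExp 𝓗 t₀ s)ᴴ)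
      ((-Complex.I) • (𝓗 s * timeOrderedExp 𝓗 t₀ s))ᴴ s := h1.star
    refine (h2.fun_mul h1).congr_deriv ?_
    rw [Matrix.conjTranspose_smul, Matrix.conjTranspose_mul, (hH s).eq]
    simp [Matrix.mul_assoc]
  have hc := is_const_of_deriv_eq_zero (fun s => (hd s).differentiableAt) (fun s => (hd s).deriv)
    t t₀
  simpa [timeOrderedExp_self h hK t₀] using hc

/-- The bound `K` may grow with `ω`, so only pointwise convergence of the partial sums is used: a
limit of continuous functions is measurable, which suffices for integrating the step over `ω`. -/
theorem stronglyMeasurable_timeOrderedExp {h : ℝ → ℝ → Matrix ι ι ℂ}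
    (hh : Continuous fun p : ℝ × ℝ => h p.1 p.2) (hK : ∀ ω, ∃ K, ∀ s, ‖h ω s‖ ≤ K) (t₀ t : ℝ) :
    StronglyMeasurable fun ω => timeOrderedExp (h ω) t₀ t := by
  refine stronglyMeasurable_of_tendsto (u := Filter.atTop)
    (f := fun N ω => ∑ n ∈ Finset.range N, dysonTerm (h ω) t₀ n t) (fun N => ?_) ?_
  · refine Continuous.stronglyMeasurable (continuous_finsetSum _ fun n _ => ?_)
    exact (continuous_dysonTerm_param hh t₀ n).comp
      (Continuous.prodMk continuous_id continuous_const)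
  · rw [tendsto_pi_nhds]
    intro ω
    obtain ⟨K, hK⟩ := hK ω
    exact (summable_dysonTerm (hh.comp (Continuous.prodMk continuous_const continuous_id)) hK
      t₀ t).hasSum.tendsto_sum_nat

end Dyson

/-! ### Tensor products with system and bath -/

section Kronecker

variable {m n : Type*} [Fintype m] [DecidableEq m] [Fintype n] [DecidableEq n]

/-- `A ↦ A ⊗ 1` as a star homomorphism. -/
noncomputable def kronLeft (m n : Type*) [Fintype m] [DecidableEq m] [Fintype n] [DecidableEq n] :
    Matrix m m ℂ →⋆ₐ[ℂ] Matrix (m × n) (m × n) ℂ where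
  toFun A := A ⊗ₖ (1 : Matrix n n ℂ)
  map_one' := Matrix.one_kronecker_one
  map_mul' A B := by rw [← Matrix.mul_kronecker_mul, Matrix.one_mul]
  map_zero' := Matrix.zero_kronecker _
  map_add' A B := Matrix.add_kronecker _ _ _
  commutes' r := by
    rw [Algebra.algebraMap_eq_smul_one, Algebra.algebraMap_eq_smul_one, Matrix.smul_kronecker,
      Matrix.one_kronecker_one]
  map_star' A := by
    rw [Matrix.star_eq_conjTranspose, Matrix.star_eq_conjTranspose,
      Matrix.conjTranspose_kronecker, Matrix.conjTranspose_one]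

/-- `B ↦ 1 ⊗ B` as a star homomorphism. -/
noncomputable def kronRight (m n : Type*) [Fintype m] [DecidableEq m] [Fintype n] [DecidableEq n] :
    Matrix n n ℂ →⋆ₐ[ℂ] Matrix (m × n) (m × n) ℂ where
  toFun B := (1 : Matrix m m ℂ) ⊗ₖ B
  map_one' := Matrix.one_kronecker_one
  map_mul' A B := by rw [← Matrix.mul_kronecker_mul, Matrix.one_mul]
  map_zero' := Matrix.kronecker_zero _
  map_add' A B := Matrix.kronecker_add _ _ _
  commutes' r := by
    rw [Algebra.algebraMap_eq_smul_one, Algebra.algebraMap_eq_smul_one, Matrix.kronecker_smul,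
      Matrix.one_kronecker_one]
  map_star' A := by
    rw [Matrix.star_eq_conjTranspose, Matrix.star_eq_conjTranspose,
      Matrix.conjTranspose_kronecker, Matrix.conjTranspose_one]

theorem kronecker_eq_mul (A : Matrix m m ℂ) (B : Matrix n n ℂ) :
    A ⊗ₖ B = kronLeft m n A * kronRight m n B := by
  change _ = (A ⊗ₖ (1 : Matrix n n ℂ)) * ((1 : Matrix m m ℂ) ⊗ₖ B)
  rw [← Matrix.mul_kronecker_mul, Matrix.mul_one, Matrix.one_mul]

/-- Each tensor factor embeds by a star homomorphism of C⋆-algebras, and these are contractive. -/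
theorem norm_kronecker_le (A : Matrix m m ℂ) (B : Matrix n n ℂ) : ‖A ⊗ₖ B‖ ≤ ‖A‖ * ‖B‖ := by
  rw [kronecker_eq_mul]
  exact (norm_mul_le _ _).trans (mul_le_mul (NonUnitalStarAlgHom.norm_apply_le _ A)
    (NonUnitalStarAlgHom.norm_apply_le _ B) (norm_nonneg _) (norm_nonneg _))

theorem continuous_kronLeft : Continuous (kronLeft m n) :=
  LinearMap.continuous_of_finiteDimensional (kronLeft m n).toAlgHom.toLinearMap

theorem continuous_kronRight : Continuous (kronRight m n) :=
  LinearMap.continuous_of_finiteDimensional (kronRight m n).toAlgHom.toLinearMap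

theorem Continuous.kronecker {X : Type*} [TopologicalSpace X] {A : X → Matrix m m ℂ}
    {B : X → Matrix n n ℂ} (hA : Continuous A) (hB : Continuous B) :
    Continuous fun x => A x ⊗ₖ B x := by
  simp only [kronecker_eq_mul]
  exact (continuous_kronLeft.comp hA).mul (continuous_kronRight.comp hB)

theorem HasDerivAt.kronecker {A : ℝ → Matrix m m ℂ} {B : ℝ → Matrix n n ℂ} {A' : Matrix m m ℂ}
    {B' : Matrix n n ℂ} {t : ℝ} (hA : HasDerivAt A A' t) (hB : HasDerivAt B B' t) :
    HasDerivAt (fun s => A s ⊗ₖ B s) (A' ⊗ₖ B t + A t ⊗ₖ B') t := by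
  have h1 : HasDerivAt (fun s => kronLeft m n (A s)) (kronLeft m n A') t := by
    let L : Matrix m m ℂ →L[ℝ] Matrix (m × n) (m × n) ℂ :=
      LinearMap.toContinuousLinearMap ((kronLeft m n).toAlgHom.toLinearMap.restrictScalars ℝ)
    exact L.hasFDerivAt.comp_hasDerivAt t hA
  have h2 : HasDerivAt (fun s => kronRight m n (B s)) (kronRight m n B') t := by
    let L : Matrix n n ℂ →L[ℝ] Matrix (m × n) (m × n) ℂ :=
      LinearMap.toContinuousLinearMap ((kronRight m n).toAlgHom.toLinearMap.restrictScalars ℝ)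
    exact L.hasFDerivAt.comp_hasDerivAt t hB
  simp only [kronecker_eq_mul]
  exact h1.fun_mul h2

end Kronecker

/-! ### The partial trace over the bath -/

section PartialTrace

variable {d : ℕ}

theorem traceBath_add (M N : Matrix (Fin d × Fin 2) (Fin d × Fin 2) ℂ) :
    traceBath (M + N) = traceBath M + traceBath N := by
  ext i j; simp [traceBath]; ring

theorem traceBath_smul (c : ℂ) (M : Matrix (Fin d × Fin 2) (Fin d × Fin 2) ℂ) :
    traceBath (c • M) = c • traceBath M := by
  ext i j; simp [traceBath]; ring

/-- The partial trace as a continuous linear map. -/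
noncomputable def traceBathCLM (d : ℕ) :
    Matrix (Fin d × Fin 2) (Fin d × Fin 2) ℂ →L[ℂ] Matrix (Fin d) (Fin d) ℂ :=
  LinearMap.toContinuousLinearMap
    { toFun := traceBath, map_add' := traceBath_add, map_smul' := traceBath_smul }

@[simp] theorem traceBathCLM_apply (M : Matrix (Fin d × Fin 2) (Fin d × Fin 2) ℂ) :
    traceBathCLM d M = traceBath M := rfl

theorem traceBath_sub (M N : Matrix (Fin d × Fin 2) (Fin d × Fin 2) ℂ) :
    traceBath (M - N) = traceBath M - traceBath N :=
  map_sub (traceBathCLM d) M N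

theorem traceBath_kronecker (A : Matrix (Fin d) (Fin d) ℂ) (P : Matrix (Fin 2) (Fin 2) ℂ) :
    traceBath (A ⊗ₖ P) = P.trace • A := by
  ext i j; simp [traceBath, Matrix.trace, Matrix.kroneckerMap_apply]; ring

/-- The partial trace is dual to `W ↦ W ⊗ 1`, which does not increase the operator norm; hence it
does not increase the trace norm. -/
theorem trace_mul_traceBath (W : Matrix (Fin d) (Fin d) ℂ)
    (M : Matrix (Fin d × Fin 2) (Fin d × Fin 2) ℂ) :
    (W * traceBath M).trace = ((W ⊗ₖ (1 : Matrix (Fin 2) (Fin 2) ℂ)) * M).trace := by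
  simp only [Matrix.trace, Matrix.diag, Matrix.mul_apply, traceBath, Matrix.of_apply,
    Fintype.sum_prod_type, Matrix.kroneckerMap_apply, Fin.sum_univ_two, Matrix.one_apply]
  simp [← Finset.sum_add_distrib, mul_add]

theorem TraceBound.traceBath {M : Matrix (Fin d × Fin 2) (Fin d × Fin 2) ℂ} {c : ℝ}
    (h : TraceBound M c) : TraceBound (traceBath M) c := fun W hW => by
  rw [trace_mul_traceBath]
  refine h _ ((norm_kronecker_le _ _).trans ?_)
  exact mul_le_one₀ hW (norm_nonneg _) norm_one_le_one

theorem traceBath_mul_kronecker_one (M : Matrix (Fin d × Fin 2) (Fin d × Fin 2) ℂ)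
    (X Y : Matrix (Fin d) (Fin d) ℂ) :
    traceBath ((X ⊗ₖ (1 : Matrix (Fin 2) (Fin 2) ℂ)) * M * (Y ⊗ₖ (1 : Matrix (Fin 2) (Fin 2) ℂ)))
      = X * traceBath M * Y := by
  ext i j
  simp only [Matrix.mul_apply, traceBath, Matrix.of_apply,
    Fintype.sum_prod_type, Matrix.kroneckerMap_apply, Fin.sum_univ_two, Matrix.one_apply]
  simp [Finset.sum_add_distrib, mul_add, add_mul]

/-- Operators `W ⊗ 1` commute with bath unitaries, so cyclicity removes `Q` from every pairing;
pairing with matrix units then recovers the entries. -/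
theorem traceBath_conj_bath {Q : Matrix (Fin 2) (Fin 2) ℂ} (hQ : Qᴴ * Q = 1)
    (M : Matrix (Fin d × Fin 2) (Fin d × Fin 2) ℂ) :
    traceBath (((1 : Matrix (Fin d) (Fin d) ℂ) ⊗ₖ Q) * M
      * ((1 : Matrix (Fin d) (Fin d) ℂ) ⊗ₖ Qᴴ)) = traceBath M := by
  have key : ∀ W : Matrix (Fin d) (Fin d) ℂ, (W * traceBath (((1 : Matrix (Fin d) (Fin d) ℂ) ⊗ₖ Q)
      * M * ((1 : Matrix (Fin d) (Fin d) ℂ) ⊗ₖ Qᴴ))).trace = (W * traceBath M).trace := by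
    intro W
    rw [trace_mul_traceBath, trace_mul_traceBath, ← Matrix.mul_assoc, Matrix.trace_mul_comm,
      ← Matrix.mul_assoc, ← Matrix.mul_assoc, ← Matrix.mul_kronecker_mul,
      ← Matrix.mul_kronecker_mul]
    simp [hQ]
  ext i j
  have := key (Matrix.single j i 1)
  simpa [Matrix.trace_single_mul] using this

end PartialTrace

/-! ### The free propagator -/

section Evolution

variable {ι : Type*} [Fintype ι] [DecidableEq ι]

/-- The propagator `exp(iHs)`. -/
noncomputable def evo (H : Matrix ι ι ℂ) (s : ℝ) : Matrix ι ι ℂ :=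
  NormedSpace.exp ((Complex.I * (s : ℂ)) • H)

theorem evo_eq (H : Matrix ι ι ℂ) (s : ℝ) : evo H s = NormedSpace.exp (s • (Complex.I • H)) := by
  rw [evo, mul_comm, mul_smul]; rfl

theorem hasDerivAt_evo (H : Matrix ι ι ℂ) (s : ℝ) :
    HasDerivAt (evo H) ((Complex.I • H) * evo H s) s := by
  have h := hasDerivAt_exp_smul_const' (𝕂 := ℝ) (Complex.I • H) s
  rw [← evo_eq] at h
  exact h.congr_of_eventuallyEq (Filter.Eventually.of_forall fun t => evo_eq H t)

theorem continuous_evo (H : Matrix ι ι ℂ) : Continuous (evo H) :=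
  continuous_iff_continuousAt.2 fun s => (hasDerivAt_evo H s).continuousAt

theorem evo_conjTranspose {H : Matrix ι ι ℂ} (hH : H.IsHermitian) (s : ℝ) :
    (evo H s)ᴴ = evo H (-s) := by
  rw [evo, ← Matrix.exp_conjTranspose, Matrix.conjTranspose_smul, hH.eq, evo]
  simp

theorem evo_add (H : Matrix ι ι ℂ) (s t : ℝ) : evo H (s + t) = evo H s * evo H t := by
  rw [evo, evo, evo, ← Matrix.exp_add_of_commute]
  · rw [← add_smul]; push_cast; ring_nf
  · exact ((Commute.refl H).smul_left _).smul_right _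

@[simp] theorem evo_zero (H : Matrix ι ι ℂ) : evo H 0 = 1 := by simp [evo]

theorem evo_conjTranspose_mul_self {H : Matrix ι ι ℂ} (hH : H.IsHermitian) (s : ℝ) :
    (evo H s)ᴴ * evo H s = 1 := by
  rw [evo_conjTranspose hH, ← evo_add]; simp

theorem evo_mul_conjTranspose_self {H : Matrix ι ι ℂ} (hH : H.IsHermitian) (s : ℝ) :
    evo H s * (evo H s)ᴴ = 1 := by
  rw [evo_conjTranspose hH, ← evo_add]; simp

theorem norm_evo_le {H : Matrix ι ι ℂ} (hH : H.IsHermitian) (s : ℝ) : ‖evo H s‖ ≤ 1 :=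
  norm_le_one_of_conjTranspose_mul_self (evo_conjTranspose_mul_self hH s)

theorem commute_evo (H : Matrix ι ι ℂ) (s : ℝ) : Commute H (evo H s) :=
  ((Commute.refl H).smul_right _).exp_right

end Evolution

/-! ### Heisenberg evolution of a coupling operator -/

section Heisenberg

variable {d : ℕ} {H : Matrix (Fin d) (Fin d) ℂ}

theorem heis_eq (hH : H.IsHermitian) (A : Matrix (Fin d) (Fin d) ℂ) (s : ℝ) :
    heis H A s = evo H s * A * (evo H s)ᴴ := by
  rw [evo_conjTranspose hH, heis, evo, evo]
  simp

theorem norm_heis_le (hH : H.IsHermitian) (A : Matrix (Fin d) (Fin d) ℂ) (s : ℝ) :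
    ‖heis H A s‖ ≤ ‖A‖ := by
  rw [heis_eq hH]
  refine (norm_mul_le _ _).trans ?_
  rw [Matrix.l2_opNorm_conjTranspose]
  have h1 := norm_evo_le hH s
  refine (mul_le_of_le_one_right (norm_nonneg _) h1).trans ((norm_mul_le _ _).trans ?_)
  exact mul_le_of_le_one_left (norm_nonneg _) h1

theorem continuous_heis (hH : H.IsHermitian) (A : Matrix (Fin d) (Fin d) ℂ) :
    Continuous (heis H A) := by
  have : heis H A = fun s => evo H s * A * evo H (-s) := by
    funext s; rw [heis_eq hH, evo_conjTranspose hH]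
  rw [this]
  exact ((continuous_evo H).mul continuous_const).mul ((continuous_evo H).comp continuous_neg)

theorem heis_conjTranspose (hH : H.IsHermitian) (A : Matrix (Fin d) (Fin d) ℂ) (s : ℝ) :
    (heis H A s)ᴴ = heis H Aᴴ s := by
  rw [heis_eq hH, heis_eq hH]
  simp [Matrix.mul_assoc]

end Heisenberg

/-! ### The bath qubit: its evolution and thermal populations -/

section Bath

theorem bathHam_eq (ω : ℝ) : bathHam ω = Matrix.diagonal ![-(ω : ℂ) / 2, (ω : ℂ) / 2] := by
  ext i j; fin_cases i <;> fin_cases j <;> simp [bathHam]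

theorem bathHam_isHermitian (ω : ℝ) : (bathHam ω).IsHermitian := by
  rw [bathHam_eq]
  refine Matrix.isHermitian_diagonal_of_self_adjoint _ ?_
  rw [isSelfAdjoint_iff]
  ext i; fin_cases i <;> simp

theorem evo_bathHam (ω s : ℝ) : evo (bathHam ω) s = Matrix.diagonal
    ![Complex.exp (-(Complex.I * ((ω * s : ℝ) : ℂ) / 2)),
      Complex.exp (Complex.I * ((ω * s : ℝ) : ℂ) / 2)] := by
  rw [evo, bathHam_eq, ← Matrix.diagonal_smul, Matrix.exp_diagonal]
  congr 1
  ext i; fin_cases i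
  · simp [Pi.coe_exp, ← Complex.exp_eq_exp_ℂ]; congr 1; ring
  · simp [Pi.coe_exp, ← Complex.exp_eq_exp_ℂ]; congr 1; ring

/-- The coupling raises the bath energy by exactly `ω`, so it is an eigenoperator of the bath
evolution. This phase is what probes the system at frequency `-ω`. -/
theorem evo_conj_bathCoupling (ω s : ℝ) :
    evo (bathHam ω) s * bathCoupling * (evo (bathHam ω) s)ᴴ
      = Complex.exp (Complex.I * ((ω * s : ℝ) : ℂ)) • bathCoupling := by
  rw [evo_conjTranspose (bathHam_isHermitian ω), evo_bathHam, evo_bathHam]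
  ext i j
  fin_cases i <;> fin_cases j <;>
    simp [bathCoupling, Matrix.mul_apply, Matrix.diagonal, ← Complex.exp_add]
  ring_nf

/-- Ground and excited state populations of the bath qubit. -/
noncomputable def bathPop (β ω : ℝ) : ℝ := (1 + Real.exp (β * ω))⁻¹

theorem bathPop_nonneg (β ω : ℝ) : 0 ≤ bathPop β ω := by unfold bathPop; positivity

theorem bathPop_add_neg (β ω : ℝ) : bathPop β (-ω) + bathPop β ω = 1 := by
  unfold bathPop
  rw [mul_neg, Real.exp_neg]
  have := Real.exp_pos (β * ω)
  field_simp
  ring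

theorem gibbs_bathHam (β ω : ℝ) : gibbs β (bathHam ω) = Matrix.diagonal
    ![(bathPop β (-ω) : ℂ), (bathPop β ω : ℂ)] := by
  have h1 : NormedSpace.exp (-(β : ℂ) • bathHam ω) = Matrix.diagonal
      ![((Real.exp (β * ω / 2) : ℝ) : ℂ), ((Real.exp (-(β * ω / 2)) : ℝ) : ℂ)] := by
    rw [bathHam_eq, ← Matrix.diagonal_smul, Matrix.exp_diagonal]
    congr 1
    ext i; fin_cases i
    · simp [Pi.coe_exp, ← Complex.exp_eq_exp_ℂ]; congr 1; ring
    · simp [Pi.coe_exp, ← Complex.exp_eq_exp_ℂ]; congr 1; ring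
  rw [gibbs, h1, Matrix.trace_diagonal, ← Matrix.diagonal_smul]
  congr 1
  have h2 : Real.exp (β * ω) = Real.exp (β * ω / 2) * Real.exp (β * ω / 2) := by
    rw [← Real.exp_add]; ring_nf
  have hp := Real.exp_pos (β * ω / 2)
  have hp' := hp.ne'
  ext i; fin_cases i
  · simp only [Fin.sum_univ_two, Pi.smul_apply, smul_eq_mul, Fin.zero_eta, Matrix.cons_val_zero,
      Matrix.cons_val_one, bathPop, ← Complex.ofReal_add, ← Complex.ofReal_inv,
      ← Complex.ofReal_mul]
    congr 1
    rw [mul_neg, Real.exp_neg, Real.exp_neg, h2]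
    field_simp
  · simp only [Fin.sum_univ_two, Pi.smul_apply, smul_eq_mul, Fin.mk_one, Matrix.cons_val_zero,
      Matrix.cons_val_one, bathPop, ← Complex.ofReal_add, ← Complex.ofReal_inv,
      ← Complex.ofReal_mul]
    congr 1
    rw [Real.exp_neg, h2]
    field_simp
    ring

end Bath

/-! ### Second order expansion with a fourth order remainder -/

section Expansion

variable {ι : Type*} [Fintype ι] [DecidableEq ι]

theorem TraceBound.intervalIntegral {F : ℝ → Matrix ι ι ℂ} {a b c : ℝ}
    (hF : IntervalIntegrable F volume a b)
    (hab : a ≤ b) (h : ∀ s ∈ Set.Icc a b, TraceBound (F s) c) :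
    TraceBound (∫ s in a..b, F s) (c * (b - a)) := by
  have h1 := TraceBound.integral (μ := volume.restrict (Set.Ioc a b)) (c := fun _ => c)
    ((intervalIntegrable_iff_integrableOn_Ioc_of_le hab).1 hF) (by simp)
    ((ae_restrict_iff' measurableSet_Ioc).2 (ae_of_all _ fun s hs => h s ⟨hs.1.le, hs.2⟩))
  rw [intervalIntegral.integral_of_le hab]
  simpa [hab, mul_comm] using h1

theorem TraceBound.of_hasDerivAt {F F' : ℝ → Matrix ι ι ℂ} {t₀ t c : ℝ}
    (hF : ∀ s, HasDerivAt F (F' s) s) (hF' : Continuous F') (h0 : F t₀ = 0)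
    (h : ∀ s ∈ Set.Icc t₀ t, TraceBound (F' s) c) {s : ℝ} (hs : s ∈ Set.Icc t₀ t) :
    TraceBound (F s) (c * (t - t₀)) := by
  have h1 := intervalIntegral.integral_eq_sub_of_hasDerivAt (fun x _ => hF x)
    (hF'.intervalIntegrable t₀ s)
  rw [h0, sub_zero] at h1
  rw [← h1]
  have hc : 0 ≤ c := (h s hs).nonneg
  refine (TraceBound.intervalIntegral (hF'.intervalIntegrable t₀ s) hs.1
    fun x hx => h x ⟨hx.1, hx.2.trans hs.2⟩).mono ?_
  have := hs.2
  gcongr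

theorem TraceBound.lie {M : Matrix ι ι ℂ} {c v : ℝ} (h : TraceBound M c) {V : Matrix ι ι ℂ}
    (hV : ‖V‖ ≤ v) : TraceBound ⁅V, M⁆ (2 * v * c) := by
  rw [Ring.lie_def]
  refine ((h.mul_left V).sub (h.mul_right V)).mono ?_
  nlinarith [h.nonneg]

omit [DecidableEq ι] in
theorem matrix_lie_sub (V A B : Matrix ι ι ℂ) : ⁅V, A - B⁆ = ⁅V, A⁆ - ⁅V, B⁆ := by
  simp only [Ring.lie_def, mul_sub, sub_mul]; abel

omit [DecidableEq ι] in
theorem matrix_lie_smul (c : ℂ) (V A : Matrix ι ι ℂ) : ⁅V, c • A⁆ = c • ⁅V, A⁆ := by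
  simp only [Ring.lie_def, Matrix.mul_smul, Matrix.smul_mul, smul_sub]

omit [DecidableEq ι] in
theorem continuous_lie {V M : ℝ → Matrix ι ι ℂ} (hV : Continuous V) (hM : Continuous M) :
    Continuous fun s => ⁅V s, M s⁆ := by
  simp only [Ring.lie_def]; fun_prop

omit [DecidableEq ι] in
theorem continuous_smul_lie (c : ℂ) {V M : ℝ → Matrix ι ι ℂ} (hV : Continuous V)
    (hM : Continuous M) : Continuous fun s => c • ⁅V s, M s⁆ := by
  simp only [Ring.lie_def]; fun_prop

/-- Second-order Dyson expansion of the even part of a state whose odd part vanishes initially,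
with fourth-order remainder. -/
theorem traceBound_even_expansion {V 𝒥 Re Ro : ℝ → Matrix ι ι ℂ} {ϱ : Matrix ι ι ℂ}
    {α v t₀ t : ℝ} (hα : 0 ≤ α) (ht : t₀ ≤ t) (hV : Continuous V) (hv : ∀ s, ‖V s‖ ≤ v)
    (hJ : ∀ s, HasDerivAt 𝒥 (V s) s) (hJ0 : 𝒥 t₀ = 0)
    (he : ∀ s, HasDerivAt Re ((-Complex.I * α) • ⁅V s, Ro s⁆) s)
    (ho : ∀ s, HasDerivAt Ro ((-Complex.I * α) • ⁅V s, Re s⁆) s)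
    (he0 : Re t₀ = ϱ) (ho0 : Ro t₀ = 0) (hb : ∀ s, TraceBound (Re s) 1) :
    TraceBound (Re t - ϱ - ∫ s in t₀..t, (-(α : ℂ) ^ 2) • ⁅V s, ⁅𝒥 s, ϱ⁆⁆)
      ((2 * α * v * (t - t₀)) ^ 4) := by
  have cont : ∀ {F F' : ℝ → Matrix ι ι ℂ}, (∀ s, HasDerivAt F (F' s) s) → Continuous F :=
    fun h => continuous_iff_continuousAt.2 fun s => (h s).continuousAt
  have cRe := cont he
  have cRo := cont ho
  have cJ := cont hJ
  have hn : ‖-Complex.I * (α : ℂ)‖ = α := by simp [abs_of_nonneg hα]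
  have tb : ∀ {M : Matrix ι ι ℂ} {c : ℝ} (s : ℝ), TraceBound M c →
      TraceBound ((-Complex.I * α) • ⁅V s, M⁆) (α * (2 * v * c)) := fun s h => by
    have := (h.lie (hv s)).smul (-Complex.I * α)
    rwa [hn] at this
  -- Bootstrap: each integration of the coupled equations gains a factor `2 * α * v * (t - t₀)`. The
  -- odd part is first order, the change of the even part second order, the odd part minus its
  -- linear term third order, and the final remainder fourth order.
  obtain ⟨c₁, hc₁⟩ : ∃ c, c = α * (2 * v * 1) * (t - t₀) := ⟨_, rfl⟩
  obtain ⟨c₂, hc₂⟩ : ∃ c, c = α * (2 * v * c₁) * (t - t₀) := ⟨_, rfl⟩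
  obtain ⟨c₃, hc₃⟩ : ∃ c, c = α * (2 * v * c₂) * (t - t₀) := ⟨_, rfl⟩
  have s1 : ∀ s ∈ Set.Icc t₀ t, TraceBound (Ro s) c₁ := fun s hs => hc₁ ▸
    TraceBound.of_hasDerivAt ho (continuous_smul_lie _ hV cRe) ho0
      (fun x _ => tb x (hb x)) hs
  have s2 : ∀ s ∈ Set.Icc t₀ t, TraceBound (Re s - ϱ) c₂ := fun s hs => hc₂ ▸
    TraceBound.of_hasDerivAt (fun s => (he s).sub_const ϱ)
      (continuous_smul_lie _ hV cRo) (by rw [he0, sub_self])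
      (fun x hx => tb x (s1 x hx)) hs
  have hL : ∀ s, HasDerivAt (fun s => (-Complex.I * (α : ℂ)) • ⁅𝒥 s, ϱ⁆)
      ((-Complex.I * (α : ℂ)) • ⁅V s, ϱ⁆) s := fun s => by
    simp only [Ring.lie_def]
    exact (((hJ s).mul_const ϱ).sub ((hJ s).const_mul ϱ)).const_smul (-Complex.I * (α : ℂ))
  have hD : ∀ s, HasDerivAt (fun s => Ro s - (-Complex.I * (α : ℂ)) • ⁅𝒥 s, ϱ⁆)
      ((-Complex.I * (α : ℂ)) • ⁅V s, Re s - ϱ⁆) s := fun s => by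
    refine ((ho s).fun_sub (hL s)).congr_deriv ?_
    rw [matrix_lie_sub, smul_sub]
  have hDc := continuous_smul_lie (-Complex.I * (α : ℂ)) hV (cRe.sub (continuous_const (y := ϱ)))
  have s3 : ∀ s ∈ Set.Icc t₀ t, TraceBound (Ro s - (-Complex.I * (α : ℂ)) • ⁅𝒥 s, ϱ⁆) c₃ :=
    fun s hs => by
    rw [hc₃]
    exact TraceBound.of_hasDerivAt hD hDc (by simp [hJ0, ho0, Ring.lie_def]) (fun x hx => tb x (s2 x hx)) hs
  have c4 : Continuous fun s => (-(α : ℂ) ^ 2) • ⁅V s, ⁅𝒥 s, ϱ⁆⁆ :=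
    continuous_smul_lie _ hV (continuous_lie cJ continuous_const)
  have c4' : ∀ s, HasDerivAt (fun s => ∫ x in t₀..s, (-(α : ℂ) ^ 2) • ⁅V x, ⁅𝒥 x, ϱ⁆⁆)
      ((-(α : ℂ) ^ 2) • ⁅V s, ⁅𝒥 s, ϱ⁆⁆) s := fun s =>
    intervalIntegral.integral_hasDerivAt_right (c4.intervalIntegrable t₀ s)
      c4.aestronglyMeasurable.stronglyMeasurableAtFilter c4.continuousAt
  have hF : ∀ s, HasDerivAt (fun s => Re s - ϱ - ∫ x in t₀..s, (-(α : ℂ) ^ 2) • ⁅V x, ⁅𝒥 x, ϱ⁆⁆)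
      ((-Complex.I * (α : ℂ)) • ⁅V s, Ro s - (-Complex.I * (α : ℂ)) • ⁅𝒥 s, ϱ⁆⁆) s := fun s => by
    refine (((he s).sub_const ϱ).fun_sub (c4' s)).congr_deriv ?_
    have hI : (-Complex.I * (α : ℂ)) * (-Complex.I * (α : ℂ)) = -(α : ℂ) ^ 2 := by
      ring_nf; simp
    rw [matrix_lie_sub, smul_sub, matrix_lie_smul, smul_smul, hI]
  have hcont := continuous_smul_lie (-Complex.I * (α : ℂ)) hV
    (cRo.sub (continuous_smul_lie (-Complex.I * (α : ℂ)) cJ (continuous_const (y := ϱ))))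
  have s4 := TraceBound.of_hasDerivAt hF hcont (by simp [he0]) (fun x hx => tb x (s3 x hx))
    (s := t) ⟨ht, le_rfl⟩
  refine s4.mono (le_of_eq ?_)
  rw [hc₃, hc₂, hc₁]
  ring

end Expansion

/-! ### The Gaussian filter and its tails -/

section Filter

theorem continuous_gaussFilter (σ : ℝ) : Continuous (gaussFilter σ) := by
  unfold gaussFilter; fun_prop

theorem gaussFilter_zero (σ : ℝ) :
    gaussFilter σ 0 = ((2 * Real.pi) ^ (1 / 4 : ℝ) * σ ^ (1 / 2 : ℝ))⁻¹ := by
  simp [gaussFilter]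

theorem gaussFilter_pos {σ : ℝ} (hσ : 0 < σ) (t : ℝ) : 0 < gaussFilter σ t := by
  unfold gaussFilter; positivity

theorem gaussFilter_eq (σ t : ℝ) :
    gaussFilter σ t = gaussFilter σ 0 * Real.exp (-(1 / (4 * σ ^ 2)) * t ^ 2) := by
  rw [gaussFilter_zero, gaussFilter]; congr 2; ring

theorem gaussFilter_le {σ : ℝ} (hσ : 0 < σ) (t : ℝ) : gaussFilter σ t ≤ gaussFilter σ 0 := by
  rw [gaussFilter_eq]
  refine mul_le_of_le_one_right (gaussFilter_pos hσ 0).le (Real.exp_le_one_iff.2 ?_)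
  rw [neg_mul, neg_nonpos]; positivity

theorem gaussFilter_zero_sq {σ : ℝ} (hσ : 0 < σ) :
    gaussFilter σ 0 ^ 2 = (√(2 * Real.pi) * σ)⁻¹ := by
  rw [gaussFilter_zero, inv_pow, mul_pow, ← Real.rpow_natCast, ← Real.rpow_natCast,
    ← Real.rpow_mul (by positivity), ← Real.rpow_mul hσ.le, Real.sqrt_eq_rpow]
  norm_num

theorem integrable_gaussFilter {σ : ℝ} (hσ : 0 < σ) : Integrable (gaussFilter σ) := by
  have := (integrable_exp_neg_mul_sq (b := 1 / (4 * σ ^ 2)) (by positivity)).const_mul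
    (gaussFilter σ 0)
  exact this.congr (ae_of_all _ fun t => (gaussFilter_eq σ t).symm)

theorem integral_gaussFilter_sq {σ : ℝ} (hσ : 0 < σ) :
    (∫ t, gaussFilter σ t) ^ 2 = 4 * Real.pi / √(2 * Real.pi) * σ := by
  have : ∫ t, gaussFilter σ t = gaussFilter σ 0 * √(Real.pi / (1 / (4 * σ ^ 2))) := by
    rw [← integral_gaussian, ← integral_const_mul]
    exact integral_congr_ae (ae_of_all _ fun t => gaussFilter_eq σ t)
  rw [this, mul_pow, Real.sq_sqrt (by positivity), gaussFilter_zero_sq hσ]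
  field_simp

theorem two_le_sqrt_two_pi : 2 ≤ √(2 * Real.pi) := by
  refine Real.le_sqrt_of_sq_le ?_
  nlinarith [Real.pi_gt_three]

theorem gaussFilter_zero_sq_le {σ : ℝ} (hσ : 0 < σ) : gaussFilter σ 0 ^ 2 ≤ 1 / σ := by
  rw [gaussFilter_zero_sq hσ, mul_inv, one_div]
  refine mul_le_of_le_one_left (by positivity) (inv_le_one_of_one_le₀ ?_)
  linarith [two_le_sqrt_two_pi]

theorem integral_gaussFilter_sq_le {σ : ℝ} (hσ : 0 < σ) :
    (∫ t, gaussFilter σ t) ^ 2 ≤ 8 * σ := by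
  rw [integral_gaussFilter_sq hσ]
  refine mul_le_mul_of_nonneg_right ?_ hσ.le
  rw [div_le_iff₀ (by positivity)]
  nlinarith [Real.pi_lt_four, two_le_sqrt_two_pi]

theorem integral_gaussFilter_nonneg {σ : ℝ} (hσ : 0 < σ) : 0 ≤ ∫ t, gaussFilter σ t :=
  integral_nonneg fun t => (gaussFilter_pos hσ t).le

theorem gaussFilter_neg (σ t : ℝ) : gaussFilter σ (-t) = gaussFilter σ t := by
  simp [gaussFilter]

/-- For `t ≥ T ≥ 0` one has `t² ≥ T² + (t - T)²`, so the tail is dominated by a damped translate of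
the filter. -/
theorem setIntegral_Ioi_gaussFilter_le {σ T : ℝ} (hσ : 0 < σ) (hT : 0 ≤ T) :
    ∫ t in Set.Ioi T, gaussFilter σ t
      ≤ Real.exp (-T ^ 2 / (4 * σ ^ 2)) * ∫ t, gaussFilter σ t := by
  have hi := integrable_gaussFilter hσ
  have h1 : ∫ t in Set.Ioi T, gaussFilter σ t
      ≤ ∫ t in Set.Ioi T, Real.exp (-T ^ 2 / (4 * σ ^ 2)) * gaussFilter σ (t - T) := by
    refine setIntegral_mono_on hi.integrableOn
      ((hi.comp_sub_right T).const_mul _).integrableOn measurableSet_Ioi fun t ht => ?_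
    rw [gaussFilter_eq σ t, gaussFilter_eq σ (t - T), mul_left_comm, ← Real.exp_add]
    refine mul_le_mul_of_nonneg_left (Real.exp_le_exp.2 ?_) (gaussFilter_pos hσ 0).le
    have h0 : 0 ≤ 1 / (4 * σ ^ 2) * (2 * T * (t - T)) := by
      have : 0 ≤ t - T := sub_nonneg.2 (le_of_lt ht)
      positivity
    have : -T ^ 2 / (4 * σ ^ 2) + -(1 / (4 * σ ^ 2)) * (t - T) ^ 2
        = -(1 / (4 * σ ^ 2)) * t ^ 2 + 1 / (4 * σ ^ 2) * (2 * T * (t - T)) := by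
      field_simp; ring
    linarith
  refine h1.trans ?_
  rw [integral_const_mul]
  refine mul_le_mul_of_nonneg_left ?_ (Real.exp_pos _).le
  rw [← integral_sub_right_eq_self (gaussFilter σ) T]
  exact setIntegral_le_integral (hi.comp_sub_right T) (ae_of_all _ fun t =>
    (gaussFilter_pos hσ _).le)

theorem setIntegral_Iic_gaussFilter_le {σ T : ℝ} (hσ : 0 < σ) (hT : 0 ≤ T) :
    ∫ t in Set.Iic (-T), gaussFilter σ t
      ≤ Real.exp (-T ^ 2 / (4 * σ ^ 2)) * ∫ t, gaussFilter σ t := by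
  have := integral_comp_neg_Iic (-T) (gaussFilter σ)
  simp only [gaussFilter_neg, neg_neg] at this
  rw [this]
  exact setIntegral_Ioi_gaussFilter_le hσ hT

end Filter

/-! ### The Gibbs state in an energy eigenbasis -/

section Gibbs

variable {d : ℕ} {H : Matrix (Fin d) (Fin d) ℂ}

/-- The last conjunct, the Boltzmann ratio, is the only feature of the weights besides normalisation
and positivity that the error estimates use. -/
theorem exists_gibbs_diagonal [NeZero d] (hH : H.IsHermitian) (β : ℝ) :
    ∃ (Q : Matrix (Fin d) (Fin d) ℂ) (E p : Fin d → ℝ), Qᴴ * Q = 1 ∧ Q * Qᴴ = 1 ∧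
      H = Q * Matrix.diagonal (fun i => (E i : ℂ)) * Qᴴ ∧
      gibbs β H = Q * Matrix.diagonal (fun i => (p i : ℂ)) * Qᴴ ∧
      (∀ i, 0 < p i) ∧ ∑ i, p i = 1 ∧ ∀ i j, p i = p j * Real.exp (-β * (E i - E j)) := by
  obtain ⟨Q, hQ, hQ', hHQ⟩ := exists_unitary_diagonal hH
  set E := hH.eigenvalues
  set Z := ∑ i, Real.exp (-β * E i) with hZ
  have hZpos : 0 < Z := Finset.sum_pos (fun i _ => Real.exp_pos _) Finset.univ_nonempty
  have hexp : NormedSpace.exp (-(β : ℂ) • H)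
      = Q * Matrix.diagonal (fun i => ((Real.exp (-β * E i) : ℝ) : ℂ)) * Qᴴ := by
    have hinv : Q⁻¹ = Qᴴ := Matrix.inv_eq_left_inv hQ
    have hu : IsUnit Q := IsUnit.of_mul_eq_one _ hQ'
    have h1 := Matrix.exp_conj Q (-(β : ℂ) • Matrix.diagonal (fun i => (E i : ℂ))) hu
    rw [hinv] at h1
    have h2 : -(β : ℂ) • H = Q * (-(β : ℂ) • Matrix.diagonal (fun i => (E i : ℂ))) * Qᴴ := by
      rw [Matrix.mul_smul, Matrix.smul_mul, ← hHQ]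
    rw [h2, h1, ← Matrix.diagonal_smul, Matrix.exp_diagonal]
    congr 3
    ext i
    simp [Pi.coe_exp, ← Complex.exp_eq_exp_ℂ]
  have htr : (NormedSpace.exp (-(β : ℂ) • H)).trace = (Z : ℂ) := by
    rw [hexp, trace_conj_unitary hQ, Matrix.trace_diagonal, hZ]
    push_cast; rfl
  refine ⟨Q, E, fun i => Z⁻¹ * Real.exp (-β * E i), hQ, hQ', hHQ, ?_,
    fun i => mul_pos (inv_pos.2 hZpos) (Real.exp_pos _),
    ?_, fun i j => ?_⟩
  · rw [gibbs, htr, hexp, ← Matrix.smul_mul, ← Matrix.mul_smul, ← Matrix.diagonal_smul]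
    congr 3
    ext i
    simp
  · rw [← Finset.mul_sum, ← hZ, inv_mul_cancel₀ hZpos.ne']
  · rw [mul_assoc, ← Real.exp_add]; ring_nf

theorem gibbs_isState [NeZero d] (hH : H.IsHermitian) (β : ℝ) : IsState (gibbs β H) := by
  obtain ⟨Q, E, p, hQ, -, -, hg, hp, hs, -⟩ := exists_gibbs_diagonal hH β
  rw [hg]
  refine ⟨(Matrix.PosSemidef.diagonal fun i => ?_).mul_mul_conjTranspose_same Q, ?_⟩
  · simpa using (hp i).le
  · rw [trace_conj_unitary hQ, Matrix.trace_diagonal]; exact_mod_cast hs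

theorem IsState.traceBound {ρ : Matrix (Fin d) (Fin d) ℂ} (h : IsState ρ) : TraceBound ρ 1 := by
  have := traceBound_of_posSemidef h.1
  rwa [h.2, Complex.one_re] at this

theorem commute_gibbs_evo (β s : ℝ) : Commute (gibbs β H) (evo H s) := by
  unfold gibbs evo
  exact ((((Commute.refl H).smul_left (-(β : ℂ))).smul_right (Complex.I * s)).exp).smul_left _

end Gibbs

/-! ### Interaction picture and the double commutator -/

section Coupling

variable {d : ℕ} {H : Matrix (Fin d) (Fin d) ℂ}

/-- The filtered coupling operator `f(s) exp(-iωs) A(s)`. -/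
noncomputable def coupling (H A : Matrix (Fin d) (Fin d) ℂ) (σ ω s : ℝ) :
    Matrix (Fin d) (Fin d) ℂ :=
  ((gaussFilter σ s : ℂ) * Complex.exp (-Complex.I * ((ω * s : ℝ) : ℂ))) • heis H A s

theorem norm_exp_I_mul (x : ℝ) : ‖Complex.exp (Complex.I * (x : ℂ))‖ = 1 := by
  rw [mul_comm, Complex.norm_exp_ofReal_mul_I]

theorem norm_exp_neg_I_mul (x : ℝ) : ‖Complex.exp (-Complex.I * (x : ℂ))‖ = 1 := by
  have := norm_exp_I_mul (-x)
  rwa [Complex.ofReal_neg, mul_neg, ← neg_mul] at this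

theorem continuous_coupling_uncurry (hH : H.IsHermitian) (A : Matrix (Fin d) (Fin d) ℂ) (σ : ℝ) :
    Continuous fun p : ℝ × ℝ => coupling H A σ p.1 p.2 := by
  unfold coupling
  have h1 := continuous_heis hH A
  have h2 := continuous_gaussFilter σ
  fun_prop

theorem continuous_coupling (hH : H.IsHermitian) (A : Matrix (Fin d) (Fin d) ℂ) (σ ω : ℝ) :
    Continuous (coupling H A σ ω) :=
  (continuous_coupling_uncurry hH A σ).comp (f := fun s : ℝ => (ω, s)) (by fun_prop)

theorem norm_coupling_le (hH : H.IsHermitian) (A : Matrix (Fin d) (Fin d) ℂ) {σ : ℝ}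
    (hσ : 0 < σ) (ω s : ℝ) : ‖coupling H A σ ω s‖ ≤ gaussFilter σ s * ‖A‖ := by
  rw [coupling, norm_smul, norm_mul, norm_exp_neg_I_mul, mul_one, Complex.norm_real,
    Real.norm_of_nonneg (gaussFilter_pos hσ s).le]
  exact mul_le_mul_of_nonneg_left (norm_heis_le hH A s) (gaussFilter_pos hσ s).le

/-- Adjoining flips the frequency. This identifies the excited-bath half of the step with the
generator of `Aᴴ` at `ω`. -/
theorem coupling_conjTranspose (hH : H.IsHermitian) (A : Matrix (Fin d) (Fin d) ℂ) (σ ω s : ℝ) :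
    (coupling H A σ ω s)ᴴ = coupling H Aᴴ σ (-ω) s := by
  rw [coupling, coupling, Matrix.conjTranspose_smul, heis_conjTranspose hH]
  congr 1
  rw [star_mul']
  simp [← Complex.exp_conj]

theorem continuous_totalHam (H A : Matrix (Fin d) (Fin d) ℂ) (σ α : ℝ) :
    Continuous fun p : ℝ × ℝ => totalHam H A σ α p.1 p.2 := by
  unfold totalHam
  have h2 := continuous_gaussFilter σ
  have h3 : Continuous bathHam := by
    have : bathHam = fun ω : ℝ => (ω : ℂ) • bathHam 1 := by
      funext ω
      ext i j; fin_cases i <;> fin_cases j <;> simp [bathHam] <;> ring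
    rw [this]
    fun_prop
  have h4 : Continuous fun p : ℝ × ℝ =>
      (1 : Matrix (Fin d) (Fin d) ℂ) ⊗ₖ bathHam p.1 :=
    Continuous.kronecker continuous_const (h3.comp continuous_fst)
  fun_prop

theorem totalHam_isHermitian (hH : H.IsHermitian) (A : Matrix (Fin d) (Fin d) ℂ)
    (σ α ω s : ℝ) : (totalHam H A σ α ω s).IsHermitian := by
  unfold totalHam Matrix.IsHermitian
  simp only [Matrix.conjTranspose_add, Matrix.conjTranspose_smul, Matrix.conjTranspose_kronecker,
    Matrix.conjTranspose_conjTranspose, hH.eq, (bathHam_isHermitian ω).eq,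
    Matrix.conjTranspose_one]
  rw [add_comm (Aᴴ ⊗ₖ bathCouplingᴴ)]
  simp

theorem exists_norm_totalHam_le (H A : Matrix (Fin d) (Fin d) ℂ) {σ : ℝ} (hσ : 0 < σ)
    (α ω : ℝ) : ∃ K, ∀ s, ‖totalHam H A σ α ω s‖ ≤ K := by
  refine ⟨‖H ⊗ₖ (1 : Matrix (Fin 2) (Fin 2) ℂ) + (1 : Matrix (Fin d) (Fin d) ℂ) ⊗ₖ bathHam ω‖
    + |α| * gaussFilter σ 0 * ‖A ⊗ₖ bathCoupling + Aᴴ ⊗ₖ bathCouplingᴴ‖, fun s => ?_⟩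
  unfold totalHam
  refine (norm_add_le _ _).trans (add_le_add le_rfl ?_)
  rw [norm_smul, Complex.norm_real, Real.norm_eq_abs, abs_mul, abs_of_pos (gaussFilter_pos hσ s)]
  have := gaussFilter_le hσ s
  gcongr

theorem norm_bathCoupling_le : ‖bathCoupling‖ ≤ 1 := by
  have h : bathCouplingᴴ * bathCoupling = Matrix.diagonal ![1, 0] := by
    ext i j
    fin_cases i <;> fin_cases j <;> simp [bathCoupling, Matrix.mul_apply]
  have h1 := Matrix.l2_opNorm_conjTranspose_mul_self bathCoupling
  have h2 : ‖Matrix.diagonal ![(1 : ℂ), 0]‖ ≤ 1 :=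
    norm_diagonal_le zero_le_one fun i => by fin_cases i <;> simp
  rw [h] at h1
  nlinarith [norm_nonneg bathCoupling]

theorem norm_interaction_le (a : Matrix (Fin d) (Fin d) ℂ) :
    ‖a ⊗ₖ bathCoupling + aᴴ ⊗ₖ bathCouplingᴴ‖ ≤ 2 * ‖a‖ := by
  have h1 := norm_kronecker_le a bathCoupling
  have h2 := norm_kronecker_le aᴴ bathCouplingᴴ
  rw [Matrix.l2_opNorm_conjTranspose, Matrix.l2_opNorm_conjTranspose] at h2
  have h3 := mul_le_of_le_one_right (norm_nonneg a) norm_bathCoupling_le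
  refine (norm_add_le _ _).trans ?_
  linarith

/-- Evolution under the uncoupled Hamiltonian. -/
noncomputable def freeEvo (H : Matrix (Fin d) (Fin d) ℂ) (ω s : ℝ) :
    Matrix (Fin d × Fin 2) (Fin d × Fin 2) ℂ :=
  evo H s ⊗ₖ evo (bathHam ω) s

/-- The uncoupled Hamiltonian. -/
noncomputable def freeHam (H : Matrix (Fin d) (Fin d) ℂ) (ω : ℝ) :
    Matrix (Fin d × Fin 2) (Fin d × Fin 2) ℂ :=
  H ⊗ₖ (1 : Matrix (Fin 2) (Fin 2) ℂ) + (1 : Matrix (Fin d) (Fin d) ℂ) ⊗ₖ bathHam ω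

theorem freeHam_isHermitian (hH : H.IsHermitian) (ω : ℝ) : (freeHam H ω).IsHermitian := by
  unfold freeHam Matrix.IsHermitian
  simp only [Matrix.conjTranspose_add, Matrix.conjTranspose_kronecker, hH.eq,
    (bathHam_isHermitian ω).eq, Matrix.conjTranspose_one]

theorem freeEvo_conjTranspose_mul_self (hH : H.IsHermitian) (ω s : ℝ) :
    (freeEvo H ω s)ᴴ * freeEvo H ω s = 1 := by
  unfold freeEvo
  rw [Matrix.conjTranspose_kronecker, ← Matrix.mul_kronecker_mul, evo_conjTranspose_mul_self hH,
    evo_conjTranspose_mul_self (bathHam_isHermitian ω), Matrix.one_kronecker_one]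

theorem hasDerivAt_freeEvo (H : Matrix (Fin d) (Fin d) ℂ) (ω s : ℝ) :
    HasDerivAt (freeEvo H ω) (Complex.I • (freeHam H ω * freeEvo H ω s)) s := by
  refine (HasDerivAt.kronecker (hasDerivAt_evo H s)
    (hasDerivAt_evo (bathHam ω) s)).congr_deriv ?_
  unfold freeHam freeEvo
  rw [add_mul, ← Matrix.mul_kronecker_mul, ← Matrix.mul_kronecker_mul, Matrix.one_mul,
    Matrix.one_mul, smul_add, Matrix.smul_mul, Matrix.smul_mul, Matrix.smul_kronecker,
    Matrix.kronecker_smul]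

/-- The free part commutes with its own evolution, and the bath phase `exp(iωs)` combines with
`A(s)` into the coupling at frequency `-ω`. -/
theorem freeEvo_conj_totalHam (hH : H.IsHermitian) (A : Matrix (Fin d) (Fin d) ℂ)
    (σ α ω s : ℝ) : freeEvo H ω s * totalHam H A σ α ω s * (freeEvo H ω s)ᴴ
      = freeHam H ω + (α : ℂ) • (coupling H A σ (-ω) s ⊗ₖ bathCoupling
        + (coupling H A σ (-ω) s)ᴴ ⊗ₖ bathCouplingᴴ) := by
  have hB := bathHam_isHermitian ω
  have h1 : freeEvo H ω s * (A ⊗ₖ bathCoupling) * (freeEvo H ω s)ᴴ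
      = (Complex.exp (Complex.I * ((ω * s : ℝ) : ℂ)) • heis H A s) ⊗ₖ bathCoupling := by
    unfold freeEvo
    rw [Matrix.conjTranspose_kronecker, ← Matrix.mul_kronecker_mul, ← Matrix.mul_kronecker_mul,
      ← heis_eq hH, evo_conj_bathCoupling, Matrix.kronecker_smul, Matrix.smul_kronecker]
  have h2 : freeEvo H ω s * (Aᴴ ⊗ₖ bathCouplingᴴ) * (freeEvo H ω s)ᴴ
      = (Complex.exp (Complex.I * ((ω * s : ℝ) : ℂ)) • heis H A s)ᴴ ⊗ₖ bathCouplingᴴ := by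
    have := congrArg Matrix.conjTranspose h1
    rw [Matrix.conjTranspose_kronecker] at this
    rw [← this]
    simp only [Matrix.conjTranspose_mul, Matrix.conjTranspose_conjTranspose,
      Matrix.conjTranspose_kronecker, Matrix.mul_assoc]
  have h3 : freeEvo H ω s * freeHam H ω * (freeEvo H ω s)ᴴ = freeHam H ω := by
    unfold freeEvo freeHam
    rw [Matrix.conjTranspose_kronecker, mul_add, add_mul, ← Matrix.mul_kronecker_mul,
      ← Matrix.mul_kronecker_mul, ← Matrix.mul_kronecker_mul, ← Matrix.mul_kronecker_mul,
      Matrix.mul_one, Matrix.mul_one, evo_mul_conjTranspose_self hH,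
      evo_mul_conjTranspose_self hB, ← (commute_evo H s).eq, ← (commute_evo (bathHam ω) s).eq,
      Matrix.mul_assoc, Matrix.mul_assoc, evo_mul_conjTranspose_self hH,
      evo_mul_conjTranspose_self hB, Matrix.mul_one, Matrix.mul_one]
  have h4 : coupling H A σ (-ω) s
      = (gaussFilter σ s : ℂ) • (Complex.exp (Complex.I * ((ω * s : ℝ) : ℂ)) • heis H A s) := by
    rw [coupling, smul_smul]; simp
  have h5 : totalHam H A σ α ω s = freeHam H ω + ((α * gaussFilter σ s : ℝ) : ℂ) •
    (A ⊗ₖ bathCoupling + Aᴴ ⊗ₖ bathCouplingᴴ) := rfl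
  rw [h5, mul_add, add_mul, h3, Matrix.mul_smul, Matrix.smul_mul, mul_add, add_mul, h1, h2, h4]
  congr 1
  generalize Complex.exp (Complex.I * ((ω * s : ℝ) : ℂ)) • heis H A s = X
  have hstar : star (gaussFilter σ s : ℂ) = gaussFilter σ s := Complex.conj_ofReal _
  rw [Matrix.conjTranspose_smul, hstar, Matrix.smul_kronecker, Matrix.smul_kronecker, ← smul_add,
    smul_smul, Complex.ofReal_mul]

/-- The second-order generator density. -/
noncomputable def secondOrder (ρ a J : Matrix (Fin d) (Fin d) ℂ) : Matrix (Fin d) (Fin d) ℂ :=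
  aᴴ * J * ρ + ρ * Jᴴ * a - a * ρ * Jᴴ - J * ρ * aᴴ

/-- Only products of one raising and one lowering bath operator have nonzero bath trace. A bath in
its ground state lets `a` and `J` act on the system, an excited one their adjoints. -/
theorem traceBath_double_commutator (ρ a J : Matrix (Fin d) (Fin d) ℂ) (p₀ p₁ : ℂ) :
    traceBath ⁅a ⊗ₖ bathCoupling + aᴴ ⊗ₖ bathCouplingᴴ,
      ⁅J ⊗ₖ bathCoupling + Jᴴ ⊗ₖ bathCouplingᴴ, ρ ⊗ₖ Matrix.diagonal ![p₀, p₁]⁆⁆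
      = p₀ • secondOrder ρ a J + p₁ • secondOrder ρ aᴴ Jᴴ := by
  simp only [Ring.lie_def, mul_add, add_mul, mul_sub, sub_mul, ← Matrix.mul_kronecker_mul,
    traceBath_add, traceBath_sub, traceBath_kronecker]
  simp only [Matrix.trace_fin_two, Matrix.mul_apply, Fin.sum_univ_two, bathCoupling,
    Matrix.conjTranspose_apply, Matrix.diagonal]
  simp [secondOrder, Matrix.mul_assoc]
  module

end Coupling

/-! ### One step in the interaction picture -/

section Step

variable {d : ℕ} {H : Matrix (Fin d) (Fin d) ℂ}

/-- The Pauli `Z` operator on the bath. -/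
noncomputable def bathParity (d : ℕ) : Matrix (Fin d × Fin 2) (Fin d × Fin 2) ℂ :=
  (1 : Matrix (Fin d) (Fin d) ℂ) ⊗ₖ Matrix.diagonal ![1, -1]

theorem bathParity_mul_self : bathParity d * bathParity d = 1 := by
  unfold bathParity
  rw [← Matrix.mul_kronecker_mul, Matrix.one_mul, Matrix.diagonal_mul_diagonal]
  have : (fun i => (![1, -1] : Fin 2 → ℂ) i * (![1, -1] : Fin 2 → ℂ) i) = fun _ => 1 := by
    ext i; fin_cases i <;> simp
  rw [this, Matrix.diagonal_one, Matrix.one_kronecker_one]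

theorem bathParity_conjTranspose : (bathParity d)ᴴ = bathParity d := by
  unfold bathParity
  rw [Matrix.conjTranspose_kronecker, Matrix.conjTranspose_one, Matrix.diagonal_conjTranspose]
  congr 2
  ext i; fin_cases i <;> simp

/-- The coupling flips the bath qubit, so it is odd under parity. This is what removes the odd
orders of the expansion. -/
theorem bathParity_conj_interaction (a : Matrix (Fin d) (Fin d) ℂ) :
    bathParity d * (a ⊗ₖ bathCoupling + aᴴ ⊗ₖ bathCouplingᴴ) * bathParity d
      = -(a ⊗ₖ bathCoupling + aᴴ ⊗ₖ bathCouplingᴴ) := by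
  have h1 : Matrix.diagonal ![1, -1] * bathCoupling * Matrix.diagonal ![1, -1]
      = (-1 : ℂ) • bathCoupling := by
    ext i j
    fin_cases i <;> fin_cases j <;> simp [bathCoupling]
  have h2 : Matrix.diagonal ![1, -1] * bathCouplingᴴ * Matrix.diagonal ![1, -1]
      = (-1 : ℂ) • bathCouplingᴴ := by
    ext i j
    fin_cases i <;> fin_cases j <;> simp [bathCoupling]
  unfold bathParity
  simp only [mul_add, add_mul, ← Matrix.mul_kronecker_mul, Matrix.one_mul, Matrix.mul_one, h1, h2,
    Matrix.kronecker_smul]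
  rw [← smul_add, neg_one_smul]

theorem bathParity_conj_diagonal (ρ : Matrix (Fin d) (Fin d) ℂ) (p : Fin 2 → ℂ) :
    bathParity d * (ρ ⊗ₖ Matrix.diagonal p) * bathParity d = ρ ⊗ₖ Matrix.diagonal p := by
  unfold bathParity
  rw [← Matrix.mul_kronecker_mul, ← Matrix.mul_kronecker_mul, Matrix.one_mul, Matrix.mul_one,
    Matrix.diagonal_mul_diagonal, Matrix.diagonal_mul_diagonal]
  congr 2
  ext i; fin_cases i <;> simp

theorem traceBath_bathParity_conj (M : Matrix (Fin d × Fin 2) (Fin d × Fin 2) ℂ) :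
    traceBath (bathParity d * M * bathParity d) = traceBath M := by
  have hd : (Matrix.diagonal ![(1 : ℂ), -1])ᴴ = Matrix.diagonal ![1, -1] := by
    rw [Matrix.diagonal_conjTranspose]
    congr 1
    ext i; fin_cases i <;> simp
  have h2 : (Matrix.diagonal ![(1 : ℂ), -1])ᴴ * Matrix.diagonal ![1, -1] = 1 := by
    rw [hd, Matrix.diagonal_mul_diagonal, ← Matrix.diagonal_one]
    congr 1
    ext i; fin_cases i <;> simp
  have := traceBath_conj_bath h2 M
  rwa [hd] at this

variable {A : Matrix (Fin d) (Fin d) ℂ} {β σ T α ω : ℝ}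

theorem traceBound_kronecker_gibbs {ρ : Matrix (Fin d) (Fin d) ℂ} (hρ : IsState ρ) (β ω : ℝ) :
    TraceBound (ρ ⊗ₖ gibbs β (bathHam ω)) 1 := by
  have hp : (gibbs β (bathHam ω)).PosSemidef := by
    rw [gibbs_bathHam]
    refine Matrix.PosSemidef.diagonal fun i => ?_
    fin_cases i <;> simpa using bathPop_nonneg _ _
  have ht : (ρ ⊗ₖ gibbs β (bathHam ω)).trace = 1 := by
    rw [Matrix.trace_kronecker, hρ.2, gibbs_bathHam, Matrix.trace_diagonal, Fin.sum_univ_two]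
    simp only [Matrix.cons_val_zero, Matrix.cons_val_one, one_mul]
    exact_mod_cast bathPop_add_neg β ω
  have := traceBound_of_posSemidef (hρ.1.kronecker hp)
  rwa [ht, Complex.one_re] at this

theorem totalHam_unitary (hH : H.IsHermitian) (hσ : 0 < σ) (t₀ t : ℝ) :
    (timeOrderedExp (totalHam H A σ α ω) t₀ t)ᴴ * timeOrderedExp (totalHam H A σ α ω) t₀ t = 1 := by
  obtain ⟨K, hK⟩ := exists_norm_totalHam_le H A hσ α ω
  have hc : Continuous (totalHam H A σ α ω) :=
    (continuous_totalHam H A σ α).comp (f := fun s : ℝ => (ω, s)) (by fun_prop)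
  exact timeOrderedExp_unitary hc hK (fun s => totalHam_isHermitian hH A σ α ω s) t₀ t

/-- The joint state in the interaction picture. -/
noncomputable def interactionState (H A : Matrix (Fin d) (Fin d) ℂ) (σ T α ω : ℝ)
    (ϱ : Matrix (Fin d × Fin 2) (Fin d × Fin 2) ℂ) (s : ℝ) :
    Matrix (Fin d × Fin 2) (Fin d × Fin 2) ℂ :=
  freeEvo H ω s * (timeOrderedExp (totalHam H A σ α ω) (-T) s * ϱ
    * (timeOrderedExp (totalHam H A σ α ω) (-T) s)ᴴ) * (freeEvo H ω s)ᴴ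

/-- The free Hamiltonian contributed by the rotation cancels the one in the Schrödinger equation,
and only the coupling, of strength `α`, drives the state. -/
theorem hasDerivAt_interactionState (hH : H.IsHermitian) (hσ : 0 < σ)
    (ϱ : Matrix (Fin d × Fin 2) (Fin d × Fin 2) ℂ) (s : ℝ) :
    HasDerivAt (interactionState H A σ T α ω ϱ)
      ((-Complex.I * α) • ⁅coupling H A σ (-ω) s ⊗ₖ bathCoupling
        + (coupling H A σ (-ω) s)ᴴ ⊗ₖ bathCouplingᴴ, interactionState H A σ T α ω ϱ s⁆) s := by
  obtain ⟨K, hK⟩ := exists_norm_totalHam_le H A hσ α ω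
  have hc : Continuous (totalHam H A σ α ω) :=
    (continuous_totalHam H A σ α).comp (f := fun s : ℝ => (ω, s)) (by fun_prop)
  have hG := hasDerivAt_freeEvo H ω s
  have hG' : HasDerivAt (fun s => (freeEvo H ω s)ᴴ)
    (Complex.I • (freeHam H ω * freeEvo H ω s))ᴴ s := hG.star
  have hU := hasDerivAt_timeOrderedExp hc hK (-T) s
  have hU' : HasDerivAt (fun s => (timeOrderedExp (totalHam H A σ α ω) (-T) s)ᴴ)
    ((-Complex.I) • (totalHam H A σ α ω s * timeOrderedExp (totalHam H A σ α ω) (-T) s))ᴴ s :=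
    hU.star
  have hrot := freeEvo_conj_totalHam hH A σ α ω s
  have hGG := freeEvo_conjTranspose_mul_self hH ω s
  have h1 := (hG.fun_mul ((hU.fun_mul (hasDerivAt_const s ϱ)).fun_mul hU')).fun_mul hG'
  unfold interactionState
  refine h1.congr_deriv ?_
  generalize coupling H A σ (-ω) s ⊗ₖ bathCoupling
        + (coupling H A σ (-ω) s)ᴴ ⊗ₖ bathCouplingᴴ = V at *
  have hh := totalHam_isHermitian hH A σ α ω s
  have hf := freeHam_isHermitian hH ω
  generalize timeOrderedExp (totalHam H A σ α ω) (-T) s = U at *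
  generalize totalHam H A σ α ω s = h at *
  generalize freeEvo H ω s = G at *
  generalize freeHam H ω = F at *
  -- Moving the free evolution past the Hamiltonian exposes the free part `F`, which then cancels.
  have e1 : G * h = (F + (α : ℂ) • V) * G := by
    rw [← hrot, Matrix.mul_assoc, hGG, Matrix.mul_one]
  have e2 : h * Gᴴ = Gᴴ * (F + (α : ℂ) • V) := by
    rw [← hrot, ← Matrix.mul_assoc, ← Matrix.mul_assoc, hGG, Matrix.one_mul]
  have e3 : G * (h * U * ϱ * Uᴴ) * Gᴴ = (F + (α : ℂ) • V) * (G * (U * ϱ * Uᴴ) * Gᴴ) := by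
    simp only [← Matrix.mul_assoc, e1]
  have e4 : G * (U * ϱ * (Uᴴ * h)) * Gᴴ = (G * (U * ϱ * Uᴴ) * Gᴴ) * (F + (α : ℂ) • V) := by
    simp only [Matrix.mul_assoc, e2]
  simp only [Matrix.conjTranspose_smul, Matrix.conjTranspose_mul, hh.eq, hf.eq, mul_zero,
    add_zero, Matrix.smul_mul, Matrix.mul_smul, add_mul, mul_add, Ring.lie_def,
    Matrix.mul_assoc]
  simp only [← Matrix.mul_assoc] at e3 e4 ⊢
  rw [e3, e4]
  simp only [Complex.star_def, map_neg, Complex.conj_I, mul_add, add_mul, Matrix.smul_mul,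
    Matrix.mul_smul]
  module

/-- The accumulated coupling on `[-T, s]`. -/
noncomputable def couplingPrimitive (H A : Matrix (Fin d) (Fin d) ℂ) (σ ω T s : ℝ) :
    Matrix (Fin d) (Fin d) ℂ :=
  ∫ x in (-T)..s, coupling H A σ ω x

theorem hasDerivAt_couplingPrimitive (hH : H.IsHermitian) (A : Matrix (Fin d) (Fin d) ℂ)
    (σ ω T s : ℝ) :
    HasDerivAt (couplingPrimitive H A σ ω T) (coupling H A σ ω s) s := by
  have hc := continuous_coupling hH A σ ω
  exact intervalIntegral.integral_hasDerivAt_right (hc.intervalIntegrable _ _)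
    hc.aestronglyMeasurable.stronglyMeasurableAtFilter hc.continuousAt

/-- The free rotation at time `T` is a product: its bath factor is invisible to the partial trace
and its system factor can be undone outside. -/
theorem stepMap_eq_interactionState (hH : H.IsHermitian) (ρ : Matrix (Fin d) (Fin d) ℂ) :
    stepMap H A β σ T α ω ρ = (evo H T)ᴴ *
      traceBath (interactionState H A σ T α ω (ρ ⊗ₖ gibbs β (bathHam ω)) T) * evo H T := by
  unfold stepMap interactionState freeEvo
  set U := timeOrderedExp (totalHam H A σ α ω) (-T) T
  set X := U * (ρ ⊗ₖ gibbs β (bathHam ω)) * Uᴴ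
  have hk : evo H T ⊗ₖ evo (bathHam ω) T = ((1 : Matrix (Fin d) (Fin d) ℂ) ⊗ₖ evo (bathHam ω) T)
      * (evo H T ⊗ₖ (1 : Matrix (Fin 2) (Fin 2) ℂ)) := by
    rw [← Matrix.mul_kronecker_mul, Matrix.one_mul, Matrix.mul_one]
  have hk' : (evo H T ⊗ₖ evo (bathHam ω) T)ᴴ = ((evo H T)ᴴ ⊗ₖ (1 : Matrix (Fin 2) (Fin 2) ℂ))
      * ((1 : Matrix (Fin d) (Fin d) ℂ) ⊗ₖ (evo (bathHam ω) T)ᴴ) := by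
    rw [← Matrix.mul_kronecker_mul, Matrix.one_mul, Matrix.mul_one,
      Matrix.conjTranspose_kronecker]
  have h1 : (evo H T ⊗ₖ evo (bathHam ω) T) * X * (evo H T ⊗ₖ evo (bathHam ω) T)ᴴ
      = ((1 : Matrix (Fin d) (Fin d) ℂ) ⊗ₖ evo (bathHam ω) T)
        * ((evo H T ⊗ₖ (1 : Matrix (Fin 2) (Fin 2) ℂ)) * X
          * ((evo H T)ᴴ ⊗ₖ (1 : Matrix (Fin 2) (Fin 2) ℂ)))
        * ((1 : Matrix (Fin d) (Fin d) ℂ) ⊗ₖ (evo (bathHam ω) T)ᴴ) := by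
    rw [hk', hk]
    simp only [Matrix.mul_assoc]
  change traceBath X = _
  rw [h1, traceBath_conj_bath (evo_conjTranspose_mul_self (bathHam_isHermitian ω) T),
    traceBath_mul_kronecker_one]
  simp only [← Matrix.mul_assoc]
  rw [evo_conjTranspose_mul_self hH, Matrix.one_mul, Matrix.mul_assoc,
    evo_conjTranspose_mul_self hH, Matrix.mul_one]

/-- Both thermal states commute with the free evolution, so the rotation at time `-T` does nothing.
-/
theorem interactionState_gibbs_start (hH : H.IsHermitian) (hσ : 0 < σ) :
    interactionState H A σ T α ω (gibbs β H ⊗ₖ gibbs β (bathHam ω)) (-T)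
      = gibbs β H ⊗ₖ gibbs β (bathHam ω) := by
  obtain ⟨K, hK⟩ := exists_norm_totalHam_le H A hσ α ω
  have hc : Continuous (totalHam H A σ α ω) :=
    (continuous_totalHam H A σ α).comp (f := fun s : ℝ => (ω, s)) (by fun_prop)
  unfold interactionState freeEvo
  rw [timeOrderedExp_self hc hK, Matrix.conjTranspose_one, Matrix.one_mul, Matrix.mul_one,
    Matrix.conjTranspose_kronecker, ← Matrix.mul_kronecker_mul, ← Matrix.mul_kronecker_mul,
    ← (commute_gibbs_evo β (-T)).eq, ← (commute_gibbs_evo (H := bathHam ω) β (-T)).eq]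
  have hcb : gibbs β (bathHam ω) * evo (bathHam ω) (-T) * (evo (bathHam ω) (-T))ᴴ
      = gibbs β (bathHam ω) := by
    rw [Matrix.mul_assoc, evo_mul_conjTranspose_self (bathHam_isHermitian ω), Matrix.mul_one]
  rw [Matrix.mul_assoc, evo_mul_conjTranspose_self hH, Matrix.mul_one, hcb]

end Step

/-! ### Expansion of the step applied to the Gibbs state -/

section SecondOrder

variable {d : ℕ} {H : Matrix (Fin d) (Fin d) ℂ}

theorem TraceBound.secondOrder {ρ a J : Matrix (Fin d) (Fin d) ℂ} (h : TraceBound ρ 1) :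
    TraceBound (secondOrder ρ a J) (4 * (‖a‖ * ‖J‖)) := by
  unfold ThermalPrep.secondOrder
  have h1 : TraceBound (aᴴ * J * ρ) (‖a‖ * ‖J‖) :=
    (h.mul_left (aᴴ * J)).mono (by
      rw [mul_one]; simpa [Matrix.l2_opNorm_conjTranspose] using norm_mul_le aᴴ J)
  have h2 : TraceBound (ρ * Jᴴ * a) (‖a‖ * ‖J‖) := by
    have h2 := h.mul_right (Jᴴ * a)
    rw [← Matrix.mul_assoc] at h2
    refine h2.mono ?_
    have := norm_mul_le Jᴴ a
    rw [Matrix.l2_opNorm_conjTranspose] at this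
    linarith
  have h3 : TraceBound (a * ρ * Jᴴ) (‖a‖ * ‖J‖) :=
    ((h.mul_left a).mul_right Jᴴ).mono (by rw [mul_one, Matrix.l2_opNorm_conjTranspose])
  have h4 : TraceBound (J * ρ * aᴴ) (‖a‖ * ‖J‖) :=
    ((h.mul_left J).mul_right aᴴ).mono (by rw [mul_one, Matrix.l2_opNorm_conjTranspose, mul_comm])
  refine (((h1.add h2).sub h3).sub h4).mono (le_of_eq ?_)
  ring

theorem secondOrder_sub (ρ a J K : Matrix (Fin d) (Fin d) ℂ) :
    secondOrder ρ a (J - K) = secondOrder ρ a J - secondOrder ρ a K := by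
  simp only [secondOrder, Matrix.conjTranspose_sub, mul_sub, sub_mul]
  abel

theorem continuous_secondOrder (ρ : Matrix (Fin d) (Fin d) ℂ) {a J : ℝ → Matrix (Fin d) (Fin d) ℂ}
    (ha : Continuous a) (hJ : Continuous J) : Continuous fun s => secondOrder ρ (a s) (J s) := by
  unfold secondOrder
  have h1 : Continuous fun s => (a s)ᴴ := ha.star
  have h2 : Continuous fun s => (J s)ᴴ := hJ.star
  fun_prop

theorem hasDerivAt_conjTranspose {ι : Type*} [Fintype ι] [DecidableEq ι]
    {F : ℝ → Matrix ι ι ℂ} {F' : Matrix ι ι ℂ} {s : ℝ} (h : HasDerivAt F F' s) :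
    HasDerivAt (fun s => (F s)ᴴ) F'ᴴ s := h.star

theorem integral_conjTranspose {X : Type*} [MeasurableSpace X] {μ : Measure X} {ι : Type*}
    [Fintype ι] [DecidableEq ι] (F : X → Matrix ι ι ℂ) :
    ∫ x, (F x)ᴴ ∂μ = (∫ x, F x ∂μ)ᴴ := by
  have h := (starL' ℝ (A := Matrix ι ι ℂ)).integral_comp_comm (μ := μ) F
  exact h

variable {A : Matrix (Fin d) (Fin d) ℂ} {β σ T α ω : ℝ}

/-- The joint state is split into its even and odd parts under bath parity. The initial state is
even and the partial trace sees only the even part, so the even expansion applies. In the remainder,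
`2 * (gaussFilter σ 0 * ‖A‖)` bounds the coupling and `T - -T` is the duration. -/
theorem traceBound_stepMap_gibbs_expansion [NeZero d] (hH : H.IsHermitian) (hσ : 0 < σ)
    (hT : 0 < T) (hα : 0 ≤ α) :
    TraceBound (stepMap H A β σ T α ω (gibbs β H) - gibbs β H
      - (evo H T)ᴴ * (∫ s in (-T)..T, (-(α : ℂ) ^ 2) •
          ((bathPop β (-ω) : ℂ) • secondOrder (gibbs β H) (coupling H A σ (-ω) s)
              (couplingPrimitive H A σ (-ω) T s)
            + (bathPop β ω : ℂ) • secondOrder (gibbs β H) (coupling H Aᴴ σ ω s)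
              (couplingPrimitive H Aᴴ σ ω T s))) * evo H T)
      ((2 * α * (2 * (gaussFilter σ 0 * ‖A‖)) * (T - -T)) ^ 4) := by
  set a := coupling H A σ (-ω) with ha
  set J := couplingPrimitive H A σ (-ω) T with hJ
  set ϱ := gibbs β H ⊗ₖ gibbs β (bathHam ω) with hϱ
  set r := interactionState H A σ T α ω ϱ with hr
  set Z := bathParity d with hZ
  set V := fun s => a s ⊗ₖ bathCoupling + (a s)ᴴ ⊗ₖ bathCouplingᴴ with hV
  have hac : Continuous a := continuous_coupling hH A σ (-ω)
  have hV1 : Continuous V :=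
    (Continuous.kronecker hac continuous_const).add
      (Continuous.kronecker hac.star continuous_const)
  have hV2 : ∀ s, ‖V s‖ ≤ 2 * (gaussFilter σ 0 * ‖A‖) := fun s => by
    refine (norm_interaction_le _).trans ?_
    have h1 := norm_coupling_le hH A hσ (-ω) s
    have h2 := mul_le_mul_of_nonneg_right (gaussFilter_le hσ s) (norm_nonneg A)
    linarith
  have hJd : ∀ s, HasDerivAt J (a s) s := fun s => hasDerivAt_couplingPrimitive hH A σ (-ω) T s
  have hJV : ∀ s, HasDerivAt (fun s => J s ⊗ₖ bathCoupling + (J s)ᴴ ⊗ₖ bathCouplingᴴ) (V s) s :=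
    fun s => by
    have h1 := HasDerivAt.kronecker (hJd s) (hasDerivAt_const s bathCoupling)
    have h2 := HasDerivAt.kronecker (hasDerivAt_conjTranspose (hJd s)) (hasDerivAt_const s bathCouplingᴴ)
    refine (h1.fun_add h2).congr_deriv ?_
    simp only [Matrix.kronecker_zero, add_zero, hV]
  have hJ0 : J (-T) = 0 := by simp [hJ, couplingPrimitive]
  have hrd : ∀ s, HasDerivAt r ((-Complex.I * α) • ⁅V s, r s⁆) s := fun s =>
    hasDerivAt_interactionState hH hσ ϱ s
  have hZZ : Z * Z = 1 := bathParity_mul_self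
  have hZVZ : ∀ s, Z * V s * Z = -V s := fun s => bathParity_conj_interaction (a s)
  -- Conjugation by `Z` reverses the sign of the coupling, so the reflected state solves the
  -- equation with `V` replaced by `-V`.
  have hzd : ∀ s, HasDerivAt (fun s => Z * r s * Z) (-((-Complex.I * α) • ⁅V s, Z * r s * Z⁆)) s :=
    fun s => by
    refine (((hrd s).const_mul Z).mul_const Z).congr_deriv ?_
    have e1 : Z * (V s * r s) * Z = -(V s) * (Z * r s * Z) := by
      rw [← hZVZ s]
      simp only [Matrix.mul_assoc]
      rw [← Matrix.mul_assoc Z Z, hZZ, Matrix.one_mul]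
    have e2 : Z * (r s * V s) * Z = (Z * r s * Z) * -(V s) := by
      rw [← hZVZ s]
      simp only [Matrix.mul_assoc]
      rw [← Matrix.mul_assoc Z Z, hZZ, Matrix.one_mul]
    rw [Matrix.mul_smul, Matrix.smul_mul, Ring.lie_def, Ring.lie_def, mul_sub, sub_mul, e1, e2,
      ← smul_neg]
    congr 1
    simp only [neg_mul, mul_neg]
    abel
  have hr0 : r (-T) = ϱ := interactionState_gibbs_start hH hσ
  have hZϱ : Z * ϱ * Z = ϱ := by
    rw [hϱ, gibbs_bathHam]
    exact bathParity_conj_diagonal _ _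
  have hG := gibbs_isState hH β
  have hrb : ∀ s, TraceBound (r s) 1 := fun s => by
    rw [hr]
    exact (((traceBound_kronecker_gibbs hG β ω).conj_unitary
      (totalHam_unitary hH hσ (-T) s)).conj_unitary (freeEvo_conjTranspose_mul_self hH ω s))
  have hZu : Zᴴ * Z = 1 := by rw [hZ, bathParity_conjTranspose, bathParity_mul_self]
  have hzb : ∀ s, TraceBound (Z * r s * Z) 1 := fun s => by
    have := (hrb s).conj_unitary hZu
    rwa [show Zᴴ = Z from bathParity_conjTranspose] at this
  set Re := fun s => (1 / 2 : ℂ) • (r s + Z * r s * Z) with hRe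
  set Ro := fun s => (1 / 2 : ℂ) • (r s - Z * r s * Z) with hRo
  have he : ∀ s, HasDerivAt Re ((-Complex.I * α) • ⁅V s, Ro s⁆) s := fun s => by
    refine (((hrd s).fun_add (hzd s)).fun_const_smul (1 / 2 : ℂ)).congr_deriv ?_
    rw [hRo, matrix_lie_smul, matrix_lie_sub]
    module
  have ho : ∀ s, HasDerivAt Ro ((-Complex.I * α) • ⁅V s, Re s⁆) s := fun s => by
    refine (((hrd s).fun_sub (hzd s)).fun_const_smul (1 / 2 : ℂ)).congr_deriv ?_
    have : ⁅V s, Re s⁆ = (1 / 2 : ℂ) • (⁅V s, r s⁆ + ⁅V s, Z * r s * Z⁆) := by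
      rw [hRe, matrix_lie_smul]
      simp only [Ring.lie_def, mul_add, add_mul]
      congr 1
      abel
    rw [this]
    module
  have he0 : Re (-T) = ϱ := by
    simp only [hRe, hr0, hZϱ]; module
  have ho0 : Ro (-T) = 0 := by
    simp only [hRo, hr0, hZϱ]; module
  have heb : ∀ s, TraceBound (Re s) 1 := fun s => by
    refine (((hrb s).add (hzb s)).smul (1 / 2)).mono ?_
    norm_num
  have hexp := traceBound_even_expansion hα (by linarith : -T ≤ T) hV1 hV2 hJV
    (by simp [hJ0]) he ho he0 ho0 heb
  -- Parity acts on the bath alone, so the reflected state has the same partial trace.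
  have hRet : traceBath (Re T) = traceBath (r T) := by
    simp only [hRe]
    rw [traceBath_smul, traceBath_add, traceBath_bathParity_conj]
    module
  have hϱt : traceBath ϱ = gibbs β H := by
    rw [hϱ, traceBath_kronecker, gibbs_bathHam, Matrix.trace_diagonal, Fin.sum_univ_two]
    simp only [Matrix.cons_val_zero, Matrix.cons_val_one]
    rw [← Complex.ofReal_add, bathPop_add_neg, Complex.ofReal_one, one_smul]
  have hJc : Continuous J := continuous_iff_continuousAt.2 fun s => (hJd s).continuousAt
  have hint : Continuous fun s => (-(α : ℂ) ^ 2) • ⁅V s,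
      ⁅J s ⊗ₖ bathCoupling + (J s)ᴴ ⊗ₖ bathCouplingᴴ, ϱ⁆⁆ :=
    continuous_smul_lie _ hV1 (continuous_lie
      ((Continuous.kronecker hJc continuous_const).add
      (Continuous.kronecker hJc.star continuous_const)) continuous_const)
  have hstar : ∀ s, (J s)ᴴ = couplingPrimitive H Aᴴ σ ω T s := fun s => by
    rw [hJ, couplingPrimitive, couplingPrimitive, intervalIntegral, intervalIntegral,
      Matrix.conjTranspose_sub, ← integral_conjTranspose, ← integral_conjTranspose]
    simp only [coupling_conjTranspose hH, neg_neg]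
  have hIt : traceBath (∫ s in (-T)..T, (-(α : ℂ) ^ 2) • ⁅V s,
      ⁅J s ⊗ₖ bathCoupling + (J s)ᴴ ⊗ₖ bathCouplingᴴ, ϱ⁆⁆)
      = ∫ s in (-T)..T, (-(α : ℂ) ^ 2) •
          ((bathPop β (-ω) : ℂ) • secondOrder (gibbs β H) (a s) (J s)
            + (bathPop β ω : ℂ) • secondOrder (gibbs β H) (coupling H Aᴴ σ ω s)
              (couplingPrimitive H Aᴴ σ ω T s)) := by
    have := (traceBathCLM d).intervalIntegral_comp_comm (μ := volume)
      (hint.intervalIntegrable (-T) T)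
    rw [traceBathCLM_apply] at this
    rw [← this]
    refine intervalIntegral.integral_congr fun s _ => ?_
    simp only [traceBathCLM_apply]
    rw [traceBath_smul, hϱ, gibbs_bathHam, hV, traceBath_double_commutator, hstar, ha,
      coupling_conjTranspose hH, neg_neg]
  have h2 := hexp.traceBath
  rw [traceBath_sub, traceBath_sub, hRet, hϱt, hIt] at h2
  have hu : (evo H T)ᴴᴴ * (evo H T)ᴴ = 1 := by
    rw [Matrix.conjTranspose_conjTranspose]; exact evo_mul_conjTranspose_self hH T
  have h3 := h2.conj_unitary hu
  rw [Matrix.conjTranspose_conjTranspose, mul_sub, sub_mul, mul_sub, sub_mul,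
    ← stepMap_eq_interactionState hH] at h3
  have h4 : (evo H T)ᴴ * gibbs β H * evo H T = gibbs β H := by
    rw [Matrix.mul_assoc, (commute_gibbs_evo β T).eq, ← Matrix.mul_assoc,
      evo_conjTranspose_mul_self hH, Matrix.one_mul]
  rwa [h4] at h3

end SecondOrder

/-! ### From the finite window to the whole line -/

section Primitive

open Filter Topology

variable {d : ℕ} {H A : Matrix (Fin d) (Fin d) ℂ} {σ T : ℝ}

theorem integrable_coupling (hH : H.IsHermitian) (A : Matrix (Fin d) (Fin d) ℂ) (hσ : 0 < σ)
    (ω : ℝ) : Integrable (coupling H A σ ω) :=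
  ((integrable_gaussFilter hσ).mul_const ‖A‖).mono'
    (continuous_coupling hH A σ ω).aestronglyMeasurable
    (ae_of_all _ fun s => norm_coupling_le hH A hσ ω s)

theorem jumpOp_eq (H A : Matrix (Fin d) (Fin d) ℂ) (σ ω : ℝ) :
    jumpOp H A σ ω = ∫ s, coupling H A σ ω s := rfl

/-- The accumulated coupling on `(-∞, s]`. -/
noncomputable def couplingTail (H A : Matrix (Fin d) (Fin d) ℂ) (σ ω s : ℝ) :
    Matrix (Fin d) (Fin d) ℂ :=
  ∫ x in Set.Iic s, coupling H A σ ω x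

theorem couplingTail_eq_add (hH : H.IsHermitian) (A : Matrix (Fin d) (Fin d) ℂ) (hσ : 0 < σ)
    (ω T s : ℝ) :
    couplingTail H A σ ω s = couplingTail H A σ ω (-T) + couplingPrimitive H A σ ω T s := by
  have hi := integrable_coupling hH A hσ ω
  rw [couplingPrimitive, ← intervalIntegral.integral_Iic_sub_Iic hi.integrableOn hi.integrableOn]
  simp [couplingTail]

theorem hasDerivAt_couplingTail (hH : H.IsHermitian) (A : Matrix (Fin d) (Fin d) ℂ) (hσ : 0 < σ)
    (ω s : ℝ) : HasDerivAt (couplingTail H A σ ω) (coupling H A σ ω s) s := by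
  have h := (hasDerivAt_couplingPrimitive hH A σ ω 0 s).const_add (couplingTail H A σ ω (-0))
  exact h.congr_of_eventuallyEq
    (Eventually.of_forall fun x => couplingTail_eq_add hH A hσ ω 0 x)

theorem continuous_couplingTail (hH : H.IsHermitian) (A : Matrix (Fin d) (Fin d) ℂ) (hσ : 0 < σ)
    (ω : ℝ) : Continuous (couplingTail H A σ ω) :=
  continuous_iff_continuousAt.2 fun s => (hasDerivAt_couplingTail hH A hσ ω s).continuousAt

theorem norm_couplingTail_le_setIntegral (hH : H.IsHermitian) (A : Matrix (Fin d) (Fin d) ℂ)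
    (hσ : 0 < σ) (ω s : ℝ) :
    ‖couplingTail H A σ ω s‖ ≤ (∫ x in Set.Iic s, gaussFilter σ x) * ‖A‖ := by
  rw [← integral_mul_const]
  exact norm_integral_le_of_norm_le ((integrable_gaussFilter hσ).mul_const ‖A‖).integrableOn
    (ae_of_all _ fun x => norm_coupling_le hH A hσ ω x)

theorem norm_couplingTail_le (hH : H.IsHermitian) (A : Matrix (Fin d) (Fin d) ℂ) (hσ : 0 < σ)
    (ω s : ℝ) : ‖couplingTail H A σ ω s‖ ≤ (∫ x, gaussFilter σ x) * ‖A‖ :=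
  (norm_couplingTail_le_setIntegral hH A hσ ω s).trans
    (mul_le_mul_of_nonneg_right (setIntegral_le_integral (integrable_gaussFilter hσ)
      (ae_of_all _ fun t => (gaussFilter_pos hσ t).le)) (norm_nonneg _))

theorem norm_jumpOp_le (hH : H.IsHermitian) (A : Matrix (Fin d) (Fin d) ℂ) (hσ : 0 < σ)
    (ω : ℝ) : ‖jumpOp H A σ ω‖ ≤ (∫ x, gaussFilter σ x) * ‖A‖ := by
  rw [← integral_mul_const]
  exact norm_integral_le_of_norm_le ((integrable_gaussFilter hσ).mul_const ‖A‖)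
    (ae_of_all _ fun x => norm_coupling_le hH A hσ ω x)

theorem tendsto_couplingTail_atBot (H A : Matrix (Fin d) (Fin d) ℂ) (σ ω : ℝ) :
    Tendsto (couplingTail H A σ ω) atBot (𝓝 0) :=
  tendsto_integral_Iic_zero tendsto_id

theorem tendsto_couplingTail_atTop (hH : H.IsHermitian) (A : Matrix (Fin d) (Fin d) ℂ)
    (hσ : 0 < σ) (ω : ℝ) : Tendsto (couplingTail H A σ ω) atTop (𝓝 (jumpOp H A σ ω)) := by
  have hi := integrable_coupling hH A hσ ω
  have h1 : couplingTail H A σ ω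
      = fun s => jumpOp H A σ ω - ∫ x in Set.Ioi s, coupling H A σ ω x := by
    funext s
    rw [jumpOp_eq, ← intervalIntegral.integral_Iic_add_Ioi hi.integrableOn hi.integrableOn (b := s)]
    simp [couplingTail]
  rw [h1]
  simpa using (tendsto_const_nhds (x := jumpOp H A σ ω)).sub
    (tendsto_integral_Ioi_zero (f := coupling H A σ ω) (μ := volume) tendsto_id)

/-- The phase `exp(iω(s₂ - s₁))` factorises, so the inner integral is the adjoint of the accumulated
coupling. -/
theorem lambOp_eq (hH : H.IsHermitian) (A : Matrix (Fin d) (Fin d) ℂ) (hσ : 0 < σ) (ω : ℝ) :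
    lambOp H A σ ω = ∫ s, (couplingTail H A σ ω s)ᴴ * coupling H A σ ω s := by
  unfold lambOp
  refine integral_congr_ae (ae_of_all _ fun s₁ => ?_)
  simp only []
  have hi : Integrable (fun s => (coupling H A σ ω s)ᴴ) (volume.restrict (Set.Iic s₁)) :=
    ((starL' ℝ (A := Matrix (Fin d) (Fin d) ℂ)).toContinuousLinearMap.integrable_comp
      (integrable_coupling hH A hσ ω)).restrict
  have h2 := ((ContinuousLinearMap.mul ℂ (Matrix (Fin d) (Fin d) ℂ)).flip
    (coupling H A σ ω s₁)).integral_comp_comm hi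
  rw [couplingTail, ← integral_conjTranspose]
  refine Eq.trans ?_ h2
  refine integral_congr_ae (ae_of_all _ fun s₂ => ?_)
  simp only [ContinuousLinearMap.flip_apply, ContinuousLinearMap.mul_apply']
  rw [coupling, coupling, Matrix.conjTranspose_smul, Matrix.smul_mul, Matrix.mul_smul, smul_smul]
  congr 1
  rw [star_mul']
  simp only [Complex.star_def, Complex.conj_ofReal, ← Complex.exp_conj, map_mul, map_neg,
    Complex.conj_I, neg_neg]
  rw [mul_sub ω s₂ s₁, Complex.ofReal_sub, mul_sub, Complex.exp_sub]
  rw [show -Complex.I * ((ω * s₁ : ℝ) : ℂ) = -(Complex.I * ((ω * s₁ : ℝ) : ℂ)) by ring,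
    Complex.exp_neg]
  push_cast
  ring

theorem integrable_couplingTail_mul (hH : H.IsHermitian) (A : Matrix (Fin d) (Fin d) ℂ)
    (hσ : 0 < σ) (ω : ℝ) : Integrable fun s => (couplingTail H A σ ω s)ᴴ * coupling H A σ ω s := by
  refine ((integrable_gaussFilter hσ).mul_const (((∫ x, gaussFilter σ x) * ‖A‖) * ‖A‖)).mono'
    ((continuous_couplingTail hH A hσ ω).star.mul
      (continuous_coupling hH A σ ω)).aestronglyMeasurable (ae_of_all _ fun s => ?_)
  refine (norm_mul_le _ _).trans ?_
  rw [Matrix.l2_opNorm_conjTranspose]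
  refine (mul_le_mul (norm_couplingTail_le hH A hσ ω s) (norm_coupling_le hH A hσ ω s)
    (norm_nonneg _) (by have := integral_gaussFilter_nonneg hσ; positivity)).trans (le_of_eq ?_)
  ring

/-- The second-order generator in terms of the jump operator `V` and the Lamb operator `G`. -/
noncomputable def generator (H A : Matrix (Fin d) (Fin d) ℂ) (σ ω : ℝ)
    (ρ : Matrix (Fin d) (Fin d) ℂ) : Matrix (Fin d) (Fin d) ℂ :=
  jumpOp H A σ ω * ρ * (jumpOp H A σ ω)ᴴ - (lambOp H A σ ω)ᴴ * ρ - ρ * lambOp H A σ ω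

theorem integrable_secondOrder (hH : H.IsHermitian) (A : Matrix (Fin d) (Fin d) ℂ) (hσ : 0 < σ)
    (ω : ℝ) (ρ : Matrix (Fin d) (Fin d) ℂ) :
    Integrable fun s => secondOrder ρ (coupling H A σ ω s) (couplingTail H A σ ω s) := by
  have hF := integral_gaussFilter_nonneg hσ
  refine ((integrable_gaussFilter hσ).mul_const
    (4 * ‖ρ‖ * ‖A‖ * ((∫ x, gaussFilter σ x) * ‖A‖))).mono'
    (continuous_secondOrder ρ (continuous_coupling hH A σ ω)
      (continuous_couplingTail hH A hσ ω)).aestronglyMeasurable (ae_of_all _ fun s => ?_)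
  have h1 := norm_coupling_le hH A hσ ω s
  have h2 := norm_couplingTail_le hH A hσ ω s
  generalize coupling H A σ ω s = a at *
  generalize couplingTail H A σ ω s = J at *
  have hm : ∀ X Y Z : Matrix (Fin d) (Fin d) ℂ, ‖X * Y * Z‖ ≤ ‖X‖ * ‖Y‖ * ‖Z‖ := fun X Y Z =>
    (norm_mul_le _ _).trans (mul_le_mul_of_nonneg_right (norm_mul_le _ _) (norm_nonneg _))
  have e1 := hm aᴴ J ρ
  have e2 := hm ρ Jᴴ a
  have e3 := hm a ρ Jᴴ
  have e4 := hm J ρ aᴴ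
  rw [Matrix.l2_opNorm_conjTranspose] at e1 e2 e3 e4
  have h3 : ‖secondOrder ρ a J‖ ≤ 4 * ‖ρ‖ * (‖a‖ * ‖J‖) := by
    unfold secondOrder
    refine (norm_sub_le _ _).trans ?_
    have := norm_sub_le (aᴴ * J * ρ + ρ * Jᴴ * a) (a * ρ * Jᴴ)
    have := norm_add_le (aᴴ * J * ρ) (ρ * Jᴴ * a)
    linarith
  refine h3.trans ?_
  have h4 := mul_le_mul h1 h2 (norm_nonneg _)
    (mul_nonneg (gaussFilter_pos hσ s).le (norm_nonneg A))
  have h5 := mul_le_mul_of_nonneg_left h4 (by positivity : 0 ≤ 4 * ‖ρ‖)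
  refine h5.trans (le_of_eq ?_)
  ring

/-- Write `a` for the coupling and `J` for its primitive vanishing at `-∞`. The terms `a ρ Jᴴ + J ρ
aᴴ` form the derivative of `J ρ Jᴴ` and integrate to its value at `+∞`, where `J` is the jump
operator. The other two terms integrate to products of `ρ` with the Lamb operator. -/
theorem integral_secondOrder (hH : H.IsHermitian) (A : Matrix (Fin d) (Fin d) ℂ) (hσ : 0 < σ)
    (ω : ℝ) (ρ : Matrix (Fin d) (Fin d) ℂ) :
    ∫ s, secondOrder ρ (coupling H A σ ω s) (couplingTail H A σ ω s)
      = -generator H A σ ω ρ := by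
  set a := coupling H A σ ω with ha
  set J := couplingTail H A σ ω with hJ
  have hd : ∀ s, HasDerivAt (fun s => J s * ρ * (J s)ᴴ)
      (a s * ρ * (J s)ᴴ + J s * ρ * (a s)ᴴ) s := fun s => by
    have h1 := hasDerivAt_couplingTail hH A hσ ω s
    exact (h1.mul_const ρ).fun_mul (hasDerivAt_conjTranspose h1)
  have hG := integrable_couplingTail_mul hH A hσ ω
  have hGs : Integrable fun s => (a s)ᴴ * J s := by
    have h := (starL' ℝ (A := Matrix (Fin d) (Fin d) ℂ)).toContinuousLinearMap.integrable_comp hG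
    refine h.congr (ae_of_all _ fun s => ?_)
    change star ((couplingTail H A σ ω s)ᴴ * coupling H A σ ω s) = _
    rw [Matrix.star_eq_conjTranspose, Matrix.conjTranspose_mul,
      Matrix.conjTranspose_conjTranspose]
  have i1 : Integrable fun s => (a s)ᴴ * J s * ρ :=
    ((ContinuousLinearMap.mul ℂ (Matrix (Fin d) (Fin d) ℂ)).flip ρ).integrable_comp hGs
  have i2 : Integrable fun s => ρ * ((J s)ᴴ * a s) :=
    ((ContinuousLinearMap.mul ℂ (Matrix (Fin d) (Fin d) ℂ)) ρ).integrable_comp hG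
  have e1 : ∫ s, (a s)ᴴ * J s * ρ = (lambOp H A σ ω)ᴴ * ρ := by
    have h := ((ContinuousLinearMap.mul ℂ (Matrix (Fin d) (Fin d) ℂ)).flip ρ).integral_comp_comm hGs
    refine h.trans ?_
    simp only [ContinuousLinearMap.flip_apply, ContinuousLinearMap.mul_apply']
    rw [lambOp_eq hH A hσ, ← integral_conjTranspose]
    simp only [Matrix.conjTranspose_mul, Matrix.conjTranspose_conjTranspose, ha, hJ]
  have e2 : ∫ s, ρ * ((J s)ᴴ * a s) = ρ * lambOp H A σ ω := by
    have h := ((ContinuousLinearMap.mul ℂ (Matrix (Fin d) (Fin d) ℂ)) ρ).integral_comp_comm hG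
    refine h.trans ?_
    rw [lambOp_eq hH A hσ]; rfl
  have hsum : ∀ s, a s * ρ * (J s)ᴴ + J s * ρ * (a s)ᴴ
      = (a s)ᴴ * J s * ρ + ρ * ((J s)ᴴ * a s) - secondOrder ρ (a s) (J s) := fun s => by
    rw [secondOrder, Matrix.mul_assoc ρ]; abel
  have i3 := integrable_secondOrder hH A hσ ω ρ
  have hdi : Integrable fun s => a s * ρ * (J s)ᴴ + J s * ρ * (a s)ᴴ := by
    simp only [hsum]
    exact (i1.add i2).sub i3
  have hbot : Tendsto (fun s => J s * ρ * (J s)ᴴ) atBot (𝓝 0) := by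
    have h := tendsto_couplingTail_atBot H A σ ω
    have h' : Tendsto (fun s => (J s)ᴴ) atBot (𝓝 (0 : Matrix (Fin d) (Fin d) ℂ)ᴴ) :=
      h.star
    simpa using (h.mul_const ρ).mul h'
  have htop : Tendsto (fun s => J s * ρ * (J s)ᴴ) atTop
      (𝓝 (jumpOp H A σ ω * ρ * (jumpOp H A σ ω)ᴴ)) := by
    have h := tendsto_couplingTail_atTop hH A hσ ω
    have h' : Tendsto (fun s => (J s)ᴴ) atTop (𝓝 (jumpOp H A σ ω)ᴴ) := h.star
    exact (h.mul_const ρ).mul h'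
  have hftc := integral_of_hasDerivAt_of_tendsto hd hdi hbot htop
  rw [sub_zero] at hftc
  have h5 : ∫ s, a s * ρ * (J s)ᴴ + J s * ρ * (a s)ᴴ
      = (lambOp H A σ ω)ᴴ * ρ + ρ * lambOp H A σ ω - ∫ s, secondOrder ρ (a s) (J s) := by
    rw [← e1, ← e2, ← integral_add i1 i2]
    simp only [hsum]
    exact integral_sub (i1.add i2) i3
  rw [hftc] at h5
  rw [generator, h5]
  abel

/-- Three errors arise: the primitive starts at `-T` instead of `-∞`, and the outer integral misses
each of the two tails. In each one a factor `∫ f` is replaced by a Gaussian tail. -/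
theorem traceBound_truncated_generator (hH : H.IsHermitian) (A : Matrix (Fin d) (Fin d) ℂ)
    (hσ : 0 < σ) (hT : 0 < T) (ω : ℝ) {ρ : Matrix (Fin d) (Fin d) ℂ} (hρ : TraceBound ρ 1) :
    TraceBound ((∫ s in (-T)..T, secondOrder ρ (coupling H A σ ω s)
      (couplingPrimitive H A σ ω T s)) + generator H A σ ω ρ)
      (96 * ‖A‖ ^ 2 * (σ * Real.exp (-T ^ 2 / (4 * σ ^ 2)))) := by
  set F := ∫ x, gaussFilter σ x with hF
  set e := Real.exp (-T ^ 2 / (4 * σ ^ 2)) with he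
  have hF0 : 0 ≤ F := integral_gaussFilter_nonneg hσ
  have he0 : 0 ≤ e := (Real.exp_pos _).le
  have hg := integrable_gaussFilter hσ
  have ca := continuous_coupling hH A σ ω
  have cJ := continuous_couplingTail hH A hσ ω
  have hi := integrable_secondOrder hH A hσ ω ρ
  set q := fun s => secondOrder ρ (coupling H A σ ω s) (couplingTail H A σ ω s) with hq
  have hprim : ∀ s, secondOrder ρ (coupling H A σ ω s) (couplingPrimitive H A σ ω T s)
      = q s - secondOrder ρ (coupling H A σ ω s) (couplingTail H A σ ω (-T)) := fun s => by
    rw [hq, ← secondOrder_sub, couplingTail_eq_add hH A hσ ω T s]; simp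
  have cK : Continuous fun s =>
      secondOrder ρ (coupling H A σ ω s) (couplingTail H A σ ω (-T)) :=
    continuous_secondOrder ρ ca continuous_const
  have hsplit : (∫ s in (-T)..T, secondOrder ρ (coupling H A σ ω s)
      (couplingPrimitive H A σ ω T s)) + generator H A σ ω ρ
      = -(∫ s in Set.Ioc (-T) T, secondOrder ρ (coupling H A σ ω s) (couplingTail H A σ ω (-T)))
        - (∫ s in Set.Iic (-T), q s) - ∫ s in Set.Ioi T, q s := by
    have h1 : generator H A σ ω ρ = -∫ s, q s := by
      rw [hq, integral_secondOrder hH A hσ, neg_neg]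
    have h2 : ∫ s, q s = (∫ s in Set.Iic (-T), q s) + (∫ s in (-T)..T, q s)
        + ∫ s in Set.Ioi T, q s := by
      rw [← intervalIntegral.integral_Iic_sub_Iic hi.integrableOn hi.integrableOn,
        add_sub_cancel, intervalIntegral.integral_Iic_add_Ioi hi.integrableOn hi.integrableOn]
    simp only [hprim]
    rw [h1, h2, intervalIntegral.integral_sub hi.intervalIntegrable (cK.intervalIntegrable _ _),
      intervalIntegral.integral_of_le (by linarith : -T ≤ T) (f := fun s =>
        secondOrder ρ (coupling H A σ ω s) (couplingTail H A σ ω (-T)))]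
    abel
  have hpt : ∀ s J, ∀ c, ‖J‖ ≤ c → TraceBound (secondOrder ρ (coupling H A σ ω s) J)
      (gaussFilter σ s * (4 * ‖A‖ * c)) := fun s J c hc => by
    refine hρ.secondOrder.mono ?_
    have h1 := mul_le_mul (norm_coupling_le hH A hσ ω s) hc (norm_nonneg _)
      (mul_nonneg (gaussFilter_pos hσ s).le (norm_nonneg A))
    linarith
  have htail : ‖couplingTail H A σ ω (-T)‖ ≤ e * F * ‖A‖ :=
    (norm_couplingTail_le_setIntegral hH A hσ ω (-T)).trans
      (mul_le_mul_of_nonneg_right (setIntegral_Iic_gaussFilter_le hσ hT.le) (norm_nonneg _))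
  have hset : ∀ S : Set ℝ, ∀ c, 0 ≤ c → (∫ s in S, gaussFilter σ s ≤ c) → ∀ J : ℝ → _, ∀ c', 0 ≤ c' →
      Integrable (fun s => secondOrder ρ (coupling H A σ ω s) (J s)) (volume.restrict S) →
      (∀ s, ‖J s‖ ≤ c') → TraceBound (∫ s in S, secondOrder ρ (coupling H A σ ω s) (J s))
        (c * (4 * ‖A‖ * c')) := fun S c _ hc J c' hc' hJi hJ => by
    refine (TraceBound.integral hJi (c := fun s => gaussFilter σ s * (4 * ‖A‖ * c'))
      (hg.restrict.mul_const _) (ae_of_all _ fun s => hpt s (J s) c' (hJ s))).mono ?_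
    rw [integral_mul_const]
    exact mul_le_mul_of_nonneg_right hc (by positivity)
  have b1 := hset (Set.Ioc (-T) T) F hF0 (setIntegral_le_integral hg
    (ae_of_all _ fun t => (gaussFilter_pos hσ t).le)) (fun _ => couplingTail H A σ ω (-T))
    (e * F * ‖A‖) (by positivity) cK.integrableOn_Ioc (fun _ => htail)
  have b2 := hset (Set.Iic (-T)) (e * F) (by positivity) (setIntegral_Iic_gaussFilter_le hσ hT.le)
    (couplingTail H A σ ω) (F * ‖A‖) (by positivity) hi.restrict
    (norm_couplingTail_le hH A hσ ω)
  have b3 := hset (Set.Ioi T) (e * F) (by positivity) (setIntegral_Ioi_gaussFilter_le hσ hT.le)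
    (couplingTail H A σ ω) (F * ‖A‖) (by positivity) hi.restrict
    (norm_couplingTail_le hH A hσ ω)
  rw [hsplit]
  refine ((b1.neg.sub b2).sub b3).mono ?_
  -- Each of the three errors is at most `4 * ‖A‖ ^ 2 * e * F ^ 2`, so this bound produces `96 = 3 *
  -- 4 * 8`.
  have hF2 : F ^ 2 ≤ 8 * σ := integral_gaussFilter_sq_le hσ
  have : F * (4 * ‖A‖ * (e * F * ‖A‖)) + e * F * (4 * ‖A‖ * (F * ‖A‖))
      + e * F * (4 * ‖A‖ * (F * ‖A‖)) = 12 * ‖A‖ ^ 2 * e * F ^ 2 := by ring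
  rw [this]
  have := mul_le_mul_of_nonneg_left hF2 (by positivity : 0 ≤ 12 * ‖A‖ ^ 2 * e)
  linarith

end Primitive

/-! ### Averages over the set of couplings -/

section Mean

variable {κ : Type*} {E : Type*} [AddCommGroup E] [Module ℝ E] {𝒜 : Finset κ}

theorem uniformMean_congr {F G : κ → E} (h : ∀ A ∈ 𝒜, F A = G A) :
    uniformMean 𝒜 F = uniformMean 𝒜 G := by
  unfold uniformMean; rw [Finset.sum_congr rfl h]

theorem uniformMean_add (F G : κ → E) :
    uniformMean 𝒜 (fun A => F A + G A) = uniformMean 𝒜 F + uniformMean 𝒜 G := by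
  unfold uniformMean; rw [Finset.sum_add_distrib, smul_add]

theorem uniformMean_sub (F G : κ → E) :
    uniformMean 𝒜 (fun A => F A - G A) = uniformMean 𝒜 F - uniformMean 𝒜 G := by
  unfold uniformMean; rw [Finset.sum_sub_distrib, smul_sub]

theorem uniformMean_const (h : 𝒜.Nonempty) (x : E) : uniformMean 𝒜 (fun _ => x) = x := by
  unfold uniformMean
  rw [Finset.sum_const, ← Nat.cast_smul_eq_nsmul ℝ, smul_smul, inv_mul_cancel₀, one_smul]
  exact_mod_cast h.card_ne_zero

theorem uniformMean_mono {F G : κ → ℝ} (h : ∀ A ∈ 𝒜, F A ≤ G A) :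
    uniformMean 𝒜 F ≤ uniformMean 𝒜 G := by
  unfold uniformMean
  exact smul_le_smul_of_nonneg_left (Finset.sum_le_sum h) (by positivity)

theorem uniformMean_nonneg {F : κ → ℝ} (h : ∀ A ∈ 𝒜, 0 ≤ F A) : 0 ≤ uniformMean 𝒜 F := by
  unfold uniformMean
  exact smul_nonneg (by positivity) (Finset.sum_nonneg h)

theorem uniformMean_mul_left (c : ℝ) (F : κ → ℝ) :
    uniformMean 𝒜 (fun A => c * F A) = c * uniformMean 𝒜 F := by
  unfold uniformMean; rw [← Finset.mul_sum]; simp only [smul_eq_mul]; ring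

/-- The adjoint is an involution of `𝒜`, hence a permutation of the summands. -/
theorem uniformMean_conjTranspose {d : ℕ} {𝒜 : Finset (Matrix (Fin d) (Fin d) ℂ)}
    (h : IsCouplingSet 𝒜) (F : Matrix (Fin d) (Fin d) ℂ → E) :
    uniformMean 𝒜 (fun A => F Aᴴ) = uniformMean 𝒜 F := by
  unfold uniformMean
  congr 1
  exact Finset.sum_nbij' (fun A => Aᴴ) (fun A => Aᴴ) (fun A hA => (h.2 A hA).2)
    (fun A hA => (h.2 A hA).2) (by simp) (by simp) (by simp)

theorem TraceBound.uniformMean {ι : Type*} [Fintype ι] [DecidableEq ι] {F : κ → Matrix ι ι ℂ}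
    {c : κ → ℝ} (h : ∀ A ∈ 𝒜, TraceBound (F A) (c A)) :
    TraceBound (uniformMean 𝒜 F) (uniformMean 𝒜 c) := by
  unfold ThermalPrep.uniformMean
  refine ((TraceBound.sum 𝒜 h).real_smul _).mono (le_of_eq ?_)
  rw [abs_of_nonneg (by positivity), smul_eq_mul]

end Mean

/-! ### The channel is linear and contracts the trace norm -/

section Channel

variable {d : ℕ} {H A : Matrix (Fin d) (Fin d) ℂ} {β σ T α ω : ℝ}

theorem integrable_smul_of_norm_le {E : Type*} [NormedAddCommGroup E] [NormedSpace ℝ E]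
    {g : ℝ → ℝ} {F : ℝ → E} (hg : Integrable g) (hF : AEStronglyMeasurable F) {C : ℝ}
    (hC : ∀ ω, ‖F ω‖ ≤ C) : Integrable fun ω => g ω • F ω := by
  refine (hg.norm.mul_const C).mono' (hg.aestronglyMeasurable.smul hF) (ae_of_all _ fun ω => ?_)
  rw [norm_smul]
  exact mul_le_mul_of_nonneg_left (hC ω) (norm_nonneg _)

theorem continuous_bathPop (β : ℝ) : Continuous (bathPop β) := by
  unfold bathPop
  exact Continuous.inv₀ (by fun_prop) fun ω => by positivity

theorem bathPop_le_one (β ω : ℝ) : bathPop β ω ≤ 1 := by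
  have := bathPop_add_neg β ω
  have := bathPop_nonneg β (-ω)
  linarith

theorem continuous_gibbs_bathHam (β : ℝ) : Continuous fun ω => gibbs β (bathHam ω) := by
  have h := continuous_bathPop β
  have h2 : (fun ω => gibbs β (bathHam ω)) = fun ω =>
      (bathPop β (-ω) : ℂ) • Matrix.diagonal ![(1 : ℂ), 0]
        + (bathPop β ω : ℂ) • Matrix.diagonal ![(0 : ℂ), 1] := by
    funext ω
    rw [gibbs_bathHam]
    ext i j
    fin_cases i <;> fin_cases j <;> simp
  rw [h2]
  have h3 : Continuous fun ω => bathPop β (-ω) := h.comp continuous_neg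
  fun_prop

theorem norm_gibbs_bathHam_le (β ω : ℝ) : ‖gibbs β (bathHam ω)‖ ≤ 1 := by
  rw [gibbs_bathHam]
  refine norm_diagonal_le zero_le_one fun i => ?_
  have h := bathPop_nonneg β
  have h1 := bathPop_le_one β
  fin_cases i
  · simpa [abs_of_nonneg (h (-ω))] using h1 (-ω)
  · simpa [abs_of_nonneg (h ω)] using h1 ω

theorem stronglyMeasurable_stepMap (H A : Matrix (Fin d) (Fin d) ℂ) (hσ : 0 < σ)
    (β T α : ℝ) (ρ : Matrix (Fin d) (Fin d) ℂ) :
    StronglyMeasurable fun ω => stepMap H A β σ T α ω ρ := by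
  have hU : StronglyMeasurable fun ω => timeOrderedExp (totalHam H A σ α ω) (-T) T :=
    stronglyMeasurable_timeOrderedExp (continuous_totalHam H A σ α)
      (fun ω => exists_norm_totalHam_le H A hσ α ω) (-T) T
  have hUs : StronglyMeasurable fun ω => (timeOrderedExp (totalHam H A σ α ω) (-T) T)ᴴ :=
    hU.star
  have hρ : StronglyMeasurable fun ω => ρ ⊗ₖ gibbs β (bathHam ω) :=
    (Continuous.kronecker continuous_const (continuous_gibbs_bathHam β)).stronglyMeasurable
  exact (traceBathCLM d).continuous.comp_stronglyMeasurable ((hU.mul hρ).mul hUs)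

theorem exists_norm_stepMap_le (hH : H.IsHermitian) (A : Matrix (Fin d) (Fin d) ℂ) (hσ : 0 < σ)
    (β T α : ℝ) (ρ : Matrix (Fin d) (Fin d) ℂ) : ∃ C, ∀ ω, ‖stepMap H A β σ T α ω ρ‖ ≤ C := by
  refine ⟨‖traceBathCLM d‖ * ‖ρ‖, fun ω => ?_⟩
  refine ((traceBathCLM d).le_opNorm _).trans (mul_le_mul_of_nonneg_left ?_ (norm_nonneg _))
  have hU := norm_le_one_of_conjTranspose_mul_self
    (totalHam_unitary (A := A) (α := α) (ω := ω) hH hσ (-T) T)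
  refine (norm_mul_le _ _).trans ?_
  rw [Matrix.l2_opNorm_conjTranspose]
  refine (mul_le_of_le_one_right (norm_nonneg _) hU).trans ((norm_mul_le _ _).trans ?_)
  refine (mul_le_of_le_one_left (norm_nonneg _) hU).trans ((norm_kronecker_le _ _).trans ?_)
  exact mul_le_of_le_one_right (norm_nonneg _) (norm_gibbs_bathHam_le β ω)

theorem integrable_smul_stepMap (hH : H.IsHermitian) (A : Matrix (Fin d) (Fin d) ℂ) (hσ : 0 < σ)
    (β T α : ℝ) (ρ : Matrix (Fin d) (Fin d) ℂ) {g : ℝ → ℝ} (hg : Integrable g) :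
    Integrable fun ω => g ω • stepMap H A β σ T α ω ρ := by
  obtain ⟨C, hC⟩ := exists_norm_stepMap_le hH A hσ β T α ρ
  exact integrable_smul_of_norm_le hg
    (stronglyMeasurable_stepMap H A hσ β T α ρ).aestronglyMeasurable hC

/-- The isometry appending the bath basis state `k`. -/
noncomputable def bathIsometry (d : ℕ) (k : Fin 2) : Matrix (Fin d × Fin 2) (Fin d) ℂ :=
  Matrix.of fun p j => if p = (j, k) then 1 else 0

theorem bathIsometry_conjTranspose_mul_self (k : Fin 2) :
    (bathIsometry d k)ᴴ * bathIsometry d k = 1 := by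
  ext i j
  simp only [bathIsometry, Matrix.mul_apply, Matrix.conjTranspose_apply, Matrix.of_apply,
    Fintype.sum_prod_type, Prod.mk.injEq]
  by_cases h : i = j
  · subst h; simp [ite_and]
  · have h' : ¬j = i := fun e => h e.symm
    simp [ite_and, h, h']

theorem norm_bathIsometry_le (k : Fin 2) : ‖bathIsometry d k‖ ≤ 1 := by
  have h1 := Matrix.l2_opNorm_conjTranspose_mul_self (bathIsometry d k)
  rw [bathIsometry_conjTranspose_mul_self] at h1
  have h2 := norm_one_le_one (ι := Fin d)
  nlinarith [norm_nonneg (bathIsometry d k)]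

theorem kronecker_diagonal_eq_sum (X : Matrix (Fin d) (Fin d) ℂ) (p : Fin 2 → ℂ) :
    X ⊗ₖ Matrix.diagonal p = ∑ k, p k • (bathIsometry d k * X * (bathIsometry d k)ᴴ) := by
  ext ⟨i, a⟩ ⟨j, b⟩
  simp only [Matrix.kroneckerMap_apply, Matrix.sum_apply, Matrix.smul_apply, Matrix.mul_apply,
    bathIsometry, Matrix.of_apply, Matrix.conjTranspose_apply, Prod.mk.injEq, Matrix.diagonal_apply]
  fin_cases a <;> fin_cases b <;> simp [mul_comm]

/-- The thermal bath makes this a convex combination of isometric copies of `X`. No positivity of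
`X` is needed, so differences of states are covered. -/
theorem TraceBound.kronecker_gibbs {X : Matrix (Fin d) (Fin d) ℂ} {c : ℝ} (h : TraceBound X c)
    (β ω : ℝ) : TraceBound (X ⊗ₖ gibbs β (bathHam ω)) c := by
  rw [gibbs_bathHam, kronecker_diagonal_eq_sum]
  have hk : ∀ k, TraceBound (bathIsometry d k * X * (bathIsometry d k)ᴴ) c := fun k W hW => by
    rw [← Matrix.mul_assoc, Matrix.trace_mul_comm, ← Matrix.mul_assoc, ← Matrix.mul_assoc]
    refine h _ ?_
    have hi := norm_bathIsometry_le (d := d) k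
    refine (Matrix.l2_opNorm_mul _ _).trans (mul_le_one₀ ?_ (norm_nonneg _) hi)
    refine (Matrix.l2_opNorm_mul _ _).trans (mul_le_one₀ ?_ (norm_nonneg _) hW)
    rwa [Matrix.l2_opNorm_conjTranspose]
  refine (TraceBound.sum Finset.univ fun k _ => (hk k).smul _).mono (le_of_eq ?_)
  rw [← Finset.sum_mul, Fin.sum_univ_two]
  simp only [Matrix.cons_val_zero, Matrix.cons_val_one, Complex.norm_real,
    Real.norm_of_nonneg (bathPop_nonneg _ _), bathPop_add_neg, one_mul]

theorem TraceBound.stepMap (hH : H.IsHermitian) (A : Matrix (Fin d) (Fin d) ℂ) (hσ : 0 < σ)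
    {X : Matrix (Fin d) (Fin d) ℂ} {c : ℝ} (h : TraceBound X c) (β T α ω : ℝ) :
    TraceBound (stepMap H A β σ T α ω X) c :=
  ((h.kronecker_gibbs β ω).conj_unitary (totalHam_unitary hH hσ (-T) T)).traceBath

theorem stepMap_sub (H A : Matrix (Fin d) (Fin d) ℂ) (β σ T α ω : ℝ)
    (X Y : Matrix (Fin d) (Fin d) ℂ) :
    stepMap H A β σ T α ω (X - Y) = stepMap H A β σ T α ω X - stepMap H A β σ T α ω Y := by
  have h : ∀ P : Matrix (Fin 2) (Fin 2) ℂ, (X - Y) ⊗ₖ P = X ⊗ₖ P - Y ⊗ₖ P := fun P => by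
    ext i j; simp [sub_mul]
  simp only [stepMap, h, mul_sub, sub_mul, traceBath_sub]

theorem stepMap_smul (H A : Matrix (Fin d) (Fin d) ℂ) (β σ T α ω : ℝ) (c : ℂ)
    (X : Matrix (Fin d) (Fin d) ℂ) :
    stepMap H A β σ T α ω (c • X) = c • stepMap H A β σ T α ω X := by
  simp only [stepMap, Matrix.smul_kronecker, Matrix.mul_smul, Matrix.smul_mul, traceBath_smul]

variable {𝒜 : Finset (Matrix (Fin d) (Fin d) ℂ)} {g : ℝ → ℝ}

theorem channel_sub (hH : H.IsHermitian) (hσ : 0 < σ) (hg : Integrable g)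
    (X Y : Matrix (Fin d) (Fin d) ℂ) :
    channel H 𝒜 g β σ T α (X - Y) = channel H 𝒜 g β σ T α X - channel H 𝒜 g β σ T α Y := by
  unfold channel
  refine Eq.trans ?_ (uniformMean_sub _ _)
  refine uniformMean_congr fun A _ => ?_
  rw [← integral_sub (integrable_smul_stepMap hH A hσ β T α X hg)
    (integrable_smul_stepMap hH A hσ β T α Y hg)]
  simp only [stepMap_sub, smul_sub]

theorem channel_smul (H : Matrix (Fin d) (Fin d) ℂ) (𝒜 : Finset (Matrix (Fin d) (Fin d) ℂ))
    (g : ℝ → ℝ) (β σ T α : ℝ) (c : ℂ) (X : Matrix (Fin d) (Fin d) ℂ) :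
    channel H 𝒜 g β σ T α (c • X) = c • channel H 𝒜 g β σ T α X := by
  unfold channel uniformMean
  rw [smul_comm c, Finset.smul_sum (r := c)]
  congr 1
  refine Finset.sum_congr rfl fun A _ => ?_
  rw [← integral_smul]
  simp only [stepMap_smul, smul_comm c]

theorem TraceBound.channel (hH : H.IsHermitian) (hσ : 0 < σ) (h𝒜 : 𝒜.Nonempty)
    (hg : IsProbDensity g) {X : Matrix (Fin d) (Fin d) ℂ} {c : ℝ} (h : TraceBound X c) :
    TraceBound (channel H 𝒜 g β σ T α X) c := by
  unfold ThermalPrep.channel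
  have key : ∀ A ∈ 𝒜, TraceBound (∫ ω, g ω • ThermalPrep.stepMap H A β σ T α ω X) c := by
    intro A _
    have := TraceBound.integral (integrable_smul_stepMap hH A hσ β T α X hg.2.1)
      (hg.2.1.mul_const c) (ae_of_all _ fun ω => by
        have := (TraceBound.stepMap hH A hσ h β T α ω).real_smul (g ω)
        rwa [abs_of_nonneg (hg.1 ω)] at this)
    rwa [integral_mul_const, hg.2.2, one_mul] at this
  have := TraceBound.uniformMean key
  rwa [uniformMean_const h𝒜] at this

end Channel

/-! ### Integrability in the frequency, and the Lindblad form of the generator -/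

section Regularity

variable {d : ℕ} {H : Matrix (Fin d) (Fin d) ℂ} {σ : ℝ}

theorem continuous_jumpOp (hH : H.IsHermitian) (A : Matrix (Fin d) (Fin d) ℂ) (hσ : 0 < σ) :
    Continuous (jumpOp H A σ) := by
  have hc := continuous_coupling_uncurry hH A σ
  change Continuous fun ω => ∫ s, coupling H A σ ω s
  refine continuous_of_dominated (bound := fun s => gaussFilter σ s * ‖A‖)
    (fun ω => (continuous_coupling hH A σ ω).aestronglyMeasurable)
    (fun ω => ae_of_all _ fun s => norm_coupling_le hH A hσ ω s)
    ((integrable_gaussFilter hσ).mul_const _)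
    (ae_of_all _ fun s => hc.comp (f := fun ω : ℝ => (ω, s)) (by fun_prop))

theorem continuous_couplingTail_freq (hH : H.IsHermitian) (A : Matrix (Fin d) (Fin d) ℂ)
    (hσ : 0 < σ) (s : ℝ) : Continuous fun ω => couplingTail H A σ ω s := by
  have hc := continuous_coupling_uncurry hH A σ
  refine continuous_of_dominated (bound := fun s => gaussFilter σ s * ‖A‖)
    (fun ω => (continuous_coupling hH A σ ω).aestronglyMeasurable)
    (fun ω => ae_of_all _ fun s => norm_coupling_le hH A hσ ω s)
    ((integrable_gaussFilter hσ).mul_const _).restrict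
    (ae_of_all _ fun s => hc.comp (f := fun ω : ℝ => (ω, s)) (by fun_prop))

theorem norm_couplingTail_mul_le (hH : H.IsHermitian) (A : Matrix (Fin d) (Fin d) ℂ)
    (hσ : 0 < σ) (ω s : ℝ) : ‖(couplingTail H A σ ω s)ᴴ * coupling H A σ ω s‖
      ≤ gaussFilter σ s * (((∫ x, gaussFilter σ x) * ‖A‖) * ‖A‖) := by
  refine (norm_mul_le _ _).trans ?_
  rw [Matrix.l2_opNorm_conjTranspose]
  refine (mul_le_mul (norm_couplingTail_le hH A hσ ω s) (norm_coupling_le hH A hσ ω s)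
    (norm_nonneg _) (by have := integral_gaussFilter_nonneg hσ; positivity)).trans (le_of_eq ?_)
  ring

theorem continuous_lambOp (hH : H.IsHermitian) (A : Matrix (Fin d) (Fin d) ℂ) (hσ : 0 < σ) :
    Continuous (lambOp H A σ) := by
  have hc := continuous_coupling_uncurry hH A σ
  have : lambOp H A σ = fun ω => ∫ s, (couplingTail H A σ ω s)ᴴ * coupling H A σ ω s := by
    funext ω; exact lambOp_eq hH A hσ ω
  rw [this]
  refine continuous_of_dominated
    (bound := fun s => gaussFilter σ s * (((∫ x, gaussFilter σ x) * ‖A‖) * ‖A‖))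
    (fun ω => (integrable_couplingTail_mul hH A hσ ω).aestronglyMeasurable)
    (fun ω => ae_of_all _ fun s => norm_couplingTail_mul_le hH A hσ ω s)
    ((integrable_gaussFilter hσ).mul_const _)
    (ae_of_all _ fun s => ?_)
  exact (continuous_couplingTail_freq hH A hσ s).star.mul
    (hc.comp (f := fun ω : ℝ => (ω, s)) (by fun_prop))

theorem exists_norm_lambOp_le (hH : H.IsHermitian) (A : Matrix (Fin d) (Fin d) ℂ) (hσ : 0 < σ) :
    ∃ C, ∀ ω, ‖lambOp H A σ ω‖ ≤ C :=
  ⟨_, fun ω => by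
    rw [lambOp_eq hH A hσ]
    exact norm_integral_le_of_norm_le ((integrable_gaussFilter hσ).mul_const _)
      (ae_of_all _ fun s => norm_couplingTail_mul_le hH A hσ ω s)⟩

/-- The sum is the integral of the derivative of `Jᴴ * J`, with `J` the primitive of the coupling
from `-∞`. It identifies the Hermitian part of the Lamb operator as half of `Vᴴ * V`. -/
theorem lambOp_add_conjTranspose (hH : H.IsHermitian) (A : Matrix (Fin d) (Fin d) ℂ)
    (hσ : 0 < σ) (ω : ℝ) :
    lambOp H A σ ω + (lambOp H A σ ω)ᴴ = (jumpOp H A σ ω)ᴴ * jumpOp H A σ ω := by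
  have hd : ∀ s, HasDerivAt (fun s => (couplingTail H A σ ω s)ᴴ * couplingTail H A σ ω s)
      ((coupling H A σ ω s)ᴴ * couplingTail H A σ ω s
        + (couplingTail H A σ ω s)ᴴ * coupling H A σ ω s) s := fun s => by
    have h1 := hasDerivAt_couplingTail hH A hσ ω s
    exact (hasDerivAt_conjTranspose h1).fun_mul h1
  have hG := integrable_couplingTail_mul hH A hσ ω
  have hGs : Integrable fun s => (coupling H A σ ω s)ᴴ * couplingTail H A σ ω s := by
    have h := (starL' ℝ (A := Matrix (Fin d) (Fin d) ℂ)).toContinuousLinearMap.integrable_comp hG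
    refine h.congr (ae_of_all _ fun s => ?_)
    change star ((couplingTail H A σ ω s)ᴴ * coupling H A σ ω s) = _
    rw [Matrix.star_eq_conjTranspose, Matrix.conjTranspose_mul,
      Matrix.conjTranspose_conjTranspose]
  have hbot := (tendsto_couplingTail_atBot H A σ ω).star.mul (tendsto_couplingTail_atBot H A σ ω)
  have htop := (tendsto_couplingTail_atTop hH A hσ ω).star.mul
    (tendsto_couplingTail_atTop hH A hσ ω)
  have h := integral_of_hasDerivAt_of_tendsto hd (hGs.add hG) hbot htop
  have h2 : ∫ s, (coupling H A σ ω s)ᴴ * couplingTail H A σ ω s = (lambOp H A σ ω)ᴴ := by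
    rw [lambOp_eq hH A hσ, ← integral_conjTranspose]
    simp only [Matrix.conjTranspose_mul, Matrix.conjTranspose_conjTranspose]
  rw [integral_add hGs hG, h2, ← lambOp_eq hH A hσ] at h
  rw [add_comm, h]
  simp [Matrix.star_eq_conjTranspose]

/-- The Hermitian part of the Lamb operator supplies the anticommutator of the dissipator; what is
left is expressed by the two commutators. -/
theorem generator_eq (hH : H.IsHermitian) (A : Matrix (Fin d) (Fin d) ℂ) (hσ : 0 < σ) (ω : ℝ)
    (ρ : Matrix (Fin d) (Fin d) ℂ) :
    generator H A σ ω ρ = dissipator (jumpOp H A σ ω) ρ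
      + ((1 / 2 : ℂ) • ⁅ρ, (lambOp H A σ ω)ᴴ⁆ - (1 / 2 : ℂ) • ⁅ρ, lambOp H A σ ω⁆) := by
  rw [generator, dissipator, ← lambOp_add_conjTranspose hH A hσ ω, Ring.lie_def, Ring.lie_def,
    mul_add, add_mul]
  module

theorem continuous_dissipator_jumpOp (hH : H.IsHermitian) (A : Matrix (Fin d) (Fin d) ℂ)
    (hσ : 0 < σ) (ρ : Matrix (Fin d) (Fin d) ℂ) :
    Continuous fun ω => dissipator (jumpOp H A σ ω) ρ := by
  unfold dissipator
  have h1 := continuous_jumpOp hH A hσ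
  have h2 : Continuous fun ω => (jumpOp H A σ ω)ᴴ := h1.star
  fun_prop

theorem norm_dissipator_le (V ρ : Matrix (Fin d) (Fin d) ℂ) :
    ‖dissipator V ρ‖ ≤ 2 * ‖V‖ ^ 2 * ‖ρ‖ := by
  have h1 : ‖V * ρ * Vᴴ‖ ≤ ‖V‖ ^ 2 * ‖ρ‖ := by
    have := (norm_mul_le (V * ρ) Vᴴ).trans
      (mul_le_mul_of_nonneg_right (norm_mul_le V ρ) (norm_nonneg _))
    rw [Matrix.l2_opNorm_conjTranspose] at this
    linarith
  have h0 : ‖Vᴴ * V‖ ≤ ‖V‖ ^ 2 := by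
    rw [Matrix.l2_opNorm_conjTranspose_mul_self, sq]
  have h2 : ‖Vᴴ * V * ρ‖ ≤ ‖V‖ ^ 2 * ‖ρ‖ :=
    (norm_mul_le _ _).trans (mul_le_mul_of_nonneg_right h0 (norm_nonneg _))
  have h3 : ‖ρ * (Vᴴ * V)‖ ≤ ‖V‖ ^ 2 * ‖ρ‖ := by
    have := (norm_mul_le ρ (Vᴴ * V)).trans (mul_le_mul_of_nonneg_left h0 (norm_nonneg _))
    linarith
  unfold dissipator
  refine (norm_sub_le _ _).trans ?_
  rw [norm_smul]
  have h4 := norm_add_le (Vᴴ * V * ρ) (ρ * (Vᴴ * V))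
  have h5 : ‖(1 / 2 : ℂ)‖ = 1 / 2 := by norm_num
  rw [h5]
  linarith

theorem exists_norm_dissipator_jumpOp_le (hH : H.IsHermitian) (A : Matrix (Fin d) (Fin d) ℂ)
    (hσ : 0 < σ) (ρ : Matrix (Fin d) (Fin d) ℂ) :
    ∃ C, ∀ ω, ‖dissipator (jumpOp H A σ ω) ρ‖ ≤ C := by
  refine ⟨2 * ((∫ x, gaussFilter σ x) * ‖A‖) ^ 2 * ‖ρ‖, fun ω => (norm_dissipator_le _ _).trans ?_⟩
  have := norm_jumpOp_le hH A hσ ω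
  gcongr

theorem integrable_fun_sub {X E : Type*} [MeasurableSpace X] {μ : Measure X}
    [NormedAddCommGroup E] {F G : X → E} (hF : Integrable F μ) (hG : Integrable G μ) :
    Integrable (fun x => F x - G x) μ := hF.sub hG

theorem lie_integral {X : Type*} [MeasurableSpace X] {μ : Measure X}
    {F : X → Matrix (Fin d) (Fin d) ℂ} (hF : Integrable F μ) (ρ : Matrix (Fin d) (Fin d) ℂ) :
    ⁅ρ, ∫ x, F x ∂μ⁆ = ∫ x, ⁅ρ, F x⁆ ∂μ :=
  ((ContinuousLinearMap.mul ℂ (Matrix (Fin d) (Fin d) ℂ) ρ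
    - (ContinuousLinearMap.mul ℂ (Matrix (Fin d) (Fin d) ℂ)).flip ρ).integral_comp_comm hF).symm

theorem integrable_lie {X : Type*} [MeasurableSpace X] {μ : Measure X}
    {F : X → Matrix (Fin d) (Fin d) ℂ} (hF : Integrable F μ) (ρ : Matrix (Fin d) (Fin d) ℂ) :
    Integrable (fun x => ⁅ρ, F x⁆) μ :=
  (ContinuousLinearMap.mul ℂ (Matrix (Fin d) (Fin d) ℂ) ρ
    - (ContinuousLinearMap.mul ℂ (Matrix (Fin d) (Fin d) ℂ)).flip ρ).integrable_comp hF

theorem integrable_smul_lie {X : Type*} [MeasurableSpace X] {μ : Measure X}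
    {F : X → Matrix (Fin d) (Fin d) ℂ} (hF : Integrable F μ) (ρ : Matrix (Fin d) (Fin d) ℂ)
    (c : ℂ) : Integrable (fun x => c • ⁅ρ, F x⁆) μ :=
  (integrable_lie hF ρ).smul c

theorem conj_integral {X : Type*} [MeasurableSpace X] {μ : Measure X}
    {F : X → Matrix (Fin d) (Fin d) ℂ} (hF : Integrable F μ) (U V : Matrix (Fin d) (Fin d) ℂ) :
    U * (∫ x, F x ∂μ) * V = ∫ x, U * F x * V ∂μ :=
  (((ContinuousLinearMap.mul ℂ (Matrix (Fin d) (Fin d) ℂ)).flip V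
    ∘L ContinuousLinearMap.mul ℂ (Matrix (Fin d) (Fin d) ℂ) U).integral_comp_comm hF).symm

theorem integrable_conj {X : Type*} [MeasurableSpace X] {μ : Measure X}
    {F : X → Matrix (Fin d) (Fin d) ℂ} (hF : Integrable F μ) (U V : Matrix (Fin d) (Fin d) ℂ) :
    Integrable (fun x => U * F x * V) μ :=
  ((ContinuousLinearMap.mul ℂ (Matrix (Fin d) (Fin d) ℂ)).flip V
    ∘L ContinuousLinearMap.mul ℂ (Matrix (Fin d) (Fin d) ℂ) U).integrable_comp hF

/-- The first summand comes from a bath in its ground state after reflecting `ω`, the second from an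
excited bath. -/
theorem rate_eq (g : ℝ → ℝ) (β ω : ℝ) :
    rate g β ω = bathPop β ω * g (-ω) + bathPop β ω * g ω := by
  rw [rate, bathPop, div_eq_inv_mul]; ring

theorem rate_nonneg {g : ℝ → ℝ} (hg : ∀ ω, 0 ≤ g ω) (β ω : ℝ) : 0 ≤ rate g β ω := by
  rw [rate_eq]
  have := bathPop_nonneg β ω
  have := hg ω
  have := hg (-ω)
  positivity

theorem integrable_bathPop_mul {g : ℝ → ℝ} (hg : Integrable g) (β : ℝ) :
    Integrable fun ω => bathPop β ω * g ω :=
  integrable_smul_of_norm_le (C := 1) hg (continuous_bathPop β).aestronglyMeasurable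
    (fun ω => by
      rw [Real.norm_of_nonneg (bathPop_nonneg β ω)]; exact bathPop_le_one β ω) |>.congr
    (ae_of_all _ fun ω => by simp [mul_comm])

theorem integrable_rate {g : ℝ → ℝ} (hg : Integrable g) (β : ℝ) : Integrable (rate g β) := by
  refine ((integrable_bathPop_mul hg.comp_neg β).add (integrable_bathPop_mul hg β)).congr
    (ae_of_all _ fun ω => ?_)
  simp [rate_eq]

theorem integrable_smul_lambOp (hH : H.IsHermitian) (A : Matrix (Fin d) (Fin d) ℂ)
    (hσ : 0 < σ) {g : ℝ → ℝ} (hg : Integrable g) :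
    Integrable fun ω => g ω • lambOp H A σ ω := by
  obtain ⟨C, hC⟩ := exists_norm_lambOp_le hH A hσ
  exact integrable_smul_of_norm_le hg (continuous_lambOp hH A hσ).aestronglyMeasurable hC

theorem integrable_smul_lambOp_conjTranspose (hH : H.IsHermitian)
    (A : Matrix (Fin d) (Fin d) ℂ) (hσ : 0 < σ) {g : ℝ → ℝ} (hg : Integrable g) :
    Integrable fun ω => g ω • (lambOp H A σ ω)ᴴ := by
  obtain ⟨C, hC⟩ := exists_norm_lambOp_le hH A hσ
  exact integrable_smul_of_norm_le hg (continuous_lambOp hH A hσ).star.aestronglyMeasurable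
    (fun ω => by rw [Matrix.l2_opNorm_conjTranspose]; exact hC ω)

theorem integrable_smul_dissipator (hH : H.IsHermitian) (A : Matrix (Fin d) (Fin d) ℂ)
    (hσ : 0 < σ) (ρ : Matrix (Fin d) (Fin d) ℂ) {g : ℝ → ℝ} (hg : Integrable g) :
    Integrable fun ω => g ω • dissipator (jumpOp H A σ ω) ρ := by
  obtain ⟨C, hC⟩ := exists_norm_dissipator_jumpOp_le hH A hσ ρ
  exact integrable_smul_of_norm_le hg (continuous_dissipator_jumpOp hH A hσ ρ).aestronglyMeasurable
    hC

theorem smul_generator_eq (hH : H.IsHermitian) (A : Matrix (Fin d) (Fin d) ℂ) (hσ : 0 < σ)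
    (ω : ℝ) (ρ : Matrix (Fin d) (Fin d) ℂ) (c : ℝ) :
    c • generator H A σ ω ρ = c • dissipator (jumpOp H A σ ω) ρ
      + ((1 / 2 : ℂ) • ⁅ρ, c • (lambOp H A σ ω)ᴴ⁆ - (1 / 2 : ℂ) • ⁅ρ, c • lambOp H A σ ω⁆) := by
  rw [generator_eq hH A hσ]
  simp only [Ring.lie_def, Matrix.mul_smul, Matrix.smul_mul]
  module

theorem integrable_smul_generator (hH : H.IsHermitian) (A : Matrix (Fin d) (Fin d) ℂ)
    (hσ : 0 < σ) (ρ : Matrix (Fin d) (Fin d) ℂ) {g : ℝ → ℝ} (hg : Integrable g) :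
    Integrable fun ω => g ω • generator H A σ ω ρ := by
  have j1 := integrable_smul_lie (integrable_smul_lambOp_conjTranspose hH A hσ hg) ρ (1 / 2)
  have j2 := integrable_smul_lie (integrable_smul_lambOp hH A hσ hg) ρ (1 / 2)
  refine ((integrable_smul_dissipator hH A hσ ρ hg).add (j1.sub j2)).congr
    (ae_of_all _ fun ω => ?_)
  exact (smul_generator_eq hH A hσ ω ρ (g ω)).symm

theorem integral_smul_generator (hH : H.IsHermitian) (A : Matrix (Fin d) (Fin d) ℂ)
    (hσ : 0 < σ) (ρ : Matrix (Fin d) (Fin d) ℂ) {g : ℝ → ℝ} (hg : Integrable g) :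
    ∫ ω, g ω • generator H A σ ω ρ = (∫ ω, g ω • dissipator (jumpOp H A σ ω) ρ)
      + ((1 / 2 : ℂ) • ⁅ρ, ∫ ω, g ω • (lambOp H A σ ω)ᴴ⁆
        - (1 / 2 : ℂ) • ⁅ρ, ∫ ω, g ω • lambOp H A σ ω⁆) := by
  have i1 := integrable_smul_lambOp_conjTranspose hH A hσ hg
  have i2 := integrable_smul_lambOp hH A hσ hg
  have j1 := integrable_smul_lie i1 ρ (1 / 2)
  have j2 := integrable_smul_lie i2 ρ (1 / 2)
  simp only [smul_generator_eq hH A hσ]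
  rw [integral_add (integrable_smul_dissipator hH A hσ ρ hg) (integrable_fun_sub j1 j2), integral_sub j1 j2,
    integral_smul, integral_smul, lie_integral i1, lie_integral i2]

end Regularity

/-! ### Displacement of the Gibbs state in one step -/

section FixedPointError

variable {d : ℕ} {H : Matrix (Fin d) (Fin d) ℂ} {β σ T α ω : ℝ}

theorem ofReal_smul_matrix {m n : Type*} (r : ℝ) (M : Matrix m n ℂ) : (r : ℂ) • M = r • M := by
  ext i j; simp

/-- The bath-averaged second-order generator at bath frequency `ω`. -/
noncomputable def bathGenerator (H A : Matrix (Fin d) (Fin d) ℂ) (β σ ω : ℝ)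
    (ρ : Matrix (Fin d) (Fin d) ℂ) : Matrix (Fin d) (Fin d) ℂ :=
  bathPop β (-ω) • generator H A σ (-ω) ρ + bathPop β ω • generator H Aᴴ σ ω ρ

/-- The fourth order remainder is combined with the truncation error of the second order term. The
remaining conjugation is unitary and leaves trace norm bounds unchanged. -/
theorem traceBound_stepMap_gibbs [NeZero d] (hH : H.IsHermitian) (A : Matrix (Fin d) (Fin d) ℂ)
    (hσ : 0 < σ) (hT : 0 < T) (hα : 0 ≤ α) (β ω : ℝ) :
    TraceBound (stepMap H A β σ T α ω (gibbs β H) - gibbs β H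
      - α ^ 2 • ((evo H T)ᴴ * bathGenerator H A β σ ω (gibbs β H) * evo H T))
      (α ^ 2 * (4096 * (σ * Real.exp (-T ^ 2 / (4 * σ ^ 2)) * ‖A‖ ^ 2
        + α ^ 2 * T ^ 4 / σ ^ 2 * ‖A‖ ^ 4))) := by
  set ρ := gibbs β H with hρ
  have hst : TraceBound ρ 1 := (gibbs_isState hH β).traceBound
  have h0 := traceBound_stepMap_gibbs_expansion (A := A) (β := β) (ω := ω) hH hσ hT hα
  have cp : ∀ (B : Matrix (Fin d) (Fin d) ℂ) (w : ℝ),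
      Continuous fun s => secondOrder ρ (coupling H B σ w s) (couplingPrimitive H B σ w T s) :=
    fun B w => continuous_secondOrder ρ (continuous_coupling hH B σ w)
      (continuous_iff_continuousAt.2 fun s =>
        (hasDerivAt_couplingPrimitive hH B σ w T s).continuousAt)
  set I₁ := ∫ s in (-T)..T, secondOrder ρ (coupling H A σ (-ω) s)
    (couplingPrimitive H A σ (-ω) T s) with hI₁
  set I₂ := ∫ s in (-T)..T, secondOrder ρ (coupling H Aᴴ σ ω s)
    (couplingPrimitive H Aᴴ σ ω T s) with hI₂
  have hI : (∫ s in (-T)..T, (-(α : ℂ) ^ 2) •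
      ((bathPop β (-ω) : ℂ) • secondOrder ρ (coupling H A σ (-ω) s)
          (couplingPrimitive H A σ (-ω) T s)
        + (bathPop β ω : ℂ) • secondOrder ρ (coupling H Aᴴ σ ω s)
          (couplingPrimitive H Aᴴ σ ω T s)))
      = (-(α : ℂ) ^ 2) • ((bathPop β (-ω) : ℂ) • I₁ + (bathPop β ω : ℂ) • I₂) := by
    rw [intervalIntegral.integral_smul, intervalIntegral.integral_add,
      intervalIntegral.integral_smul, intervalIntegral.integral_smul]
    · exact ((cp A (-ω)).const_smul (bathPop β (-ω) : ℂ)).intervalIntegrable _ _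
    · exact ((cp Aᴴ ω).const_smul (bathPop β ω : ℂ)).intervalIntegrable _ _
  rw [hI] at h0
  have e1 := (traceBound_truncated_generator hH A hσ hT (-ω) hst).smul (bathPop β (-ω) : ℂ)
  have e2 := (traceBound_truncated_generator hH Aᴴ hσ hT ω hst).smul (bathPop β ω : ℂ)
  rw [← hI₁] at e1
  rw [← hI₂] at e2
  have e3 := ((e1.add e2).smul ((α : ℂ) ^ 2)).conj_unitary (Q := (evo H T)ᴴ)
    (by rw [Matrix.conjTranspose_conjTranspose]; exact evo_mul_conjTranspose_self hH T)
  rw [Matrix.conjTranspose_conjTranspose] at e3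
  have hb := (h0.sub e3)
  have hM : stepMap H A β σ T α ω ρ - ρ
      - α ^ 2 • ((evo H T)ᴴ * bathGenerator H A β σ ω ρ * evo H T)
      = stepMap H A β σ T α ω ρ - ρ - (evo H T)ᴴ * ((-(α : ℂ) ^ 2) •
          ((bathPop β (-ω) : ℂ) • I₁ + (bathPop β ω : ℂ) • I₂)) * evo H T
        - (evo H T)ᴴ * ((α : ℂ) ^ 2 • ((bathPop β (-ω) : ℂ) • (I₁ + generator H A σ (-ω) ρ)
          + (bathPop β ω : ℂ) • (I₂ + generator H Aᴴ σ ω ρ))) * evo H T := by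
    rw [bathGenerator, ← ofReal_smul_matrix, ← ofReal_smul_matrix, ← ofReal_smul_matrix]
    simp only [Matrix.mul_smul, Matrix.smul_mul, mul_add, add_mul]
    push_cast
    module
  rw [hM]
  refine hb.mono ?_
  have hp := bathPop_add_neg β ω
  have hf : (gaussFilter σ 0) ^ 4 ≤ 1 / σ ^ 2 := by
    have h1 := gaussFilter_zero_sq_le hσ
    have h2 : (gaussFilter σ 0) ^ 4 = (gaussFilter σ 0 ^ 2) ^ 2 := by ring
    rw [h2, show 1 / σ ^ 2 = (1 / σ) ^ 2 by field_simp]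
    gcongr
  rw [Matrix.l2_opNorm_conjTranspose, Complex.norm_real, Complex.norm_real, norm_pow,
    Complex.norm_real, Real.norm_of_nonneg (bathPop_nonneg _ _),
    Real.norm_of_nonneg (bathPop_nonneg _ _), Real.norm_of_nonneg hα, ← add_mul, hp, one_mul]
  -- The constant is `8 ^ 4 = 4096`; the fourth power of the filter maximum provides `1 / σ ^ 2`.
  have h5 : (2 * α * (2 * (gaussFilter σ 0 * ‖A‖)) * (T - -T)) ^ 4
      = 4096 * (α ^ 2 * (α ^ 2 * T ^ 4 * ‖A‖ ^ 4)) * (gaussFilter σ 0) ^ 4 := by ring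
  rw [h5]
  have h6 := mul_le_mul_of_nonneg_left hf
    (by positivity : 0 ≤ 4096 * (α ^ 2 * (α ^ 2 * T ^ 4 * ‖A‖ ^ 4)))
  have h7 : 0 ≤ α ^ 2 * (‖A‖ ^ 2 * (σ * Real.exp (-T ^ 2 / (4 * σ ^ 2)))) := by positivity
  have h8 : 4096 * (α ^ 2 * (α ^ 2 * T ^ 4 * ‖A‖ ^ 4)) * (1 / σ ^ 2)
      = α ^ 2 * (4096 * (α ^ 2 * T ^ 4 / σ ^ 2 * ‖A‖ ^ 4)) := by ring
  rw [h8] at h6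
  nlinarith

variable {𝒜 : Finset (Matrix (Fin d) (Fin d) ℂ)} {g : ℝ → ℝ}

theorem integrable_smul_bathGenerator_parts (hH : H.IsHermitian) (A : Matrix (Fin d) (Fin d) ℂ)
    (hσ : 0 < σ) (β : ℝ) (ρ : Matrix (Fin d) (Fin d) ℂ) (hg : Integrable g) :
    Integrable (fun ω => (bathPop β (-ω) * g ω) • generator H A σ (-ω) ρ) ∧
    Integrable (fun ω => (bathPop β ω * g ω) • generator H Aᴴ σ ω ρ) := by
  constructor
  · have := (integrable_smul_generator hH A hσ ρ (integrable_bathPop_mul hg.comp_neg β)).comp_neg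
    simpa using this
  · exact integrable_smul_generator hH Aᴴ hσ ρ (integrable_bathPop_mul hg β)

theorem smul_bathGenerator (A : Matrix (Fin d) (Fin d) ℂ) (ρ : Matrix (Fin d) (Fin d) ℂ) (c : ℝ) :
    c • bathGenerator H A β σ ω ρ = (bathPop β (-ω) * c) • generator H A σ (-ω) ρ
      + (bathPop β ω * c) • generator H Aᴴ σ ω ρ := by
  rw [bathGenerator]; module

theorem integrable_smul_bathGenerator (hH : H.IsHermitian) (A : Matrix (Fin d) (Fin d) ℂ)
    (hσ : 0 < σ) (β : ℝ) (ρ : Matrix (Fin d) (Fin d) ℂ) (hg : Integrable g) :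
    Integrable fun ω => g ω • bathGenerator H A β σ ω ρ := by
  obtain ⟨h1, h2⟩ := integrable_smul_bathGenerator_parts hH A hσ β ρ hg
  refine (h1.add h2).congr (ae_of_all _ fun ω => ?_)
  exact (smul_bathGenerator A ρ (g ω)).symm

/-- Reflecting `ω` in the ground-state half and replacing `A` by `Aᴴ` in the excited half puts both
halves on the same generator, and their weights add up to `rate`. -/
theorem uniformMean_integral_bathGenerator (hH : H.IsHermitian) (h𝒜 : IsCouplingSet 𝒜)
    (hσ : 0 < σ) (β : ℝ) (ρ : Matrix (Fin d) (Fin d) ℂ) (hg : Integrable g) :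
    uniformMean 𝒜 (fun A => ∫ ω, g ω • bathGenerator H A β σ ω ρ)
      = uniformMean 𝒜 fun A => ∫ ω, rate g β ω • generator H A σ ω ρ := by
  obtain ⟨F, hF⟩ : ∃ F : Matrix (Fin d) (Fin d) ℂ → Matrix (Fin d) (Fin d) ℂ,
    ∀ A, F A = ∫ ω, (bathPop β ω * g (-ω)) • generator H A σ ω ρ := ⟨_, fun _ => rfl⟩
  obtain ⟨G, hG⟩ : ∃ G : Matrix (Fin d) (Fin d) ℂ → Matrix (Fin d) (Fin d) ℂ,
    ∀ A, G A = ∫ ω, (bathPop β ω * g ω) • generator H A σ ω ρ := ⟨_, fun _ => rfl⟩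
  have h1 : ∀ A ∈ 𝒜, ∫ ω, g ω • bathGenerator H A β σ ω ρ = F A + G Aᴴ := fun A _ => by
    obtain ⟨h1, h2⟩ := integrable_smul_bathGenerator_parts hH A hσ β ρ hg
    simp only [smul_bathGenerator]
    rw [integral_add h1 h2, hF, hG]
    congr 1
    rw [← integral_neg_eq_self]
    simp only [neg_neg]
  have h2 : ∀ A ∈ 𝒜, ∫ ω, rate g β ω • generator H A σ ω ρ = F A + G A := fun A _ => by
    rw [hF, hG, ← integral_add
      (integrable_smul_generator hH A hσ ρ (integrable_bathPop_mul hg.comp_neg β))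
      (integrable_smul_generator hH A hσ ρ (integrable_bathPop_mul hg β))]
    simp only [rate_eq, add_smul]
  rw [uniformMean_congr h1, uniformMean_congr h2, uniformMean_add, uniformMean_add,
    uniformMean_conjTranspose h𝒜 G]

/-- The triangle inequality is taken inside the mean for the commutators but outside it for the
dissipator, whose smallness depends on cancellation between `A` and `Aᴴ`. -/
theorem traceBound_mean_generator (hH : H.IsHermitian) (hσ : 0 < σ)
    (hg : Integrable g) (β : ℝ) :
    TraceBound (uniformMean 𝒜 fun A => ∫ ω, rate g β ω • generator H A σ ω (gibbs β H))
      (lambError H 𝒜 g β σ + dissError H 𝒜 g β σ) := by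
  have hr := integrable_rate hg β
  have h1 : (uniformMean 𝒜 fun A => ∫ ω, rate g β ω • generator H A σ ω (gibbs β H))
      = (uniformMean 𝒜 fun A => ((1 / 2 : ℂ) • ⁅gibbs β H, ∫ ω, rate g β ω • (lambOp H A σ ω)ᴴ⁆
        - (1 / 2 : ℂ) • ⁅gibbs β H, ∫ ω, rate g β ω • lambOp H A σ ω⁆))
      + uniformMean 𝒜 fun A => ∫ ω, rate g β ω • dissipator (jumpOp H A σ ω) (gibbs β H) := by
    rw [← uniformMean_add]
    refine uniformMean_congr fun A _ => ?_
    rw [integral_smul_generator hH A hσ _ hr, add_comm]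
  rw [h1]
  refine TraceBound.add ?_ (traceBound_traceNorm _)
  unfold lambError
  refine TraceBound.uniformMean fun A _ => ?_
  refine (((traceBound_traceNorm _).smul (1 / 2)).sub
    ((traceBound_traceNorm _).smul (1 / 2))).mono ?_
  have n1 := traceNorm_nonneg ⁅gibbs β H, ∫ ω, rate g β ω • lambOp H A σ ω⁆
  have n2 := traceNorm_nonneg ⁅gibbs β H, ∫ ω, rate g β ω • (lambOp H A σ ω)ᴴ⁆
  have hh : ‖(1 / 2 : ℂ)‖ = 1 / 2 := by norm_num
  rw [hh]
  linarith

/-- One step of the channel moves the Gibbs state by at most `α²` times the error terms. -/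
theorem traceBound_channel_gibbs_sub [NeZero d] (hH : H.IsHermitian) (h𝒜 : IsCouplingSet 𝒜)
    (hg : IsProbDensity g) (hσ : 0 < σ) (hT : 0 < T) (hα : 0 ≤ α) (β : ℝ) :
    TraceBound (channel H 𝒜 g β σ T α (gibbs β H) - gibbs β H)
      (α ^ 2 * (lambError H 𝒜 g β σ + dissError H 𝒜 g β σ + 4096 * truncError 𝒜 σ T α)) := by
  set ρ := gibbs β H with hρ
  set u := evo H T with hu
  set X := fun (A : Matrix (Fin d) (Fin d) ℂ) ω => bathGenerator H A β σ ω ρ with hX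
  set Eb := fun A : Matrix (Fin d) (Fin d) ℂ => α ^ 2 *
    (4096 * (σ * Real.exp (-T ^ 2 / (4 * σ ^ 2)) * ‖A‖ ^ 2
        + α ^ 2 * T ^ 4 / σ ^ 2 * ‖A‖ ^ 4)) with hEb
  have iX : ∀ A, Integrable fun ω => g ω • X A ω := fun A =>
    integrable_smul_bathGenerator hH A hσ β ρ hg.2.1
  have iS : ∀ A, Integrable fun ω => g ω • stepMap H A β σ T α ω ρ := fun A =>
    integrable_smul_stepMap hH A hσ β T α ρ hg.2.1
  have iρ : Integrable fun ω => g ω • ρ := hg.2.1.smul_const ρ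
  have iC : ∀ A, Integrable fun ω => α ^ 2 • (uᴴ * (g ω • X A ω) * u) := fun A =>
    (integrable_conj (iX A) uᴴ u).smul (α ^ 2)
  have hpt : ∀ A ω, g ω • (stepMap H A β σ T α ω ρ - ρ - α ^ 2 • (uᴴ * X A ω * u))
      = g ω • stepMap H A β σ T α ω ρ - g ω • ρ - α ^ 2 • (uᴴ * (g ω • X A ω) * u) := fun A ω => by
    rw [Matrix.mul_smul, Matrix.smul_mul]; module
  have iE : ∀ A, Integrable fun ω =>
      g ω • (stepMap H A β σ T α ω ρ - ρ - α ^ 2 • (uᴴ * X A ω * u)) := fun A => by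
    simp only [hpt]
    exact ((iS A).sub iρ).sub (iC A)
  have hA : ∀ A, ∫ ω, g ω • stepMap H A β σ T α ω ρ
      = (∫ ω, g ω • (stepMap H A β σ T α ω ρ - ρ - α ^ 2 • (uᴴ * X A ω * u)))
        + α ^ 2 • (uᴴ * (∫ ω, g ω • X A ω) * u) + ρ := fun A => by
    simp only [hpt]
    rw [integral_sub (integrable_fun_sub (iS A) iρ) (iC A), integral_sub (iS A) iρ, integral_smul_const,
      hg.2.2, one_smul, integral_smul, ← conj_integral (iX A)]
    abel
  have hEB : ∀ A ∈ 𝒜, TraceBound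
      (∫ ω, g ω • (stepMap H A β σ T α ω ρ - ρ - α ^ 2 • (uᴴ * X A ω * u))) (Eb A) := by
    intro A _
    have := TraceBound.integral (iE A) (hg.2.1.mul_const (Eb A)) (ae_of_all _ fun ω => by
      have := (traceBound_stepMap_gibbs hH A hσ hT hα β ω).real_smul (g ω)
      rwa [abs_of_nonneg (hg.1 ω)] at this)
    rwa [integral_mul_const, hg.2.2, one_mul] at this
  have hmean : channel H 𝒜 g β σ T α ρ - ρ
      = uniformMean 𝒜 (fun A => ∫ ω, g ω • (stepMap H A β σ T α ω ρ - ρ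
          - α ^ 2 • (uᴴ * X A ω * u)))
        + α ^ 2 • (uᴴ * (uniformMean 𝒜 fun A => ∫ ω, g ω • X A ω) * u) := by
    unfold channel
    simp only [hA]
    rw [uniformMean_add, uniformMean_add, uniformMean_const h𝒜.1, add_sub_cancel_right]
    congr 1
    unfold uniformMean
    rw [Matrix.mul_smul, Matrix.smul_mul, Matrix.mul_sum, Matrix.sum_mul, ← Finset.smul_sum,
      smul_comm]
  rw [hmean, hX, uniformMean_integral_bathGenerator hH h𝒜 hσ β ρ hg.2.1]
  have hu1 : uᴴᴴ * uᴴ = 1 := by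
    rw [Matrix.conjTranspose_conjTranspose]; exact evo_mul_conjTranspose_self hH T
  have h3 := ((traceBound_mean_generator (𝒜 := 𝒜) hH hσ hg.2.1 β).conj_unitary hu1).real_smul
    (α ^ 2)
  rw [Matrix.conjTranspose_conjTranspose] at h3
  refine ((TraceBound.uniformMean hEB).add h3).mono (le_of_eq ?_)
  rw [abs_of_nonneg (by positivity), hEb, uniformMean_mul_left, uniformMean_mul_left,
    uniformMean_add, uniformMean_mul_left, uniformMean_mul_left, truncError]
  ring

end FixedPointError

/-! ### Commutators with the Gibbs state -/

section GibbsCommutator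

variable {ι : Type*} [Fintype ι] [DecidableEq ι]

theorem sum_norm_mul_le_of_col_row (W X : Matrix ι ι ℂ) (i : ι) :
    ∑ j, ‖W j i‖ * ‖X i j‖ ≤ ‖W‖ * ‖X‖ := by
  refine (Real.sum_mul_le_sqrt_mul_sqrt _ _ _).trans ?_
  refine mul_le_mul ?_ ?_ (Real.sqrt_nonneg _) (norm_nonneg _)
  · exact Real.sqrt_le_iff.2 ⟨norm_nonneg _, sum_col_norm_sq_le W i⟩
  · exact Real.sqrt_le_iff.2 ⟨norm_nonneg _, sum_row_norm_sq_le X i⟩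

theorem sum_norm_mul_le_of_row_col (W X : Matrix ι ι ℂ) (j : ι) :
    ∑ i, ‖W j i‖ * ‖X i j‖ ≤ ‖W‖ * ‖X‖ := by
  refine (Real.sum_mul_le_sqrt_mul_sqrt _ _ _).trans ?_
  refine mul_le_mul ?_ ?_ (Real.sqrt_nonneg _) (norm_nonneg _)
  · exact Real.sqrt_le_iff.2 ⟨norm_nonneg _, sum_row_norm_sq_le W j⟩
  · exact Real.sqrt_le_iff.2 ⟨norm_nonneg _, sum_col_norm_sq_le X j⟩

/-- A matrix dominated entrywise by `(pᵢ + pⱼ) |Xᵢⱼ|` has trace norm at most `2 ‖X‖`. -/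
theorem traceBound_of_entry_le {M X : Matrix ι ι ℂ} {p : ι → ℝ} (hp : ∀ i, 0 ≤ p i)
    (hs : ∑ i, p i = 1) (h : ∀ i j, ‖M i j‖ ≤ (p i + p j) * ‖X i j‖) :
    TraceBound M (2 * ‖X‖) := fun W hW => by
  have h1 : ‖(W * M).trace‖ ≤ ∑ j, ∑ i, ‖W j i‖ * ((p i + p j) * ‖X i j‖) := by
    simp only [Matrix.trace, Matrix.diag, Matrix.mul_apply]
    refine (norm_sum_le _ _).trans (Finset.sum_le_sum fun j _ => ?_)
    refine (norm_sum_le _ _).trans (Finset.sum_le_sum fun i _ => ?_)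
    rw [norm_mul]
    exact mul_le_mul_of_nonneg_left (h i j) (norm_nonneg _)
  have h2 : ∑ j, ∑ i, ‖W j i‖ * ((p i + p j) * ‖X i j‖)
      = ∑ i, p i * ∑ j, ‖W j i‖ * ‖X i j‖ + ∑ j, p j * ∑ i, ‖W j i‖ * ‖X i j‖ := by
    simp only [Finset.mul_sum]
    rw [Finset.sum_comm (f := fun i j => p i * (‖W j i‖ * ‖X i j‖)), ← Finset.sum_add_distrib]
    refine Finset.sum_congr rfl fun j _ => ?_
    rw [← Finset.sum_add_distrib]
    exact Finset.sum_congr rfl fun i _ => by ring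
  have hWX : ‖W‖ * ‖X‖ ≤ ‖X‖ := mul_le_of_le_one_left (norm_nonneg _) hW
  -- The weight `p i` pairs a column of `W` with a row of `X`, the weight `p j` a row with a column.
  -- Cauchy–Schwarz bounds each by operator norms, so no dimension enters.
  have h3 : ∑ i, p i * ∑ j, ‖W j i‖ * ‖X i j‖ ≤ ∑ i, p i * ‖X‖ :=
    Finset.sum_le_sum fun i _ => mul_le_mul_of_nonneg_left
      ((sum_norm_mul_le_of_col_row W X i).trans hWX) (hp i)
  have h4 : ∑ j, p j * ∑ i, ‖W j i‖ * ‖X i j‖ ≤ ∑ j, p j * ‖X‖ :=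
    Finset.sum_le_sum fun i _ => mul_le_mul_of_nonneg_left
      ((sum_norm_mul_le_of_row_col W X i).trans hWX) (hp i)
  rw [← Finset.sum_mul, hs, one_mul] at h3 h4
  linarith

/-- A weak form of `|tanh (x / 2)| ≤ |x|`; it makes the difference of two Boltzmann weights small
relative to their sum. -/
theorem abs_one_sub_exp_neg_le (x : ℝ) :
    |1 - Real.exp (-x)| ≤ |x| * (1 + Real.exp (-x)) := by
  have hpos := Real.exp_pos (-x)
  rcases le_total 0 x with hx | hx
  · have h1 := Real.add_one_le_exp (-x)
    have h2 : Real.exp (-x) ≤ 1 := Real.exp_le_one_iff.2 (by linarith)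
    rw [abs_of_nonneg (by linarith), abs_of_nonneg hx]
    nlinarith
  · have h1 := Real.add_one_le_exp x
    have h2 : 1 ≤ Real.exp (-x) := Real.one_le_exp (by linarith)
    have h3 : Real.exp (-x) * Real.exp x = 1 := by rw [← Real.exp_add]; simp
    rw [abs_of_nonpos (by linarith), abs_of_nonpos hx]
    nlinarith

variable {d : ℕ} {H : Matrix (Fin d) (Fin d) ℂ}

/-- In the energy basis the two commutators have entries `(p i - p j) N i j` and `(E i - E j) N i
j`, and `|p i - p j| ≤ β |E i - E j| (p i + p j)`. The weights sum to 1, so the trace norm is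
controlled by an operator norm. -/
theorem traceBound_lie_gibbs [NeZero d] (hH : H.IsHermitian) {β : ℝ} (hβ : 0 ≤ β)
    (N : Matrix (Fin d) (Fin d) ℂ) : TraceBound ⁅gibbs β H, N⁆ (2 * β * ‖⁅H, N⁆‖) := by
  obtain ⟨Q, E, p, hQ, hQ', hHQ, hg, hp, hs, hdb⟩ := exists_gibbs_diagonal hH β
  set N' := Qᴴ * N * Q with hN'
  have hrot : ∀ D : Matrix (Fin d) (Fin d) ℂ, ⁅Q * D * Qᴴ, N⁆ = Q * ⁅D, N'⁆ * Qᴴ := fun D => by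
    have e1 : Q * D * Qᴴ * N = Q * (D * N') * Qᴴ := by
      simp only [hN', Matrix.mul_assoc, hQ', Matrix.mul_one]
    have e2 : N * (Q * D * Qᴴ) = Q * (N' * D) * Qᴴ := by
      simp only [hN', ← Matrix.mul_assoc, hQ', Matrix.one_mul]
    rw [Ring.lie_def, Ring.lie_def, e1, e2, mul_sub, sub_mul]
  set X := ⁅Matrix.diagonal (fun i => (E i : ℂ)), N'⁆ with hX
  have hXn : ‖X‖ ≤ ‖⁅H, N⁆‖ := by
    have h1 : X = Qᴴ * ⁅H, N⁆ * Q := by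
      rw [hHQ, hrot]
      simp only [← Matrix.mul_assoc, hQ, Matrix.one_mul]
      rw [Matrix.mul_assoc, hQ, Matrix.mul_one]
    have hq := norm_le_one_of_conjTranspose_mul_self hQ
    rw [h1]
    refine (norm_mul_le _ _).trans ((mul_le_of_le_one_right (norm_nonneg _) hq).trans ?_)
    refine (norm_mul_le _ _).trans (mul_le_of_le_one_left (norm_nonneg _) ?_)
    rwa [Matrix.l2_opNorm_conjTranspose]
  have hXe : ∀ i j, X i j = ((E i - E j : ℝ) : ℂ) * N' i j := fun i j => by
    rw [hX, Ring.lie_def, Matrix.sub_apply, Matrix.diagonal_mul, Matrix.mul_diagonal]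
    push_cast; ring
  rw [hg, hrot]
  have key : TraceBound ⁅Matrix.diagonal (fun i => (p i : ℂ)), N'⁆ (2 * ‖(β : ℂ) • X‖) := by
    refine traceBound_of_entry_le (fun i => (hp i).le) hs fun i j => ?_
    have h1 : ⁅Matrix.diagonal (fun i => (p i : ℂ)), N'⁆ i j = ((p i - p j : ℝ) : ℂ) * N' i j := by
      rw [Ring.lie_def, Matrix.sub_apply, Matrix.diagonal_mul, Matrix.mul_diagonal]
      push_cast; ring
    have h2 : |p i - p j| ≤ (p i + p j) * (β * |E i - E j|) := by
      have h3 := abs_one_sub_exp_neg_le (β * (E i - E j))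
      have h4 := hdb i j
      rw [neg_mul] at h4
      have h5 : p i - p j = -(p j * (1 - Real.exp (-(β * (E i - E j))))) := by rw [h4]; ring
      rw [h5, abs_neg, abs_mul, abs_of_pos (hp j)]
      rw [abs_mul, abs_of_nonneg hβ] at h3
      refine (mul_le_mul_of_nonneg_left h3 (hp j).le).trans (le_of_eq ?_)
      rw [h4]; ring
    rw [h1, Matrix.smul_apply, smul_eq_mul, hXe, norm_mul, norm_mul, norm_mul, Complex.norm_real,
      Complex.norm_real, Complex.norm_real, Real.norm_eq_abs, Real.norm_eq_abs, Real.norm_eq_abs,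
      abs_of_nonneg hβ]
    have := mul_le_mul_of_nonneg_right h2 (norm_nonneg (N' i j))
    linarith
  refine (key.conj_unitary hQ).mono ?_
  rw [norm_smul, Complex.norm_real, Real.norm_of_nonneg hβ]
  nlinarith

end GibbsCommutator

/-! ### Time averages almost commute with the Hamiltonian -/

section TimeAverage

variable {d : ℕ} {H : Matrix (Fin d) (Fin d) ℂ} {σ : ℝ}

theorem hasDerivAt_heis (hH : H.IsHermitian) (X : Matrix (Fin d) (Fin d) ℂ) (s : ℝ) :
    HasDerivAt (heis H X) (Complex.I • ⁅H, heis H X s⁆) s := by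
  have h1 := hasDerivAt_evo H s
  have h2 := ((h1.mul_const X).fun_mul (hasDerivAt_conjTranspose h1))
  have h3 := h2.congr_of_eventuallyEq
    (Filter.Eventually.of_forall fun t => heis_eq hH X t)
  refine h3.congr_deriv ?_
  have hc : (evo H s)ᴴ * H = H * (evo H s)ᴴ := by
    rw [evo_conjTranspose hH, (commute_evo H (-s)).eq]
  rw [heis_eq hH, Ring.lie_def, Matrix.conjTranspose_mul, Matrix.conjTranspose_smul, hH.eq,
    Matrix.mul_smul, hc]
  simp only [Matrix.smul_mul, Matrix.mul_smul, ← Matrix.mul_assoc, Complex.star_def,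
    Complex.conj_I]
  rw [Matrix.mul_assoc (evo H s * X), ← hc, ← Matrix.mul_assoc]
  module

/-- The correlation kernel `f(s-q) f(s)`. -/
noncomputable def filterKernel (σ q s : ℝ) : ℝ := gaussFilter σ (s - q) * gaussFilter σ s

/-- Completing the square separates the delay `q` from the midpoint time `s - q / 2`. -/
theorem filterKernel_eq (hσ : 0 < σ) (q s : ℝ) : filterKernel σ q s = gaussFilter σ 0 ^ 2 *
    Real.exp (-q ^ 2 / (8 * σ ^ 2)) * Real.exp (-(s - q / 2) ^ 2 / (2 * σ ^ 2)) := by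
  rw [filterKernel, gaussFilter_eq σ (s - q), gaussFilter_eq σ s]
  have : Real.exp (-(1 / (4 * σ ^ 2)) * (s - q) ^ 2) * Real.exp (-(1 / (4 * σ ^ 2)) * s ^ 2)
      = Real.exp (-q ^ 2 / (8 * σ ^ 2)) * Real.exp (-(s - q / 2) ^ 2 / (2 * σ ^ 2)) := by
    rw [← Real.exp_add, ← Real.exp_add]
    congr 1
    field_simp
    ring
  linear_combination gaussFilter σ 0 ^ 2 * this

theorem filterKernel_nonneg (hσ : 0 < σ) (q s : ℝ) : 0 ≤ filterKernel σ q s :=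
  (mul_pos (gaussFilter_pos hσ _) (gaussFilter_pos hσ _)).le

theorem hasDerivAt_filterKernel (hσ : 0 < σ) (q s : ℝ) :
    HasDerivAt (filterKernel σ q) (-((s - q / 2) / σ ^ 2) * filterKernel σ q s) s := by
  have h1 : HasDerivAt (fun s : ℝ => -(s - q / 2) ^ 2 / (2 * σ ^ 2)) (-((s - q / 2) / σ ^ 2)) s := by
    have h := ((((hasDerivAt_id s).sub_const (q / 2)).pow 2).neg).div_const (2 * σ ^ 2)
    refine h.congr_deriv ?_
    simp; field_simp
  have h2 := h1.exp.const_mul (gaussFilter σ 0 ^ 2 * Real.exp (-q ^ 2 / (8 * σ ^ 2)))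
  refine (h2.congr_of_eventuallyEq
    (Filter.Eventually.of_forall fun s => filterKernel_eq hσ q s)).congr_deriv ?_
  rw [filterKernel_eq hσ]; ring

theorem abs_deriv_filterKernel_le (hσ : 0 < σ) (q s : ℝ) :
    |-((s - q / 2) / σ ^ 2) * filterKernel σ q s| ≤ gaussFilter σ 0 ^ 2 *
      Real.exp (-q ^ 2 / (8 * σ ^ 2)) / σ * Real.exp (-(1 / (4 * σ ^ 2)) * (s - q / 2) ^ 2) := by
  set u := s - q / 2 with hu
  -- From `2 y ≤ 1 + y² ≤ exp (y²)` with `y = |u| / (2σ)`. The linear factor of the derivative costs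
  -- half of the Gaussian decay in `u`.
  have h1 : |u| / σ ≤ Real.exp (u ^ 2 / (4 * σ ^ 2)) := by
    have h2 := Real.add_one_le_exp (u ^ 2 / (4 * σ ^ 2))
    have h3 : u ^ 2 / (4 * σ ^ 2) = (|u| / σ / 2) ^ 2 := by
      rw [div_div, div_pow, sq_abs]; congr 1; ring
    rw [h3] at h2 ⊢
    nlinarith [sq_nonneg (|u| / σ / 2 - 1)]
  rw [abs_mul, abs_neg, abs_div, abs_of_nonneg (filterKernel_nonneg hσ q s),
    abs_of_pos (by positivity : 0 < σ ^ 2), filterKernel_eq hσ, ← hu]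
  have h4 : Real.exp (-(1 / (4 * σ ^ 2)) * u ^ 2)
      = Real.exp (u ^ 2 / (4 * σ ^ 2)) * Real.exp (-u ^ 2 / (2 * σ ^ 2)) := by
    rw [← Real.exp_add]; congr 1; field_simp; ring
  rw [h4]
  have h5 := mul_le_mul_of_nonneg_left h1 (by positivity : 0 ≤ gaussFilter σ 0 ^ 2 *
    Real.exp (-q ^ 2 / (8 * σ ^ 2)) / σ * Real.exp (-u ^ 2 / (2 * σ ^ 2)))
  have h6 : gaussFilter σ 0 ^ 2 * Real.exp (-q ^ 2 / (8 * σ ^ 2)) / σ *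
      Real.exp (-u ^ 2 / (2 * σ ^ 2)) * (|u| / σ) = |u| / σ ^ 2 * (gaussFilter σ 0 ^ 2 *
      Real.exp (-q ^ 2 / (8 * σ ^ 2)) * Real.exp (-u ^ 2 / (2 * σ ^ 2))) := by
    field_simp
  rw [h6] at h5
  linarith

/-- Time average of `A(s-q)ᴴ A(s)` against the filter kernel. -/
noncomputable def corrOp (H A : Matrix (Fin d) (Fin d) ℂ) (σ q : ℝ) : Matrix (Fin d) (Fin d) ℂ :=
  ∫ s, filterKernel σ q s • ((heis H A (s - q))ᴴ * heis H A s)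

/-- At fixed delay the product depends on `s` only through the evolution of one operator, so its
`s`-derivative is a commutator with `H`. -/
theorem heis_shift_mul (hH : H.IsHermitian) (A : Matrix (Fin d) (Fin d) ℂ) (q s : ℝ) :
    (heis H A (s - q))ᴴ * heis H A s = heis H ((heis H A (-q))ᴴ * A) s := by
  rw [heis_eq hH, heis_eq hH, heis_eq hH, heis_eq hH, sub_eq_add_neg, evo_add]
  simp only [Matrix.conjTranspose_mul, Matrix.conjTranspose_conjTranspose, Matrix.mul_assoc]
  rw [← Matrix.mul_assoc (evo H s)ᴴ (evo H s), evo_conjTranspose_mul_self hH, Matrix.one_mul]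

theorem continuous_filterKernel (σ : ℝ) : Continuous fun p : ℝ × ℝ => filterKernel σ p.1 p.2 := by
  unfold filterKernel
  have := continuous_gaussFilter σ
  fun_prop

/-- A product bound with worse constants, for dominated convergence and Fubini. It rests on
positivity of `5s² - 6sq + 2q²`. -/
theorem filterKernel_le (hσ : 0 < σ) (q s : ℝ) : filterKernel σ q s ≤ gaussFilter σ 0 ^ 2 *
    (Real.exp (-(1 / (12 * σ ^ 2)) * q ^ 2) * Real.exp (-(1 / (12 * σ ^ 2)) * s ^ 2)) := by
  rw [filterKernel_eq hσ, mul_assoc, ← Real.exp_add, ← Real.exp_add]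
  refine mul_le_mul_of_nonneg_left (Real.exp_le_exp.2 ?_) (sq_nonneg _)
  have h : -(1 / (12 * σ ^ 2)) * q ^ 2 + -(1 / (12 * σ ^ 2)) * s ^ 2
      - (-q ^ 2 / (8 * σ ^ 2) + -(s - q / 2) ^ 2 / (2 * σ ^ 2))
      = (5 * s ^ 2 - 6 * s * q + 2 * q ^ 2) / (12 * σ ^ 2) := by
    field_simp; ring
  have h2 : 0 ≤ (5 * s ^ 2 - 6 * s * q + 2 * q ^ 2) / (12 * σ ^ 2) := by
    refine div_nonneg ?_ (by positivity)
    nlinarith [sq_nonneg (5 * s - 3 * q), sq_nonneg q]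
  linarith

theorem integrable_exp_twelve (hσ : 0 < σ) :
    Integrable fun s : ℝ => Real.exp (-(1 / (12 * σ ^ 2)) * s ^ 2) :=
  integrable_exp_neg_mul_sq (by positivity)

theorem norm_corr_integrand_le (hH : H.IsHermitian) (A : Matrix (Fin d) (Fin d) ℂ) (hσ : 0 < σ)
    (q s : ℝ) : ‖filterKernel σ q s • ((heis H A (s - q))ᴴ * heis H A s)‖
      ≤ filterKernel σ q s * ‖A‖ ^ 2 := by
  rw [norm_smul, Real.norm_of_nonneg (filterKernel_nonneg hσ q s)]
  refine mul_le_mul_of_nonneg_left ((norm_mul_le _ _).trans ?_) (filterKernel_nonneg hσ q s)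
  rw [Matrix.l2_opNorm_conjTranspose, sq]
  exact mul_le_mul (norm_heis_le hH A _) (norm_heis_le hH A _) (norm_nonneg _) (norm_nonneg _)

theorem continuous_corr_integrand (hH : H.IsHermitian) (A : Matrix (Fin d) (Fin d) ℂ) (σ : ℝ) :
    Continuous fun p : ℝ × ℝ =>
      filterKernel σ p.1 p.2 • ((heis H A (p.2 - p.1))ᴴ * heis H A p.2) := by
  have h1 := continuous_filterKernel σ
  have h2 := continuous_heis hH A
  have h3 : Continuous fun p : ℝ × ℝ => (heis H A (p.2 - p.1))ᴴ :=
    (h2.comp (f := fun p : ℝ × ℝ => p.2 - p.1) (by fun_prop)).star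
  fun_prop

theorem integrable_corr_integrand (hH : H.IsHermitian) (A : Matrix (Fin d) (Fin d) ℂ)
    (hσ : 0 < σ) (q : ℝ) :
    Integrable fun s => filterKernel σ q s • ((heis H A (s - q))ᴴ * heis H A s) := by
  refine (((integrable_exp_twelve hσ).const_mul (gaussFilter σ 0 ^ 2 *
    Real.exp (-(1 / (12 * σ ^ 2)) * q ^ 2))).mul_const (‖A‖ ^ 2)).mono'
    ((continuous_corr_integrand hH A σ).comp (f := fun s : ℝ => (q, s))
      (by fun_prop)).aestronglyMeasurable (ae_of_all _ fun s => ?_)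
  refine (norm_corr_integrand_le hH A hσ q s).trans
    (mul_le_mul_of_nonneg_right ((filterKernel_le hσ q s).trans (le_of_eq ?_)) (sq_nonneg _))
  ring

/-- Commuting with `H` is differentiation in `s`, up to a factor `i`. Integration by parts moves the
derivative onto the kernel, whose width is of order `σ`, so its derivative has `L¹` norm of order `1
/ σ`. -/
theorem norm_lie_corrOp_le (hH : H.IsHermitian) (A : Matrix (Fin d) (Fin d) ℂ) (hσ : 0 < σ)
    (q : ℝ) : ‖⁅H, corrOp H A σ q⁆‖ ≤ 2 / σ * Real.exp (-q ^ 2 / (8 * σ ^ 2)) * ‖A‖ ^ 2 := by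
  set X := (heis H A (-q))ᴴ * A with hX
  have hXn : ‖X‖ ≤ ‖A‖ ^ 2 := by
    refine (norm_mul_le _ _).trans ?_
    rw [Matrix.l2_opNorm_conjTranspose, sq]
    exact mul_le_mul_of_nonneg_right (norm_heis_le hH A _) (norm_nonneg _)
  set h' := fun s => -((s - q / 2) / σ ^ 2) * filterKernel σ q s with hh'
  have i0 : Integrable fun s => filterKernel σ q s • heis H X s := by
    have := integrable_corr_integrand hH A hσ q
    simpa only [heis_shift_mul hH] using this
  have hgauss : Integrable fun s : ℝ => Real.exp (-(1 / (4 * σ ^ 2)) * (s - q / 2) ^ 2) :=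
    (integrable_exp_neg_mul_sq (b := 1 / (4 * σ ^ 2)) (by positivity)).comp_sub_right (q / 2)
  set c := gaussFilter σ 0 ^ 2 * Real.exp (-q ^ 2 / (8 * σ ^ 2)) / σ with hc
  have hc0 : 0 ≤ c := by positivity
  have hbound : ∀ s, ‖h' s • heis H X s‖
      ≤ c * Real.exp (-(1 / (4 * σ ^ 2)) * (s - q / 2) ^ 2) * ‖A‖ ^ 2 := fun s => by
    rw [norm_smul, Real.norm_eq_abs]
    exact mul_le_mul (abs_deriv_filterKernel_le hσ q s) ((norm_heis_le hH X s).trans hXn)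
      (norm_nonneg _) (by positivity)
  have cK : Continuous (filterKernel σ q) :=
    (continuous_filterKernel σ).comp (f := fun s : ℝ => (q, s)) (by fun_prop)
  have ch : Continuous h' := by rw [hh']; fun_prop
  have iB : Integrable fun s : ℝ =>
      c * Real.exp (-(1 / (4 * σ ^ 2)) * (s - q / 2) ^ 2) * ‖A‖ ^ 2 :=
    (hgauss.const_mul c).mul_const _
  have i1 : Integrable fun s => h' s • heis H X s :=
    iB.mono' (ch.smul (continuous_heis hH X)).aestronglyMeasurable (ae_of_all _ hbound)
  have i2 : Integrable fun s => ⁅H, filterKernel σ q s • heis H X s⁆ := integrable_lie i0 H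
  have hd : ∀ s, HasDerivAt (fun s => filterKernel σ q s • heis H X s)
      (h' s • heis H X s + Complex.I • ⁅H, filterKernel σ q s • heis H X s⁆) s := fun s => by
    refine ((hasDerivAt_filterKernel hσ q s).fun_smul (hasDerivAt_heis hH X s)).congr_deriv ?_
    rw [add_comm]
    congr 1
    simp only [Ring.lie_def, Matrix.mul_smul, Matrix.smul_mul]
    module
  have i3 : Integrable fun s => Complex.I • ⁅H, filterKernel σ q s • heis H X s⁆ :=
    integrable_smul_lie i0 H Complex.I
  -- The boundary terms vanish because the weighted evolution is integrable together with its
  -- derivative.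
  have h0 := integral_eq_zero_of_hasDerivAt_of_integrable hd (i1.add i3) i0
  rw [integral_add i1 i3, integral_smul, ← lie_integral i0] at h0
  have hcorr : corrOp H A σ q = ∫ s, filterKernel σ q s • heis H X s := by
    unfold corrOp; simp only [heis_shift_mul hH, hX]
  rw [← hcorr] at h0
  have hn : ‖⁅H, corrOp H A σ q⁆‖ = ‖∫ s, h' s • heis H X s‖ := by
    have h1 : Complex.I • ⁅H, corrOp H A σ q⁆ = -∫ s, h' s • heis H X s :=
      (neg_eq_of_add_eq_zero_right h0).symm
    have h2 := congrArg norm h1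
    rwa [norm_smul, Complex.norm_I, one_mul, norm_neg] at h2
  rw [hn]
  refine (norm_integral_le_of_norm_le iB (ae_of_all _ hbound)).trans ?_
  rw [integral_mul_const, integral_const_mul,
    integral_sub_right_eq_self (fun s : ℝ => Real.exp (-(1 / (4 * σ ^ 2)) * s ^ 2)) (q / 2),
    integral_gaussian]
  refine mul_le_mul_of_nonneg_right ?_ (sq_nonneg _)
  rw [hc, gaussFilter_zero_sq hσ]
  have h4 : √(Real.pi / (1 / (4 * σ ^ 2))) = 2 * σ * √Real.pi := by
    rw [show Real.pi / (1 / (4 * σ ^ 2)) = (2 * σ) ^ 2 * Real.pi by field_simp; ring,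
      Real.sqrt_mul (by positivity), Real.sqrt_sq (by positivity)]
  have h5 : √Real.pi ≤ √(2 * Real.pi) := Real.sqrt_le_sqrt (by linarith [Real.pi_pos])
  have h6 : 0 < √(2 * Real.pi) := by positivity
  rw [h4]
  have h7 : (√(2 * Real.pi) * σ)⁻¹ * Real.exp (-q ^ 2 / (8 * σ ^ 2)) / σ * (2 * σ * √Real.pi)
      = 2 / σ * Real.exp (-q ^ 2 / (8 * σ ^ 2)) * (√Real.pi / √(2 * Real.pi)) := by
    field_simp
  rw [h7]
  exact mul_le_of_le_one_right (by positivity) ((div_le_one h6).2 h5)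

end TimeAverage

/-! ### Bound on the Lamb error -/

section LambBound

variable {d : ℕ} {H : Matrix (Fin d) (Fin d) ℂ} {σ : ℝ}

theorem setIntegral_Iic_eq_Ioi_sub {E : Type*} [NormedAddCommGroup E] [NormedSpace ℝ E]
    (F : ℝ → E) (s : ℝ) : ∫ x in Set.Iic s, F x = ∫ q in Set.Ioi (0 : ℝ), F (s - q) := by
  rw [← integral_Ici_eq_integral_Ioi, ← integral_indicator measurableSet_Iic,
    ← integral_indicator measurableSet_Ici, ← integral_sub_left_eq_self _ _ s]
  refine integral_congr_ae (ae_of_all _ fun q => ?_)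
  by_cases h : 0 ≤ q
  · simp [Set.indicator, h]
  · simp [Set.indicator, h]

theorem norm_corr_integrand_le_exp (hH : H.IsHermitian) (A : Matrix (Fin d) (Fin d) ℂ)
    (hσ : 0 < σ) (q s : ℝ) : ‖filterKernel σ q s • ((heis H A (s - q))ᴴ * heis H A s)‖
      ≤ (gaussFilter σ 0 ^ 2 * ‖A‖ ^ 2 * Real.exp (-(1 / (12 * σ ^ 2)) * s ^ 2))
        * Real.exp (-(1 / (12 * σ ^ 2)) * q ^ 2) := by
  refine (norm_corr_integrand_le hH A hσ q s).trans
    ((mul_le_mul_of_nonneg_right (filterKernel_le hσ q s) (sq_nonneg _)).trans (le_of_eq ?_))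
  ring

theorem continuous_corrOp (hH : H.IsHermitian) (A : Matrix (Fin d) (Fin d) ℂ) (hσ : 0 < σ) :
    Continuous (corrOp H A σ) := by
  have hc := continuous_corr_integrand hH A σ
  refine continuous_of_dominated
    (bound := fun s => gaussFilter σ 0 ^ 2 * ‖A‖ ^ 2 * Real.exp (-(1 / (12 * σ ^ 2)) * s ^ 2))
    (fun q => (integrable_corr_integrand hH A hσ q).aestronglyMeasurable)
    (fun q => ae_of_all _ fun s => (norm_corr_integrand_le_exp hH A hσ q s).trans
      (mul_le_of_le_one_right (by positivity) (Real.exp_le_one_iff.2 ?_)))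
    ((integrable_exp_twelve hσ).const_mul _) (ae_of_all _ fun s =>
      hc.comp (f := fun q : ℝ => (q, s)) (by fun_prop))
  have : 0 ≤ 1 / (12 * σ ^ 2) * q ^ 2 := by positivity
  linarith

theorem exists_norm_corrOp_le (hH : H.IsHermitian) (A : Matrix (Fin d) (Fin d) ℂ) (hσ : 0 < σ) :
    ∃ K, ∀ q, ‖corrOp H A σ q‖ ≤ K * Real.exp (-(1 / (12 * σ ^ 2)) * q ^ 2) :=
  ⟨_, fun q => by
    have h := norm_integral_le_of_norm_le (((integrable_exp_twelve hσ).const_mul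
      (gaussFilter σ 0 ^ 2 * ‖A‖ ^ 2)).mul_const (Real.exp (-(1 / (12 * σ ^ 2)) * q ^ 2)))
      (ae_of_all _ fun s => norm_corr_integrand_le_exp hH A hσ q s)
    rwa [integral_mul_const] at h⟩

theorem integrable_corrOp (hH : H.IsHermitian) (A : Matrix (Fin d) (Fin d) ℂ) (hσ : 0 < σ) :
    Integrable (corrOp H A σ) := by
  obtain ⟨K, hK⟩ := exists_norm_corrOp_le hH A hσ
  exact ((integrable_exp_twelve hσ).const_mul K).mono'
    (continuous_corrOp hH A hσ).aestronglyMeasurable (ae_of_all _ hK)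

/-- Substituting the delay `q = s₁ - s₂` and exchanging the time integrals confines the frequency to
the phase in `q`. -/
theorem lambOp_eq_corrOp (hH : H.IsHermitian) (A : Matrix (Fin d) (Fin d) ℂ) (hσ : 0 < σ)
    (ω : ℝ) : lambOp H A σ ω = ∫ q in Set.Ioi (0 : ℝ),
      Complex.exp (-Complex.I * ((ω * q : ℝ) : ℂ)) • corrOp H A σ q := by
  have h1 : lambOp H A σ ω = ∫ s : ℝ, ∫ q in Set.Ioi (0 : ℝ),
      Complex.exp (-Complex.I * ((ω * q : ℝ) : ℂ)) •
        (filterKernel σ q s • ((heis H A (s - q))ᴴ * heis H A s)) := by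
    unfold lambOp
    refine integral_congr_ae (ae_of_all _ fun s => ?_)
    simp only
    rw [setIntegral_Iic_eq_Ioi_sub]
    refine integral_congr_ae (ae_of_all _ fun q => ?_)
    simp only
    rw [← ofReal_smul_matrix, smul_smul, filterKernel, mul_comm]
    congr 3
    push_cast; ring
  rw [h1, integral_integral_swap]
  · refine integral_congr_ae (ae_of_all _ fun q => ?_)
    simp only
    rw [integral_smul]; rfl
  · have hb : Integrable (fun p : ℝ × ℝ => (gaussFilter σ 0 ^ 2 * ‖A‖ ^ 2 *
        Real.exp (-(1 / (12 * σ ^ 2)) * p.1 ^ 2)) * Real.exp (-(1 / (12 * σ ^ 2)) * p.2 ^ 2))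
        (volume.prod (volume.restrict (Set.Ioi 0))) :=
      ((integrable_exp_twelve hσ).const_mul _).mul_prod (integrable_exp_twelve hσ).restrict
    refine hb.mono' ?_ (ae_of_all _ fun p => ?_)
    · have hc := (continuous_corr_integrand hH A σ).comp continuous_swap
      refine Continuous.aestronglyMeasurable ?_
      exact Continuous.smul (f := fun p : ℝ × ℝ => Complex.exp (-Complex.I * ((ω * p.2 : ℝ) : ℂ)))
        (by fun_prop) hc
    · rw [Function.uncurry_apply_pair, norm_smul, norm_exp_neg_I_mul, one_mul]
      exact norm_corr_integrand_le_exp hH A hσ p.2 p.1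

/-- A further exchange of integrals: the rate enters only through its Fourier transform at the
delay. -/
theorem integral_smul_lambOp (hH : H.IsHermitian) (A : Matrix (Fin d) (Fin d) ℂ) (hσ : 0 < σ)
    {r : ℝ → ℝ} (hr : Integrable r) :
    ∫ ω, r ω • lambOp H A σ ω = ∫ q in Set.Ioi (0 : ℝ),
      (∫ ω, (r ω : ℂ) * Complex.exp (-Complex.I * ((ω * q : ℝ) : ℂ))) • corrOp H A σ q := by
  have h1 : ∫ ω, r ω • lambOp H A σ ω = ∫ ω, ∫ q in Set.Ioi (0 : ℝ),
      ((r ω : ℂ) * Complex.exp (-Complex.I * ((ω * q : ℝ) : ℂ))) • corrOp H A σ q := by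
    refine integral_congr_ae (ae_of_all _ fun ω => ?_)
    simp only
    rw [lambOp_eq_corrOp hH A hσ, ← integral_smul]
    refine integral_congr_ae (ae_of_all _ fun q => ?_)
    simp only
    rw [← ofReal_smul_matrix, smul_smul]
  rw [h1, integral_integral_swap]
  · refine integral_congr_ae (ae_of_all _ fun q => ?_)
    simp only
    rw [integral_smul_const]
  · have hb : Integrable (fun p : ℝ × ℝ => ‖r p.1‖ * ‖corrOp H A σ p.2‖)
        (volume.prod (volume.restrict (Set.Ioi 0))) :=
      hr.norm.mul_prod (integrable_corrOp hH A hσ).norm.restrict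
    refine hb.mono' ?_ (ae_of_all _ fun p => ?_)
    · have m1 : AEStronglyMeasurable (fun p : ℝ × ℝ => (r p.1 : ℂ))
          (volume.prod (volume.restrict (Set.Ioi 0))) :=
        Complex.continuous_ofReal.comp_aestronglyMeasurable hr.aestronglyMeasurable.comp_fst
      have m2 : Continuous fun p : ℝ × ℝ =>
          Complex.exp (-Complex.I * ((p.1 * p.2 : ℝ) : ℂ)) := by fun_prop
      have m3 := (continuous_corrOp hH A hσ).comp (continuous_snd (X := ℝ))
      exact (m1.mul m2.aestronglyMeasurable).smul m3.aestronglyMeasurable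
    · rw [Function.uncurry_apply_pair, norm_smul, norm_mul, norm_exp_neg_I_mul, mul_one,
        Complex.norm_real]

theorem norm_fourier_neg (r : ℝ → ℝ) (q : ℝ) :
    ‖∫ ω, (r ω : ℂ) * Complex.exp (-Complex.I * ((ω * q : ℝ) : ℂ))‖
      = ‖∫ ω, (r ω : ℂ) * Complex.exp (Complex.I * ((ω * q : ℝ) : ℂ))‖ := by
  rw [← Complex.norm_conj, ← integral_conj]
  congr 1
  refine integral_congr_ae (ae_of_all _ fun ω => ?_)
  simp only
  rw [map_mul, Complex.conj_ofReal, ← Complex.exp_conj, map_mul, map_neg, Complex.conj_I,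
    Complex.conj_ofReal, neg_neg]

/-- Rescaling the delay by `σ` absorbs exactly the `1 / σ` gained by integration by parts. -/
theorem lambR_eq (g : ℝ → ℝ) (β : ℝ) (hσ : 0 < σ) : lambR g β σ = σ⁻¹ * ∫ q in Set.Ioi (0 : ℝ),
    ‖∫ ω, (rate g β ω : ℂ) * Complex.exp (Complex.I * ((ω * q : ℝ) : ℂ))‖
      * Real.exp (-q ^ 2 / (8 * σ ^ 2)) := by
  have h := integral_comp_mul_left_Ioi (fun q : ℝ =>
    ‖∫ ω, (rate g β ω : ℂ) * Complex.exp (Complex.I * ((ω * q : ℝ) : ℂ))‖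
      * Real.exp (-q ^ 2 / (8 * σ ^ 2))) 0 hσ
  rw [mul_zero, smul_eq_mul] at h
  rw [← h, lambR]
  refine integral_congr_ae (ae_of_all _ fun q => ?_)
  have e : -(σ * q) ^ 2 / (8 * σ ^ 2) = -q ^ 2 / 8 := by field_simp
  simp only [mul_assoc, e]

theorem norm_fourier_le {r : ℝ → ℝ} (q : ℝ) :
    ‖∫ ω, (r ω : ℂ) * Complex.exp (Complex.I * ((ω * q : ℝ) : ℂ))‖ ≤ ∫ ω, ‖r ω‖ := by
  refine (norm_integral_le_integral_norm _).trans (le_of_eq ?_)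
  refine integral_congr_ae (ae_of_all _ fun ω => ?_)
  simp only
  rw [norm_mul, norm_exp_I_mul, mul_one, Complex.norm_real]

theorem continuous_fourier {r : ℝ → ℝ} (hr : Integrable r) : Continuous fun q : ℝ =>
    ∫ ω, (r ω : ℂ) * Complex.exp (Complex.I * ((ω * q : ℝ) : ℂ)) := by
  refine continuous_of_dominated (bound := fun ω => ‖r ω‖) (fun q => ?_)
    (fun q => ae_of_all _ fun ω => ?_) hr.norm (ae_of_all _ fun ω => by fun_prop)
  · exact (Complex.continuous_ofReal.comp_aestronglyMeasurable hr.aestronglyMeasurable).mul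
      (Continuous.aestronglyMeasurable (by fun_prop))
  · rw [norm_mul, norm_exp_I_mul, mul_one, Complex.norm_real]

theorem integrable_exp_eight (hσ : 0 < σ) :
    Integrable fun q : ℝ => Real.exp (-q ^ 2 / (8 * σ ^ 2)) := by
  refine (integrable_exp_neg_mul_sq (b := 1 / (8 * σ ^ 2)) (by positivity)).congr
    (ae_of_all _ fun q => ?_)
  simp only
  congr 1
  ring

theorem integrable_fourier_mul_exp {r : ℝ → ℝ} (hr : Integrable r) (hσ : 0 < σ) :
    Integrable fun q : ℝ => ‖∫ ω, (r ω : ℂ) * Complex.exp (Complex.I * ((ω * q : ℝ) : ℂ))‖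
      * Real.exp (-q ^ 2 / (8 * σ ^ 2)) := by
  refine ((integrable_exp_eight hσ).const_mul (∫ ω, ‖r ω‖)).mono' ?_ (ae_of_all _ fun q => ?_)
  · have := continuous_fourier hr
    exact Continuous.aestronglyMeasurable (by fun_prop)
  · rw [Real.norm_of_nonneg (by positivity)]
    exact mul_le_mul_of_nonneg_right (norm_fourier_le q) (Real.exp_pos _).le

theorem norm_lie_integral_lambOp_le (hH : H.IsHermitian) (A : Matrix (Fin d) (Fin d) ℂ)
    (hσ : 0 < σ) {g : ℝ → ℝ} (hg : Integrable g) (β : ℝ) :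
    ‖⁅H, ∫ ω, rate g β ω • lambOp H A σ ω⁆‖ ≤ 2 * lambR g β σ * ‖A‖ ^ 2 := by
  have hr := integrable_rate hg β
  rw [integral_smul_lambOp hH A hσ hr]
  set c := fun q : ℝ => ∫ ω, (rate g β ω : ℂ) * Complex.exp (-Complex.I * ((ω * q : ℝ) : ℂ))
    with hc
  have hcn : ∀ q, ‖c q‖
      = ‖∫ ω, (rate g β ω : ℂ) * Complex.exp (Complex.I * ((ω * q : ℝ) : ℂ))‖ :=
    fun q => norm_fourier_neg _ q
  have cc : Continuous c := by
    have h := (continuous_fourier hr).comp continuous_neg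
    refine h.congr fun q => integral_congr_ae (ae_of_all _ fun ω => ?_)
    simp only
    congr 2
    push_cast; ring
  have hi : Integrable (fun q => c q • corrOp H A σ q) (volume.restrict (Set.Ioi 0)) := by
    refine Integrable.restrict (((integrable_corrOp hH A hσ).norm.const_mul
      (∫ ω, ‖rate g β ω‖)).mono'
      (cc.smul (continuous_corrOp hH A hσ)).aestronglyMeasurable (ae_of_all _ fun q => ?_))
    rw [Pi.smul_apply', norm_smul, hcn]
    exact mul_le_mul_of_nonneg_right (norm_fourier_le q) (norm_nonneg _)
  rw [lie_integral hi]
  have hb := ((integrable_fourier_mul_exp hr hσ).const_mul (2 / σ * ‖A‖ ^ 2)).restrict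
    (s := Set.Ioi 0)
  refine (norm_integral_le_of_norm_le hb (ae_of_all _ fun q => ?_)).trans (le_of_eq ?_)
  · have e : ⁅H, c q • corrOp H A σ q⁆ = c q • ⁅H, corrOp H A σ q⁆ := by
      rw [Ring.lie_def, Ring.lie_def, Matrix.mul_smul, Matrix.smul_mul, smul_sub]
    rw [e, norm_smul, hcn]
    have := mul_le_mul_of_nonneg_left (norm_lie_corrOp_le hH A hσ q)
      (norm_nonneg (∫ ω, (rate g β ω : ℂ) * Complex.exp (Complex.I * ((ω * q : ℝ) : ℂ))))
    linarith
  · rw [integral_const_mul, lambR_eq g β hσ]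
    ring

theorem norm_lie_conjTranspose (hH : H.IsHermitian) (N : Matrix (Fin d) (Fin d) ℂ) :
    ‖⁅H, Nᴴ⁆‖ = ‖⁅H, N⁆‖ := by
  rw [← Matrix.l2_opNorm_conjTranspose ⁅H, N⁆, ← norm_neg]
  congr 1
  rw [Ring.lie_def, Ring.lie_def, Matrix.conjTranspose_sub, Matrix.conjTranspose_mul,
    Matrix.conjTranspose_mul, hH.eq]
  abel

/-- Two commutators, each costing `2 * β` from the Gibbs weights and `2` from the time average. The
adjoint has a commutator with `H` of the same norm. -/
theorem lambError_le [NeZero d] (hH : H.IsHermitian) {𝒜 : Finset (Matrix (Fin d) (Fin d) ℂ)}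
    {g : ℝ → ℝ} (hg : Integrable g) {β : ℝ} (hβ : 0 ≤ β) (hσ : 0 < σ) :
    lambError H 𝒜 g β σ ≤ 8 * β * lambR g β σ * uniformMean 𝒜 (fun A => ‖A‖ ^ 2) := by
  have key : ∀ A ∈ 𝒜, traceNorm ⁅gibbs β H, ∫ ω, rate g β ω • lambOp H A σ ω⁆
      + traceNorm ⁅gibbs β H, ∫ ω, rate g β ω • (lambOp H A σ ω)ᴴ⁆
      ≤ 8 * β * lambR g β σ * ‖A‖ ^ 2 := fun A _ => by
    have h0 := mul_le_mul_of_nonneg_left (norm_lie_integral_lambOp_le hH A hσ hg β)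
      (by positivity : 0 ≤ 2 * β)
    have e : ∫ ω, rate g β ω • (lambOp H A σ ω)ᴴ = (∫ ω, rate g β ω • lambOp H A σ ω)ᴴ := by
      rw [← integral_conjTranspose]
      refine integral_congr_ae (ae_of_all _ fun ω => ?_)
      simp only
      rw [Matrix.conjTranspose_smul]; rfl
    have h1 := traceNorm_le_iff.2
      (traceBound_lie_gibbs hH hβ (∫ ω, rate g β ω • lambOp H A σ ω))
    have h2 := traceNorm_le_iff.2
      (traceBound_lie_gibbs hH hβ (∫ ω, rate g β ω • lambOp H A σ ω)ᴴ)
    rw [norm_lie_conjTranspose hH] at h2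
    rw [e]
    linarith
  unfold lambError
  refine (uniformMean_mono key).trans (le_of_eq ?_)
  rw [uniformMean_mul_left]

end LambBound

/-! ### Hilbert–Schmidt Cauchy–Schwarz -/

section HilbertSchmidt

variable {ι : Type*} [Fintype ι] [DecidableEq ι]

/-- Squared Hilbert–Schmidt norm. -/
noncomputable def hsSq (M : Matrix ι ι ℂ) : ℝ := ∑ i, ∑ j, ‖M i j‖ ^ 2

omit [DecidableEq ι] in
theorem hsSq_nonneg (M : Matrix ι ι ℂ) : 0 ≤ hsSq M :=
  Finset.sum_nonneg fun _ _ => Finset.sum_nonneg fun _ _ => sq_nonneg _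

theorem hsSq_mul_le (W M : Matrix ι ι ℂ) : hsSq (W * M) ≤ ‖W‖ ^ 2 * hsSq M := by
  unfold hsSq
  rw [Finset.sum_comm, Finset.sum_comm (f := fun i j => ‖M i j‖ ^ 2), Finset.mul_sum]
  refine Finset.sum_le_sum fun j _ => ?_
  have h := Matrix.l2_opNorm_mulVec W (WithLp.toLp 2 (fun i => M i j) : EuclideanSpace ℂ ι)
  have h2 := pow_le_pow_left₀ (norm_nonneg _) h 2
  rw [mul_pow, EuclideanSpace.norm_sq_eq, EuclideanSpace.norm_sq_eq] at h2
  simpa [Matrix.mul_apply, Matrix.mulVec, dotProduct] using h2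

-- Cauchy–Schwarz in its weighted arithmetic–geometric form. The weight `l` stays free so that the
-- two factors can be balanced after integration over the frequency.
omit [DecidableEq ι] in
theorem norm_trace_mul_conjTranspose_le (C D : Matrix ι ι ℂ) {l : ℝ} (hl : 0 < l) :
    ‖(C * Dᴴ).trace‖ ≤ (l * hsSq C + l⁻¹ * hsSq D) / 2 := by
  have h1 : ‖(C * Dᴴ).trace‖ ≤ ∑ i, ∑ j, ‖C i j‖ * ‖D i j‖ := by
    simp only [Matrix.trace, Matrix.diag, Matrix.mul_apply, Matrix.conjTranspose_apply]
    refine (norm_sum_le _ _).trans (Finset.sum_le_sum fun i _ => ?_)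
    refine (norm_sum_le _ _).trans (Finset.sum_le_sum fun j _ => ?_)
    rw [norm_mul, norm_star]
  refine h1.trans ?_
  have h2 : (l * hsSq C + l⁻¹ * hsSq D) / 2
      = ∑ i, ∑ j, (l * ‖C i j‖ ^ 2 + l⁻¹ * ‖D i j‖ ^ 2) / 2 := by
    simp only [hsSq, ← Finset.sum_div, Finset.sum_add_distrib, Finset.mul_sum]
  rw [h2]
  refine Finset.sum_le_sum fun i _ => Finset.sum_le_sum fun j _ => ?_
  have h3 : 0 ≤ l⁻¹ * (l * ‖C i j‖ - ‖D i j‖) ^ 2 := by positivity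
  have h4 : l⁻¹ * (l * ‖C i j‖ - ‖D i j‖) ^ 2
      = l * ‖C i j‖ ^ 2 - 2 * (‖C i j‖ * ‖D i j‖) + l⁻¹ * ‖D i j‖ ^ 2 := by
    field_simp; ring
  linarith

theorem traceBound_mul_conjTranspose (C D : Matrix ι ι ℂ) {l : ℝ} (hl : 0 < l) :
    TraceBound (C * Dᴴ) ((l * hsSq C + l⁻¹ * hsSq D) / 2) := fun W hW => by
  rw [← Matrix.mul_assoc]
  refine (norm_trace_mul_conjTranspose_le _ _ hl).trans ?_
  have h1 : hsSq (W * C) ≤ hsSq C :=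
    (hsSq_mul_le W C).trans (mul_le_of_le_one_left (hsSq_nonneg _)
      (pow_le_one₀ (norm_nonneg _) hW))
  have := mul_le_mul_of_nonneg_left h1 hl.le
  linarith

theorem TraceBound.conjTranspose {M : Matrix ι ι ℂ} {c : ℝ} (h : TraceBound M c) :
    TraceBound Mᴴ c := fun W hW => by
  have h1 := h Wᴴ (by rwa [Matrix.l2_opNorm_conjTranspose])
  rwa [← Matrix.conjTranspose_conjTranspose W, ← Matrix.conjTranspose_mul,
    Matrix.trace_conjTranspose, norm_star, Matrix.trace_mul_comm]

end HilbertSchmidt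

/-! ### Fourier transforms of the filter -/

section GaussianFourier

variable {σ : ℝ}

theorem integral_exp_mul_gaussian {b : ℝ} (hb : 0 < b) (x : ℝ) :
    ∫ t : ℝ, Complex.exp (Complex.I * ((x * t : ℝ) : ℂ)) * ((Real.exp (-b * t ^ 2) : ℝ) : ℂ)
      = ((√(Real.pi / b) * Real.exp (-x ^ 2 / (4 * b)) : ℝ) : ℂ) := by
  have h := fourierIntegral_gaussian (b := (b : ℂ)) (by simpa using hb) (x : ℂ)
  have h2 : ((Real.pi : ℂ) / b) ^ (1 / 2 : ℂ) = ((√(Real.pi / b) : ℝ) : ℂ) := by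
    rw [Real.sqrt_eq_rpow, Complex.ofReal_cpow (by positivity)]
    push_cast; rfl
  rw [h2] at h
  push_cast
  rw [← h]
  refine integral_congr_ae (ae_of_all _ fun t => ?_)
  simp only [mul_assoc]

/-- Fourier transform of the Gaussian filter. -/
noncomputable def filterFourier (σ x : ℝ) : ℝ :=
  gaussFilter σ 0 * (2 * σ * √Real.pi) * Real.exp (-σ ^ 2 * x ^ 2)

theorem sqrt_pi_div_inv_four (hσ : 0 < σ) : √(Real.pi / (1 / (4 * σ ^ 2))) = 2 * σ * √Real.pi := by
  rw [show Real.pi / (1 / (4 * σ ^ 2)) = (2 * σ) ^ 2 * Real.pi by field_simp; ring,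
    Real.sqrt_mul (by positivity), Real.sqrt_sq (by positivity)]

theorem integral_gaussFilter_mul_exp (hσ : 0 < σ) (x : ℝ) :
    ∫ t : ℝ, (gaussFilter σ t : ℂ) * Complex.exp (Complex.I * ((x * t : ℝ) : ℂ))
      = (filterFourier σ x : ℂ) := by
  have h := integral_exp_mul_gaussian (b := 1 / (4 * σ ^ 2)) (by positivity) x
  have h2 := congrArg (fun z => (gaussFilter σ 0 : ℂ) * z) h
  rw [← integral_const_mul] at h2
  have e : (filterFourier σ x : ℂ) = (gaussFilter σ 0 : ℂ) *
      ((√(Real.pi / (1 / (4 * σ ^ 2))) * Real.exp (-x ^ 2 / (4 * (1 / (4 * σ ^ 2)))) : ℝ) : ℂ) := by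
    have hx : -x ^ 2 / (4 * (1 / (4 * σ ^ 2))) = -σ ^ 2 * x ^ 2 := by field_simp
    rw [sqrt_pi_div_inv_four hσ, filterFourier, hx]
    push_cast; ring
  rw [e, ← h2]
  refine integral_congr_ae (ae_of_all _ fun t => ?_)
  simp only
  rw [gaussFilter_eq σ t]
  push_cast; ring

theorem gaussFilter_sq_eq (σ t : ℝ) : gaussFilter σ t ^ 2
    = gaussFilter σ 0 ^ 2 * Real.exp (-(1 / (2 * σ ^ 2)) * t ^ 2) := by
  rw [gaussFilter_eq σ t, mul_pow, ← Real.exp_nat_mul]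
  congr 2
  push_cast; ring

theorem integral_gaussFilter_sq_mul_exp (hσ : 0 < σ) (x : ℝ) :
    ∫ t : ℝ, ((gaussFilter σ t ^ 2 : ℝ) : ℂ) * Complex.exp (Complex.I * ((x * t : ℝ) : ℂ))
      = ((Real.exp (-(σ ^ 2 / 2) * x ^ 2) : ℝ) : ℂ) := by
  have h := integral_exp_mul_gaussian (b := 1 / (2 * σ ^ 2)) (by positivity) x
  have h2 := congrArg (fun z => ((gaussFilter σ 0 ^ 2 : ℝ) : ℂ) * z) h
  rw [← integral_const_mul, ← Complex.ofReal_mul] at h2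
  have e : gaussFilter σ 0 ^ 2 * (√(Real.pi / (1 / (2 * σ ^ 2))) *
      Real.exp (-x ^ 2 / (4 * (1 / (2 * σ ^ 2))))) = Real.exp (-(σ ^ 2 / 2) * x ^ 2) := by
    rw [gaussFilter_zero_sq hσ, show Real.pi / (1 / (2 * σ ^ 2)) = σ ^ 2 * (2 * Real.pi) by
      field_simp, Real.sqrt_mul (sq_nonneg σ), Real.sqrt_sq hσ.le,
      show -x ^ 2 / (4 * (1 / (2 * σ ^ 2))) = -(σ ^ 2 / 2) * x ^ 2 by field_simp; ring]
    have : 0 < √(2 * Real.pi) := by positivity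
    field_simp
  rw [← e, ← h2]
  refine integral_congr_ae (ae_of_all _ fun t => ?_)
  simp only
  rw [gaussFilter_sq_eq σ t]
  push_cast; ring

theorem filterFourier_mul (σ a b ω : ℝ) :
    filterFourier σ (ω - a) * filterFourier σ (ω - b)
      = (gaussFilter σ 0 * (2 * σ * √Real.pi)) ^ 2 * Real.exp (-(σ ^ 2 / 2) * (a - b) ^ 2)
        * Real.exp (-(2 * σ ^ 2) * (ω - (a + b) / 2) ^ 2) := by
  unfold filterFourier
  have : Real.exp (-σ ^ 2 * (ω - a) ^ 2) * Real.exp (-σ ^ 2 * (ω - b) ^ 2)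
      = Real.exp (-(σ ^ 2 / 2) * (a - b) ^ 2) * Real.exp (-(2 * σ ^ 2) * (ω - (a + b) / 2) ^ 2) := by
    rw [← Real.exp_add, ← Real.exp_add]
    congr 1
    ring
  linear_combination (gaussFilter σ 0 * (2 * σ * √Real.pi)) ^ 2 * this

theorem filterFourier_zero_sq (hσ : 0 < σ) : (gaussFilter σ 0 * (2 * σ * √Real.pi)) ^ 2
    = 4 * Real.pi * σ / √(2 * Real.pi) := by
  rw [mul_pow, gaussFilter_zero_sq hσ, mul_pow, Real.sq_sqrt Real.pi_pos.le]
  field_simp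
  ring

theorem integrable_filterFourier_mul (hσ : 0 < σ) (a b : ℝ) :
    Integrable fun ω => filterFourier σ (ω - a) * filterFourier σ (ω - b) := by
  simp only [filterFourier_mul σ]
  exact ((integrable_exp_neg_mul_sq (b := 2 * σ ^ 2) (by positivity)).comp_sub_right
    ((a + b) / 2)).const_mul _

/-- The overlap of two translates is, up to `2π`, the Fourier transform of the squared filter at `a
- b`; this match is the whole content of the Parseval identity below. -/
theorem integral_filterFourier_mul (hσ : 0 < σ) (a b : ℝ) :
    ∫ ω, filterFourier σ (ω - a) * filterFourier σ (ω - b)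
      = 2 * Real.pi * Real.exp (-(σ ^ 2 / 2) * (a - b) ^ 2) := by
  simp only [filterFourier_mul σ]
  rw [integral_const_mul,
    integral_sub_right_eq_self (fun ω : ℝ => Real.exp (-(2 * σ ^ 2) * ω ^ 2)) ((a + b) / 2),
    integral_gaussian, filterFourier_zero_sq hσ]
  have h : √(2 * Real.pi) * √(Real.pi / (2 * σ ^ 2)) = Real.pi / σ := by
    rw [← Real.sqrt_mul (by positivity), show 2 * Real.pi * (Real.pi / (2 * σ ^ 2))
      = (Real.pi / σ) ^ 2 by field_simp, Real.sqrt_sq (by positivity)]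
  have h0 : √(2 * Real.pi) ^ 2 = 2 * Real.pi := Real.sq_sqrt (by positivity)
  have h1 : 0 < √(2 * Real.pi) := by positivity
  have h2 : √(Real.pi / (2 * σ ^ 2)) = Real.pi / σ / √(2 * Real.pi) := by
    rw [eq_div_iff h1.ne', mul_comm, h]
  rw [h2]
  field_simp
  rw [mul_comm Real.pi 2, h0]; ring

theorem continuous_filterFourier (σ : ℝ) : Continuous (filterFourier σ) := by
  unfold filterFourier; fun_prop

end GaussianFourier

/-! ### Parseval for translates of the filter -/

section Parseval

variable {ι : Type*} [Fintype ι] {σ : ℝ}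

theorem norm_sum_sq_eq (z : ι → ℂ) :
    ((‖∑ j, z j‖ ^ 2 : ℝ) : ℂ) = ∑ j, ∑ k, z j * (starRingEnd ℂ) (z k) := by
  push_cast
  rw [← Complex.mul_conj', map_sum, Finset.sum_mul_sum]

/-- Parseval's identity for finite sums of translates of the filter. -/
theorem integral_norm_sum_filterFourier_sq (hσ : 0 < σ) (c : ι → ℂ) (ν : ι → ℝ) :
    Integrable (fun ω => ‖∑ j, c j * (filterFourier σ (ω - ν j) : ℂ)‖ ^ 2) ∧
    Integrable (fun t => gaussFilter σ t ^ 2 *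
      ‖∑ j, c j * Complex.exp (Complex.I * ((ν j * t : ℝ) : ℂ))‖ ^ 2) ∧
    ∫ ω, ‖∑ j, c j * (filterFourier σ (ω - ν j) : ℂ)‖ ^ 2
      = 2 * Real.pi * ∫ t, gaussFilter σ t ^ 2 *
        ‖∑ j, c j * Complex.exp (Complex.I * ((ν j * t : ℝ) : ℂ))‖ ^ 2 := by
  have e1 : ∀ ω, ((‖∑ j, c j * (filterFourier σ (ω - ν j) : ℂ)‖ ^ 2 : ℝ) : ℂ)
      = ∑ j, ∑ k, (c j * (starRingEnd ℂ) (c k)) *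
        ((filterFourier σ (ω - ν j) * filterFourier σ (ω - ν k) : ℝ) : ℂ) := fun ω => by
    rw [norm_sum_sq_eq]
    refine Finset.sum_congr rfl fun j _ => Finset.sum_congr rfl fun k _ => ?_
    rw [map_mul, Complex.conj_ofReal]; push_cast; ring
  have e2 : ∀ t, ((gaussFilter σ t ^ 2 *
      ‖∑ j, c j * Complex.exp (Complex.I * ((ν j * t : ℝ) : ℂ))‖ ^ 2 : ℝ) : ℂ)
      = ∑ j, ∑ k, (c j * (starRingEnd ℂ) (c k)) * (((gaussFilter σ t ^ 2 : ℝ) : ℂ) *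
        Complex.exp (Complex.I * (((ν j - ν k) * t : ℝ) : ℂ))) := fun t => by
    rw [Complex.ofReal_mul, norm_sum_sq_eq, Finset.mul_sum]
    refine Finset.sum_congr rfl fun j _ => ?_
    rw [Finset.mul_sum]
    refine Finset.sum_congr rfl fun k _ => ?_
    have : Complex.exp (Complex.I * (((ν j - ν k) * t : ℝ) : ℂ))
        = Complex.exp (Complex.I * ((ν j * t : ℝ) : ℂ))
          * (starRingEnd ℂ) (Complex.exp (Complex.I * ((ν k * t : ℝ) : ℂ))) := by
      rw [← Complex.exp_conj, ← Complex.exp_add, map_mul, Complex.conj_I, Complex.conj_ofReal]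
      congr 1; push_cast; ring
    rw [map_mul, this]; ring
  have j1 : ∀ j k, Integrable fun ω => (c j * (starRingEnd ℂ) (c k)) *
      ((filterFourier σ (ω - ν j) * filterFourier σ (ω - ν k) : ℝ) : ℂ) := fun j k =>
    (integrable_filterFourier_mul hσ (ν j) (ν k)).ofReal.const_mul _
  have hsq : Integrable fun t => gaussFilter σ t ^ 2 := by
    rw [funext (gaussFilter_sq_eq σ)]
    exact (integrable_exp_neg_mul_sq (by positivity)).const_mul _
  have j2 : ∀ j k, Integrable fun t => (c j * (starRingEnd ℂ) (c k)) *
      (((gaussFilter σ t ^ 2 : ℝ) : ℂ) *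
        Complex.exp (Complex.I * (((ν j - ν k) * t : ℝ) : ℂ))) := fun j k => by
    refine Integrable.const_mul (hsq.mono' ?_ (ae_of_all _ fun t => ?_)) _
    · have := continuous_gaussFilter σ
      exact Continuous.aestronglyMeasurable (by fun_prop)
    · rw [norm_mul, norm_exp_I_mul, mul_one, Complex.norm_real, Real.norm_of_nonneg (sq_nonneg _)]
  have s1 := integrable_finsetSum Finset.univ fun j _ =>
    integrable_finsetSum Finset.univ fun k _ => j1 j k
  have s2 := integrable_finsetSum Finset.univ fun j _ =>
    integrable_finsetSum Finset.univ fun k _ => j2 j k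
  have i1 : Integrable (fun ω => ‖∑ j, c j * (filterFourier σ (ω - ν j) : ℂ)‖ ^ 2) := by
    refine s1.re.congr (ae_of_all _ fun ω => ?_)
    simp only [← e1]; exact Complex.ofReal_re _
  have i2 : Integrable (fun t => gaussFilter σ t ^ 2 *
      ‖∑ j, c j * Complex.exp (Complex.I * ((ν j * t : ℝ) : ℂ))‖ ^ 2) := by
    refine s2.re.congr (ae_of_all _ fun ω => ?_)
    simp only [← e2]; exact Complex.ofReal_re _
  refine ⟨i1, i2, ?_⟩
  apply Complex.ofReal_injective
  rw [← integral_complex_ofReal, Complex.ofReal_mul, ← integral_complex_ofReal]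
  simp only [e1, e2]
  rw [integral_finsetSum _ fun j _ => integrable_finsetSum _ fun k _ => j1 j k,
    integral_finsetSum _ fun j _ => integrable_finsetSum _ fun k _ => j2 j k, Finset.mul_sum]
  refine Finset.sum_congr rfl fun j _ => ?_
  rw [integral_finsetSum _ fun k _ => j1 j k, integral_finsetSum _ fun k _ => j2 j k,
    Finset.mul_sum]
  refine Finset.sum_congr rfl fun k _ => ?_
  rw [integral_const_mul, integral_const_mul, integral_complex_ofReal,
    integral_filterFourier_mul hσ, integral_gaussFilter_sq_mul_exp hσ]
  push_cast; ring

end Parseval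

/-! ### Jump operators in the energy basis -/

section SpectralMultiplier

variable {d : ℕ} {H : Matrix (Fin d) (Fin d) ℂ} {σ : ℝ}

/-- The matrix with entries `Bᵢⱼ φ(ω - (Eᵢ - Eⱼ))`. -/
noncomputable def specMul (E : Fin d → ℝ) (B : Matrix (Fin d) (Fin d) ℂ) (φ : ℝ → ℝ) (ω : ℝ) :
    Matrix (Fin d) (Fin d) ℂ :=
  Matrix.of fun i j => B i j * (φ (ω - (E i - E j)) : ℂ)

theorem integral_apply {X : Type*} [MeasurableSpace X] {μ : Measure X}
    {F : X → Matrix (Fin d) (Fin d) ℂ} (hF : Integrable F μ) (i j : Fin d) :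
    (∫ x, F x ∂μ) i j = ∫ x, F x i j ∂μ :=
  ((Matrix.entryLinearMap ℂ ℂ i j).toContinuousLinearMap.integral_comp_comm hF).symm

theorem evo_eq_conj_diagonal {Q : Matrix (Fin d) (Fin d) ℂ} {E : Fin d → ℝ} (hQ : Qᴴ * Q = 1)
    (hQ' : Q * Qᴴ = 1) (hH : H = Q * Matrix.diagonal (fun i => (E i : ℂ)) * Qᴴ) (s : ℝ) :
    evo H s = Q * Matrix.diagonal (fun i => Complex.exp (Complex.I * ((E i * s : ℝ) : ℂ))) * Qᴴ := by
  have hinv : Q⁻¹ = Qᴴ := Matrix.inv_eq_right_inv hQ'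
  have hu : IsUnit Q := ⟨⟨Q, Qᴴ, hQ', hQ⟩, rfl⟩
  have h1 : (Complex.I * (s : ℂ)) • H
      = Q * Matrix.diagonal (fun i => Complex.I * ((E i * s : ℝ) : ℂ)) * Q⁻¹ := by
    rw [hH, hinv, ← Matrix.smul_mul, ← Matrix.mul_smul, ← Matrix.diagonal_smul]
    congr 3
    funext i
    simp only [Pi.smul_apply, smul_eq_mul]
    push_cast; ring
  rw [evo, h1, Matrix.exp_conj _ _ hu, Matrix.exp_diagonal, hinv]
  congr 3
  funext i
  rw [Pi.exp_def, Complex.exp_eq_exp_ℂ]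

theorem heis_conj_apply {Q : Matrix (Fin d) (Fin d) ℂ} {E : Fin d → ℝ} (hH' : H.IsHermitian)
    (hQ : Qᴴ * Q = 1) (hQ' : Q * Qᴴ = 1)
    (hH : H = Q * Matrix.diagonal (fun i => (E i : ℂ)) * Qᴴ) (A : Matrix (Fin d) (Fin d) ℂ)
    (s : ℝ) (i j : Fin d) : (Qᴴ * heis H A s * Q) i j
      = (Qᴴ * A * Q) i j * Complex.exp (Complex.I * (((E i - E j) * s : ℝ) : ℂ)) := by
  set D := Matrix.diagonal (fun i => Complex.exp (Complex.I * ((E i * s : ℝ) : ℂ))) with hD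
  have h1 : Qᴴ * heis H A s * Q = D * (Qᴴ * A * Q) * Dᴴ := by
    rw [heis_eq hH', evo_eq_conj_diagonal hQ hQ' hH]
    simp only [Matrix.conjTranspose_mul, Matrix.conjTranspose_conjTranspose, ← Matrix.mul_assoc,
      hQ, Matrix.one_mul]
    rw [Matrix.mul_assoc _ Qᴴ Q, hQ, Matrix.mul_one]
  rw [h1, hD, Matrix.diagonal_conjTranspose, Matrix.mul_diagonal, Matrix.diagonal_mul,
    Pi.star_apply, Complex.star_def, ← Complex.exp_conj, map_mul, Complex.conj_I,
    Complex.conj_ofReal, mul_comm (Complex.exp _), mul_assoc, ← Complex.exp_add]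
  congr 2
  push_cast; ring

theorem filterFourier_neg (σ x : ℝ) : filterFourier σ (-x) = filterFourier σ x := by
  unfold filterFourier; rw [neg_sq]

/-- The entry `(i, j)` of `A(t)` oscillates at the Bohr frequency `E i - E j`, so the filtered
integral multiplies it by the filter transform at the detuning. -/
theorem conj_jumpOp_eq {Q : Matrix (Fin d) (Fin d) ℂ} {E : Fin d → ℝ} (hH' : H.IsHermitian)
    (hQ : Qᴴ * Q = 1) (hQ' : Q * Qᴴ = 1)
    (hH : H = Q * Matrix.diagonal (fun i => (E i : ℂ)) * Qᴴ) (A : Matrix (Fin d) (Fin d) ℂ)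
    (hσ : 0 < σ) (ω : ℝ) :
    Qᴴ * jumpOp H A σ ω * Q = specMul E (Qᴴ * A * Q) (filterFourier σ) ω := by
  ext i j
  have hi := integrable_coupling hH' A hσ ω
  rw [jumpOp_eq, conj_integral hi, integral_apply (integrable_conj hi _ _), specMul,
    Matrix.of_apply, ← neg_sub, filterFourier_neg, ← integral_gaussFilter_mul_exp hσ,
    ← integral_const_mul]
  refine integral_congr_ae (ae_of_all _ fun t => ?_)
  simp only
  rw [coupling, Matrix.mul_smul, Matrix.smul_mul, Matrix.smul_apply,
    heis_conj_apply hH' hQ hQ' hH, smul_eq_mul]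
  have e : Complex.exp (Complex.I * (((E i - E j - ω) * t : ℝ) : ℂ))
      = Complex.exp (-Complex.I * ((ω * t : ℝ) : ℂ))
        * Complex.exp (Complex.I * (((E i - E j) * t : ℝ) : ℂ)) := by
    rw [← Complex.exp_add]; congr 1; push_cast; ring
  rw [e]; ring

theorem jumpOp_eq_conj {Q : Matrix (Fin d) (Fin d) ℂ} {E : Fin d → ℝ} (hH' : H.IsHermitian)
    (hQ : Qᴴ * Q = 1) (hQ' : Q * Qᴴ = 1)
    (hH : H = Q * Matrix.diagonal (fun i => (E i : ℂ)) * Qᴴ) (A : Matrix (Fin d) (Fin d) ℂ)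
    (hσ : 0 < σ) (ω : ℝ) :
    jumpOp H A σ ω = Q * specMul E (Qᴴ * A * Q) (filterFourier σ) ω * Qᴴ := by
  rw [← conj_jumpOp_eq hH' hQ hQ' hH A hσ]
  simp only [← Matrix.mul_assoc, hQ', Matrix.one_mul]
  rw [Matrix.mul_assoc, hQ', Matrix.mul_one]

theorem norm_conj_le {Q : Matrix (Fin d) (Fin d) ℂ} (hQ : Qᴴ * Q = 1)
    (A : Matrix (Fin d) (Fin d) ℂ) : ‖Qᴴ * A * Q‖ ≤ ‖A‖ := by
  have hq := norm_le_one_of_conjTranspose_mul_self hQ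
  refine (norm_mul_le _ _).trans ((mul_le_of_le_one_right (norm_nonneg _) hq).trans ?_)
  refine (norm_mul_le _ _).trans (mul_le_of_le_one_left (norm_nonneg _) ?_)
  rwa [Matrix.l2_opNorm_conjTranspose]

/-- The phases are a conjugation by a diagonal unitary. -/
theorem norm_phase_mul_le (E : Fin d → ℝ) (B : Matrix (Fin d) (Fin d) ℂ) (t : ℝ) :
    ‖(Matrix.of fun i j => B i j * Complex.exp (Complex.I * (((E i - E j) * t : ℝ) : ℂ)) :
      Matrix (Fin d) (Fin d) ℂ)‖ ≤ ‖B‖ := by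
  set D := Matrix.diagonal (fun i => Complex.exp (Complex.I * ((E i * t : ℝ) : ℂ))) with hD
  have h1 : (Matrix.of fun i j => B i j * Complex.exp (Complex.I * (((E i - E j) * t : ℝ) : ℂ)) :
      Matrix (Fin d) (Fin d) ℂ) = D * B * Dᴴ := by
    ext i j
    rw [hD, Matrix.diagonal_conjTranspose, Matrix.mul_diagonal, Matrix.diagonal_mul,
      Pi.star_apply, Complex.star_def, ← Complex.exp_conj, map_mul, Complex.conj_I,
      Complex.conj_ofReal, mul_comm (Complex.exp _), mul_assoc, ← Complex.exp_add,
      Matrix.of_apply]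
    congr 2
    push_cast; ring
  have hD1 : ‖D‖ ≤ 1 := norm_diagonal_le zero_le_one fun i => (norm_exp_I_mul _).le
  rw [h1]
  refine (norm_mul_le _ _).trans ?_
  rw [Matrix.l2_opNorm_conjTranspose]
  refine (mul_le_of_le_one_right (norm_nonneg _) hD1).trans ?_
  exact (norm_mul_le _ _).trans (mul_le_of_le_one_left (norm_nonneg _) hD1)

theorem specMul_mul_apply (E : Fin d → ℝ) (B Z : Matrix (Fin d) (Fin d) ℂ) (φ : ℝ → ℝ) (ω : ℝ)
    (i k : Fin d) : (specMul E B φ ω * Z) i k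
      = ∑ j, (B i j * Z j k) * (φ (ω - (E i - E j)) : ℂ) := by
  rw [Matrix.mul_apply]
  exact Finset.sum_congr rfl fun j _ => by rw [specMul, Matrix.of_apply]; ring

theorem integrable_hsSq_specMul_mul (E : Fin d → ℝ) (B Z : Matrix (Fin d) (Fin d) ℂ)
    (hσ : 0 < σ) : Integrable fun ω => hsSq (specMul E B (filterFourier σ) ω * Z) := by
  unfold hsSq
  refine integrable_finsetSum _ fun i _ => integrable_finsetSum _ fun k _ => ?_
  simp only [specMul_mul_apply]
  exact (integral_norm_sum_filterFourier_sq hσ (fun j => B i j * Z j k) fun j => E i - E j).1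

/-- Parseval replaces the frequency integral by a time average of unitary conjugates of `B`. This
allows a non-diagonal `Z`, which the crude dissipator bound requires. -/
theorem integral_hsSq_specMul_mul_le (E : Fin d → ℝ) (B Z : Matrix (Fin d) (Fin d) ℂ)
    (hσ : 0 < σ) : ∫ ω, hsSq (specMul E B (filterFourier σ) ω * Z)
      ≤ 2 * Real.pi * (‖B‖ ^ 2 * hsSq Z) := by
  have key := fun i k =>
    integral_norm_sum_filterFourier_sq hσ (fun j => B i j * Z j k) fun j => E i - E j
  set U : ℝ → Matrix (Fin d) (Fin d) ℂ := fun t => Matrix.of fun i j =>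
    B i j * Complex.exp (Complex.I * (((E i - E j) * t : ℝ) : ℂ)) with hU
  have hsum : ∀ t, gaussFilter σ t ^ 2 * hsSq (U t * Z) = ∑ i, ∑ k, gaussFilter σ t ^ 2 *
      ‖∑ j, B i j * Z j k * Complex.exp (Complex.I * (((E i - E j) * t : ℝ) : ℂ))‖ ^ 2 := fun t => by
    simp only [hsSq, Finset.mul_sum]
    refine Finset.sum_congr rfl fun i _ => Finset.sum_congr rfl fun k _ => ?_
    rw [Matrix.mul_apply]
    congr 3
    exact Finset.sum_congr rfl fun j _ => by simp only [hU, Matrix.of_apply]; ring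
  have e : ∫ ω, hsSq (specMul E B (filterFourier σ) ω * Z)
      = 2 * Real.pi * ∫ t, gaussFilter σ t ^ 2 * hsSq (U t * Z) := by
    simp only [hsum]
    simp only [hsSq, specMul_mul_apply]
    rw [integral_finsetSum _ fun i _ => integrable_finsetSum _ fun k _ => (key i k).1,
      integral_finsetSum _ fun i _ => integrable_finsetSum _ fun k _ => (key i k).2.1,
      Finset.mul_sum]
    refine Finset.sum_congr rfl fun i _ => ?_
    rw [integral_finsetSum _ fun k _ => (key i k).1, integral_finsetSum _ fun k _ => (key i k).2.1,
      Finset.mul_sum]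
    exact Finset.sum_congr rfl fun k _ => (key i k).2.2
  have hnorm : ∫ t, gaussFilter σ t ^ 2 = 1 := by
    have h := integral_gaussFilter_sq_mul_exp hσ 0
    simp only [zero_mul, Complex.ofReal_zero, mul_zero, Complex.exp_zero, mul_one] at h
    rw [integral_complex_ofReal] at h
    have := Complex.ofReal_injective h
    simpa using this
  have hsq : Integrable fun t => gaussFilter σ t ^ 2 :=
    integrable_of_integral_eq_one hnorm
  have hi : Integrable fun t => gaussFilter σ t ^ 2 * hsSq (U t * Z) := by
    simp only [hsum]
    exact integrable_finsetSum _ fun i _ => integrable_finsetSum _ fun k _ => (key i k).2.1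
  rw [e]
  refine mul_le_mul_of_nonneg_left ?_ (by positivity)
  have h2 := integral_mono hi (hsq.mul_const (‖B‖ ^ 2 * hsSq Z)) fun t =>
    mul_le_mul_of_nonneg_left ((hsSq_mul_le (U t) Z).trans (mul_le_mul_of_nonneg_right
      (pow_le_pow_left₀ (norm_nonneg _) (norm_phase_mul_le E B t) 2) (hsSq_nonneg Z)))
      (sq_nonneg (gaussFilter σ t))
  rwa [integral_mul_const, hnorm, one_mul] at h2

theorem hsSq_specMul_diagonal (E : Fin d → ℝ) (B : Matrix (Fin d) (Fin d) ℂ) (φ : ℝ → ℝ)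
    {p : Fin d → ℝ} (hp : ∀ i, 0 ≤ p i) (ω : ℝ) :
    hsSq (specMul E B φ ω * Matrix.diagonal fun i => ((√(p i) : ℝ) : ℂ))
      = ∑ i, ∑ j, (‖B i j‖ ^ 2 * p j) * φ (ω - (E i - E j)) ^ 2 := by
  unfold hsSq
  refine Finset.sum_congr rfl fun i _ => Finset.sum_congr rfl fun j _ => ?_
  rw [Matrix.mul_diagonal, specMul, Matrix.of_apply, norm_mul, norm_mul, mul_pow, mul_pow,
    Complex.norm_real, Complex.norm_real, Real.norm_eq_abs, Real.norm_eq_abs, sq_abs, sq_abs,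
    Real.sq_sqrt (hp j)]
  ring

theorem integrable_hsSq_specMul_diagonal (E : Fin d → ℝ) (B : Matrix (Fin d) (Fin d) ℂ)
    {φ : ℝ → ℝ} (hφ : Integrable fun x => φ x ^ 2) {p : Fin d → ℝ} (hp : ∀ i, 0 ≤ p i) :
    Integrable fun ω =>
      hsSq (specMul E B φ ω * Matrix.diagonal fun i => ((√(p i) : ℝ) : ℂ)) := by
  simp only [hsSq_specMul_diagonal E B φ hp]
  exact integrable_finsetSum _ fun i _ => integrable_finsetSum _ fun j _ =>
    (hφ.comp_sub_right (E i - E j)).const_mul _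

/-- With a diagonal factor there is no interference between entries, so any square integrable `φ` is
allowed; this form is needed for the detailed balance defect. -/
theorem integral_hsSq_specMul_diagonal_le (E : Fin d → ℝ) (B : Matrix (Fin d) (Fin d) ℂ)
    {φ : ℝ → ℝ} (hφ : Integrable fun x => φ x ^ 2) {p : Fin d → ℝ} (hp : ∀ i, 0 ≤ p i)
    (hs : ∑ i, p i = 1) :
    ∫ ω, hsSq (specMul E B φ ω * Matrix.diagonal fun i => ((√(p i) : ℝ) : ℂ))
      ≤ ‖B‖ ^ 2 * ∫ x, φ x ^ 2 := by
  have hi : ∀ i j, Integrable fun ω => (‖B i j‖ ^ 2 * p j) * φ (ω - (E i - E j)) ^ 2 :=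
    fun i j => (hφ.comp_sub_right (E i - E j)).const_mul _
  simp only [hsSq_specMul_diagonal E B φ hp]
  rw [integral_finsetSum _ fun i _ => integrable_finsetSum _ fun j _ => hi i j]
  have h1 : ∀ i, ∫ ω, ∑ j, (‖B i j‖ ^ 2 * p j) * φ (ω - (E i - E j)) ^ 2
      = ∑ j, (‖B i j‖ ^ 2 * p j) * ∫ x, φ x ^ 2 := fun i => by
    rw [integral_finsetSum _ fun j _ => hi i j]
    refine Finset.sum_congr rfl fun j _ => ?_
    rw [integral_const_mul, integral_sub_right_eq_self (fun x => φ x ^ 2) (E i - E j)]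
  simp only [h1]
  rw [Finset.sum_comm]
  have h2 : ∀ j, ∑ i, (‖B i j‖ ^ 2 * p j) * ∫ x, φ x ^ 2
      ≤ p j * (‖B‖ ^ 2 * ∫ x, φ x ^ 2) := fun j => by
    rw [← Finset.sum_mul, ← Finset.sum_mul]
    have h3 := sum_col_norm_sq_le B j
    have h4 : 0 ≤ ∫ x, φ x ^ 2 := integral_nonneg fun x => sq_nonneg _
    have h5 := mul_le_mul_of_nonneg_right h3 (mul_nonneg (hp j) h4)
    linarith
  refine (Finset.sum_le_sum fun j _ => h2 j).trans (le_of_eq ?_)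
  rw [← Finset.sum_mul, hs, one_mul]

end SpectralMultiplier

/-! ### Size of the detailed balance defect -/

section DetailedBalanceDefect

variable {σ β : ℝ}

/-- The filter transform times the detailed balance defect `1 - exp(βx)`. -/
noncomputable def filterDefect (σ β x : ℝ) : ℝ := filterFourier σ x * (1 - Real.exp (β * x))

/-- In the variable `u = σ x` the defect is `1 - exp (κ u)` with `κ = β / σ ≤ 1`, at most `2 κ |u|
exp |u|` in size. Half of the decay `exp (-2u²)` of the squared transform absorbs `u² exp (2|u|)`.
-/
theorem filterDefect_sq_le (hσ : 0 < σ) (hβ : 0 ≤ β) (hβσ : β ≤ σ) (x : ℝ) :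
    filterDefect σ β x ^ 2 ≤ 4 * Real.pi * σ / √(2 * Real.pi) * (64 * (β / σ) ^ 2)
      * Real.exp (-σ ^ 2 * x ^ 2) := by
  set u := σ * x with hu
  set κ := β / σ with hκ
  have hκ0 : 0 ≤ κ := by positivity
  have hκ1 : κ ≤ 1 := (div_le_one hσ).2 hβσ
  have hy : β * x = κ * u := by rw [hκ, hu]; field_simp
  have habs : |κ * u| = κ * |u| := by rw [abs_mul, abs_of_nonneg hκ0]
  have h1 : |1 - Real.exp (κ * u)| ≤ 2 * κ * |u| * Real.exp |u| := by
    have h := abs_one_sub_exp_neg_le (-(κ * u))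
    rw [neg_neg, abs_neg, habs] at h
    have h2 : κ * u ≤ |u| :=
      (le_abs_self _).trans (habs.le.trans (mul_le_of_le_one_left (abs_nonneg u) hκ1))
    have h3 : Real.exp (κ * u) ≤ Real.exp |u| := Real.exp_le_exp.2 h2
    have h4 : 1 ≤ Real.exp |u| := Real.one_le_exp (abs_nonneg u)
    have h5 : 0 ≤ κ * |u| := by positivity
    nlinarith
  have h2 : (1 - Real.exp (κ * u)) ^ 2 ≤ 64 * κ ^ 2 * Real.exp (u ^ 2) := by
    have h3 : (1 - Real.exp (κ * u)) ^ 2 ≤ (2 * κ * |u| * Real.exp |u|) ^ 2 := by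
      rw [← sq_abs]; exact pow_le_pow_left₀ (abs_nonneg _) h1 2
    have h4 : (2 * κ * |u| * Real.exp |u|) ^ 2 = 4 * κ ^ 2 * (u ^ 2 * Real.exp (2 * |u|)) := by
      rw [two_mul |u|, Real.exp_add, mul_pow, mul_pow, mul_pow, sq_abs]; ring
    have h5 : u ^ 2 ≤ 2 * Real.exp (u ^ 2 / 2) := by
      have := Real.add_one_le_exp (u ^ 2 / 2)
      linarith
    have h6 : Real.exp (2 * |u|) ≤ 8 * Real.exp (u ^ 2 / 2) := by
      have h7 : Real.exp 2 ≤ 8 := by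
        have h8 := Real.exp_one_lt_d9
        have h9 : Real.exp 2 = Real.exp 1 ^ 2 := by rw [← Real.exp_nat_mul]; norm_num
        rw [h9]; nlinarith [Real.exp_pos 1]
      have h10 : Real.exp (2 * |u|) ≤ Real.exp 2 * Real.exp (u ^ 2 / 2) := by
        rw [← Real.exp_add]
        refine Real.exp_le_exp.2 ?_
        nlinarith [sq_nonneg (|u| - 2), sq_abs u]
      exact h10.trans (mul_le_mul_of_nonneg_right h7 (Real.exp_pos _).le)
    have h7 : u ^ 2 * Real.exp (2 * |u|) ≤ 16 * Real.exp (u ^ 2) := by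
      have h8 : Real.exp (u ^ 2) = Real.exp (u ^ 2 / 2) * Real.exp (u ^ 2 / 2) := by
        rw [← Real.exp_add]; congr 1; ring
      rw [h8]
      refine (mul_le_mul h5 h6 (Real.exp_pos _).le (by positivity)).trans (le_of_eq (by ring))
    have := mul_le_mul_of_nonneg_left h7 (by positivity : 0 ≤ 4 * κ ^ 2)
    linarith
  have h3 : filterFourier σ x ^ 2
      = 4 * Real.pi * σ / √(2 * Real.pi) * (Real.exp (-u ^ 2) * Real.exp (-u ^ 2)) := by
    rw [filterFourier, mul_pow, filterFourier_zero_sq hσ, hu, mul_pow, neg_mul]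
    ring
  have h4 : Real.exp (-u ^ 2) * Real.exp (u ^ 2) = 1 := by rw [← Real.exp_add]; simp
  have hc : 0 ≤ 4 * Real.pi * σ / √(2 * Real.pi) := by positivity
  rw [filterDefect, mul_pow, hy, h3, neg_mul, ← mul_pow, ← hu]
  have h5 := mul_le_mul_of_nonneg_left h2
    (by positivity : 0 ≤ 4 * Real.pi * σ / √(2 * Real.pi) * (Real.exp (-u ^ 2) * Real.exp (-u ^ 2)))
  refine h5.trans (le_of_eq ?_)
  linear_combination (4 * Real.pi * σ / √(2 * Real.pi) * (64 * κ ^ 2) * Real.exp (-u ^ 2)) * h4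

theorem integrable_filterDefect_sq (hσ : 0 < σ) (hβ : 0 ≤ β) (hβσ : β ≤ σ) :
    Integrable fun x => filterDefect σ β x ^ 2 := by
  refine ((integrable_exp_neg_mul_sq (b := σ ^ 2) (by positivity)).const_mul
    (4 * Real.pi * σ / √(2 * Real.pi) * (64 * (β / σ) ^ 2))).mono'
    (Continuous.aestronglyMeasurable ?_) (ae_of_all _ fun x => ?_)
  · unfold filterDefect
    have := continuous_filterFourier σ
    fun_prop
  · rw [Real.norm_of_nonneg (sq_nonneg _)]
    exact filterDefect_sq_le hσ hβ hβσ x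

theorem integral_filterDefect_sq_le (hσ : 0 < σ) (hβ : 0 ≤ β) (hβσ : β ≤ σ) :
    ∫ x, filterDefect σ β x ^ 2 ≤ 1024 * (β / σ) ^ 2 := by
  have h1 := integral_mono (integrable_filterDefect_sq hσ hβ hβσ)
    ((integrable_exp_neg_mul_sq (b := σ ^ 2) (by positivity)).const_mul
      (4 * Real.pi * σ / √(2 * Real.pi) * (64 * (β / σ) ^ 2)))
    fun x => filterDefect_sq_le hσ hβ hβσ x
  rw [integral_const_mul, integral_gaussian] at h1
  refine h1.trans ?_
  have h2 : √(Real.pi / σ ^ 2) ≤ √(2 * Real.pi) / σ := by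
    rw [Real.sqrt_div Real.pi_pos.le, Real.sqrt_sq hσ.le]
    exact div_le_div_of_nonneg_right (Real.sqrt_le_sqrt (by linarith [Real.pi_pos])) hσ.le
  have h3 : 0 < √(2 * Real.pi) := by positivity
  refine (mul_le_mul_of_nonneg_left h2 (by positivity)).trans ?_
  have h4 : 4 * Real.pi * σ / √(2 * Real.pi) * (64 * (β / σ) ^ 2) * (√(2 * Real.pi) / σ)
      = 256 * Real.pi * (β / σ) ^ 2 := by
    generalize (β / σ) ^ 2 = z
    field_simp
    ring
  rw [h4]
  have := Real.pi_lt_four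
  gcongr
  linarith

end DetailedBalanceDefect

/-! ### Bound on the dissipative error by near detailed balance -/

section DissipatorBound

variable {d : ℕ} {H : Matrix (Fin d) (Fin d) ℂ} {σ β : ℝ}

/-- The KMS condition: the symmetrised density cancels and only the thermal factor remains. -/
theorem rate_neg (g : ℝ → ℝ) (β ω : ℝ) :
    rate g β (-ω) = rate g β ω * Real.exp (β * ω) := by
  rw [rate, rate, neg_neg, mul_neg, Real.exp_neg]
  have := Real.exp_pos (β * ω)
  field_simp
  ring

theorem jumpOp_conjTranspose (hH : H.IsHermitian) (A : Matrix (Fin d) (Fin d) ℂ) (σ ω : ℝ) :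
    (jumpOp H A σ ω)ᴴ = jumpOp H Aᴴ σ (-ω) := by
  rw [jumpOp_eq, jumpOp_eq, ← integral_conjTranspose]
  simp only [coupling_conjTranspose hH]

theorem integral_mul_matrix {X : Type*} [MeasurableSpace X] {μ : Measure X}
    {F : X → Matrix (Fin d) (Fin d) ℂ} (hF : Integrable F μ) (V : Matrix (Fin d) (Fin d) ℂ) :
    (∫ x, F x ∂μ) * V = ∫ x, F x * V ∂μ := by
  simpa using conj_integral hF 1 V

theorem integrable_mul_matrix {X : Type*} [MeasurableSpace X] {μ : Measure X}
    {F : X → Matrix (Fin d) (Fin d) ℂ} (hF : Integrable F μ) (V : Matrix (Fin d) (Fin d) ℂ) :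
    Integrable (fun x => F x * V) μ := by
  simpa using integrable_conj hF 1 V

theorem integrable_smul_jumpOp_conj (hH : H.IsHermitian) (A ρ : Matrix (Fin d) (Fin d) ℂ)
    (hσ : 0 < σ) {r : ℝ → ℝ} (hr : Integrable r) :
    Integrable fun ω => r ω • (jumpOp H A σ ω * ρ * (jumpOp H A σ ω)ᴴ) := by
  have h1 := continuous_jumpOp hH A hσ
  have h2 : Continuous fun ω => (jumpOp H A σ ω)ᴴ := h1.star
  have hc : Continuous fun ω => jumpOp H A σ ω * ρ * (jumpOp H A σ ω)ᴴ := by fun_prop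
  refine integrable_smul_of_norm_le (C := ((∫ x, gaussFilter σ x) * ‖A‖) ^ 2 * ‖ρ‖) hr
    hc.aestronglyMeasurable fun ω => ?_
  have h3 := norm_jumpOp_le hH A hσ ω
  refine (norm_mul_le _ _).trans ?_
  rw [Matrix.l2_opNorm_conjTranspose]
  refine (mul_le_mul_of_nonneg_right (norm_mul_le _ _) (norm_nonneg _)).trans ?_
  rw [mul_right_comm, ← sq]
  gcongr

theorem integrable_smul_jumpOp_self_mul (hH : H.IsHermitian) (A : Matrix (Fin d) (Fin d) ℂ)
    (hσ : 0 < σ) {r : ℝ → ℝ} (hr : Integrable r) :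
    Integrable fun ω => r ω • (jumpOp H A σ ω * (jumpOp H A σ ω)ᴴ) := by
  simpa using integrable_smul_jumpOp_conj hH A 1 hσ hr

theorem integrable_smul_jumpOp_conjTranspose_mul (hH : H.IsHermitian)
    (A : Matrix (Fin d) (Fin d) ℂ) (hσ : 0 < σ) {r : ℝ → ℝ} (hr : Integrable r) :
    Integrable fun ω => r ω • ((jumpOp H A σ ω)ᴴ * jumpOp H A σ ω) := by
  have h := (integrable_smul_jumpOp_self_mul hH Aᴴ hσ hr.comp_neg).comp_neg
  refine h.congr (ae_of_all _ fun ω => ?_)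
  simp only [neg_neg]
  rw [jumpOp_conjTranspose hH, jumpOp_conjTranspose hH, neg_neg, Matrix.conjTranspose_conjTranspose]

theorem integral_smul_dissipator (hH : H.IsHermitian) (A ρ : Matrix (Fin d) (Fin d) ℂ)
    (hσ : 0 < σ) {r : ℝ → ℝ} (hr : Integrable r) :
    ∫ ω, r ω • dissipator (jumpOp H A σ ω) ρ
      = (∫ ω, r ω • (jumpOp H A σ ω * ρ * (jumpOp H A σ ω)ᴴ))
        - (1 / 2 : ℂ) • ((∫ ω, r ω • ((jumpOp H A σ ω)ᴴ * jumpOp H A σ ω)) * ρ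
          + ρ * ∫ ω, r ω • ((jumpOp H A σ ω)ᴴ * jumpOp H A σ ω)) := by
  have i1 := integrable_smul_jumpOp_conj hH A ρ hσ hr
  have i2 := integrable_smul_jumpOp_conjTranspose_mul hH A hσ hr
  obtain ⟨N, hN⟩ : ∃ N : ℝ → Matrix (Fin d) (Fin d) ℂ,
    ∀ ω, N ω = r ω • ((jumpOp H A σ ω)ᴴ * jumpOp H A σ ω) := ⟨_, fun _ => rfl⟩
  obtain ⟨P, hP⟩ : ∃ P : ℝ → Matrix (Fin d) (Fin d) ℂ,
    ∀ ω, P ω = r ω • (jumpOp H A σ ω * ρ * (jumpOp H A σ ω)ᴴ) := ⟨_, fun _ => rfl⟩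
  simp only [← hN, ← hP] at i1 i2 ⊢
  have hD : ∀ ω, r ω • dissipator (jumpOp H A σ ω) ρ
      = P ω - (1 / 2 : ℂ) • (N ω * ρ + ρ * N ω) := fun ω => by
    rw [hP, hN, dissipator]
    simp only [Matrix.smul_mul, Matrix.mul_smul, smul_sub, smul_add]
    congr 1
    module
  have j1 := integrable_conj i2 1 ρ
  have j2 := integrable_conj i2 ρ 1
  have k1 := conj_integral i2 1 ρ
  have k2 := conj_integral i2 ρ 1
  simp only [Matrix.one_mul, Matrix.mul_one] at j1 j2 k1 k2
  simp only [hD]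
  have j3 : Integrable fun ω => (1 / 2 : ℂ) • (N ω * ρ + ρ * N ω) :=
    (j1.add j2).smul (1 / 2 : ℂ)
  rw [integral_sub i1 j3, integral_smul, integral_add j1 j2, ← k1, ← k2]

theorem integral_conjTranspose_mul_jumpOp (hH : H.IsHermitian) (A : Matrix (Fin d) (Fin d) ℂ)
    (σ : ℝ) (r : ℝ → ℝ) :
    ∫ ω, r ω • ((jumpOp H Aᴴ σ ω)ᴴ * jumpOp H Aᴴ σ ω)
      = ∫ ω, r (-ω) • (jumpOp H A σ ω * (jumpOp H A σ ω)ᴴ) := by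
  rw [← integral_neg_eq_self]
  refine integral_congr_ae (ae_of_all _ fun ω => ?_)
  simp only
  rw [← jumpOp_conjTranspose hH, Matrix.conjTranspose_conjTranspose]

/-- Detailed balance: the two halves of the dissipator combine into a defect term. -/
theorem jumpOp_detailed_balance {Q : Matrix (Fin d) (Fin d) ℂ} {E p : Fin d → ℝ}
    (hQ : Qᴴ * Q = 1) (hp : ∀ i, 0 ≤ p i)
    (hdb : ∀ i j, p i = p j * Real.exp (-β * (E i - E j))) (B : Matrix (Fin d) (Fin d) ℂ)
    (σ ω : ℝ) {V ρ : Matrix (Fin d) (Fin d) ℂ}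
    (hV : V = Q * specMul E B (filterFourier σ) ω * Qᴴ)
    (hρ : ρ = Q * Matrix.diagonal (fun i => (p i : ℂ)) * Qᴴ) :
    V * ρ * Vᴴ - (Real.exp (β * ω) : ℂ) • (V * Vᴴ * ρ)
      = Q * ((specMul E B (filterFourier σ) ω * Matrix.diagonal fun i => ((√(p i) : ℝ) : ℂ))
          * (specMul E B (filterDefect σ β) ω *
            Matrix.diagonal fun i => ((√(p i) : ℝ) : ℂ))ᴴ) * Qᴴ := by
  set v := specMul E B (filterFourier σ) ω with hv
  set x := specMul E B (filterDefect σ β) ω with hx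
  set D := Matrix.diagonal (fun i => (p i : ℂ)) with hD
  set S := Matrix.diagonal (fun i => ((√(p i) : ℝ) : ℂ)) with hS
  have hSS : S * Sᴴ = D := by
    rw [hS, hD, Matrix.diagonal_conjTranspose, Matrix.diagonal_mul_diagonal]
    congr 1
    funext i
    rw [Pi.star_apply, Complex.star_def, Complex.conj_ofReal, ← Complex.ofReal_mul,
      Real.mul_self_sqrt (hp i)]
  -- Moving the Gibbs weight across `vᴴ` costs `exp (-β (E j - E i))`, so together with `exp (β ω)`
  -- only the exponential of the detuning `ω - (E j - E i)` survives.
  have key : D * xᴴ = D * vᴴ - (Real.exp (β * ω) : ℂ) • (vᴴ * D) := by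
    ext i j
    rw [Matrix.sub_apply, Matrix.smul_apply, hD, Matrix.diagonal_mul, Matrix.diagonal_mul,
      Matrix.mul_diagonal, Matrix.conjTranspose_apply, Matrix.conjTranspose_apply, hx, hv,
      specMul, specMul, Matrix.of_apply, Matrix.of_apply, filterDefect]
    have h1 : p j * Real.exp (β * ω) = p i * Real.exp (β * (ω - (E j - E i))) := by
      rw [hdb j i, mul_assoc, ← Real.exp_add]; congr 2; ring
    have h2 : (p j : ℂ) * (Real.exp (β * ω) : ℂ)
        = (p i : ℂ) * (Real.exp (β * (ω - (E j - E i))) : ℂ) := by exact_mod_cast h1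
    simp only [star_mul', Complex.star_def, Complex.conj_ofReal, smul_eq_mul]
    push_cast at h2 ⊢
    linear_combination (starRingEnd ℂ) (B j i) * (filterFourier σ (ω - (E j - E i)) : ℂ) * h2
  have e1 : V * ρ * Vᴴ = Q * (v * (D * vᴴ)) * Qᴴ := by
    rw [hV, hρ]
    simp only [Matrix.conjTranspose_mul, Matrix.conjTranspose_conjTranspose, Matrix.mul_assoc]
    rw [← Matrix.mul_assoc Qᴴ Q, hQ, Matrix.one_mul, ← Matrix.mul_assoc Qᴴ Q, hQ, Matrix.one_mul]
  have e2 : V * Vᴴ * ρ = Q * (v * (vᴴ * D)) * Qᴴ := by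
    rw [hV, hρ]
    simp only [Matrix.conjTranspose_mul, Matrix.conjTranspose_conjTranspose, Matrix.mul_assoc]
    rw [← Matrix.mul_assoc Qᴴ Q, hQ, Matrix.one_mul, ← Matrix.mul_assoc Qᴴ Q, hQ, Matrix.one_mul]
  have e3 : (v * S) * (x * S)ᴴ = v * (D * xᴴ) := by
    rw [Matrix.conjTranspose_mul, ← hSS]
    simp only [Matrix.mul_assoc]
  rw [e1, e2, e3, key, Matrix.mul_sub, Matrix.mul_sub, Matrix.sub_mul, Matrix.mul_smul,
    Matrix.mul_smul, Matrix.smul_mul]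

theorem ae_abs_rate_le {g : ℝ → ℝ} (hg : IsProbDensity g) {K : ℝ}
    (hK : ∀ᵐ ω, rate g β ω ≤ K) : ∀ᵐ ω, |rate g β ω| ≤ K := by
  filter_upwards [hK] with ω h
  rwa [abs_of_nonneg (rate_nonneg hg.1 β ω)]

theorem filterFourier_sq_integral (hσ : 0 < σ) :
    Integrable (fun x => filterFourier σ x ^ 2) ∧ ∫ x, filterFourier σ x ^ 2 = 2 * Real.pi := by
  have h1 := integrable_filterFourier_mul hσ 0 0
  have h2 := integral_filterFourier_mul hσ 0 0
  simp only [sub_zero, ← sq] at h1 h2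
  refine ⟨h1, h2.trans ?_⟩
  simp

/-- Near detailed balance of the population transfer. -/
theorem traceBound_jumpOp_defect [NeZero d] (hH : H.IsHermitian)
    {g : ℝ → ℝ} (hg : IsProbDensity g) (hβ : 0 ≤ β) (hβσ : β < σ) {K : ℝ}
    (hK : ∀ᵐ ω, rate g β ω ≤ K) (A : Matrix (Fin d) (Fin d) ℂ) {l : ℝ} (hl : 0 < l) :
    TraceBound ((∫ ω, rate g β ω • (jumpOp H A σ ω * gibbs β H * (jumpOp H A σ ω)ᴴ))
        - (∫ ω, rate g β (-ω) • (jumpOp H A σ ω * (jumpOp H A σ ω)ᴴ)) * gibbs β H)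
      (K * ((l * (2 * Real.pi) + l⁻¹ * (1024 * (β / σ) ^ 2)) / 2 * ‖A‖ ^ 2)) := by
  have hσ : 0 < σ := hβ.trans_lt hβσ
  obtain ⟨Q, E, p, hQ, hQ', hHQ, hgb, hp, hs, hdb⟩ := exists_gibbs_diagonal hH β
  have hp0 : ∀ i, 0 ≤ p i := fun i => (hp i).le
  set B := Qᴴ * A * Q with hB
  have hr := integrable_rate hg.2.1 β
  have i1 := integrable_smul_jumpOp_conj hH A (gibbs β H) hσ hr
  have i2 := integrable_mul_matrix (integrable_smul_jumpOp_self_mul hH A hσ hr.comp_neg)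
    (gibbs β H)
  rw [integral_mul_matrix (integrable_smul_jumpOp_self_mul hH A hσ hr.comp_neg),
    ← integral_sub i1 i2]
  set S := Matrix.diagonal (fun i => ((√(p i) : ℝ) : ℂ)) with hS
  obtain ⟨hf1, hf2⟩ := filterFourier_sq_integral hσ
  have hd1 := integrable_filterDefect_sq hσ hβ hβσ.le
  have hd2 := integral_filterDefect_sq_le hσ hβ hβσ.le
  have ie := integrable_hsSq_specMul_diagonal E B hf1 hp0
  have ix := integrable_hsSq_specMul_diagonal E B hd1 hp0
  have ne := integral_hsSq_specMul_diagonal_le E B hf1 hp0 hs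
  have nx := integral_hsSq_specMul_diagonal_le E B hd1 hp0 hs
  rw [← hS] at ie ix ne nx
  have hK0 : 0 ≤ K := by
    obtain ⟨ω, hω⟩ := hK.exists
    exact (rate_nonneg hg.1 β ω).trans hω
  have ic : Integrable fun ω => K * ((l * hsSq (specMul E B (filterFourier σ) ω * S)
      + l⁻¹ * hsSq (specMul E B (filterDefect σ β) ω * S)) / 2) :=
    (((ie.const_mul l).add (ix.const_mul l⁻¹)).div_const 2).const_mul K
  refine (TraceBound.integral (integrable_fun_sub i1 i2) ic ?_).mono ?_
  · filter_upwards [ae_abs_rate_le hg hK] with ω hω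
    have hdet := jumpOp_detailed_balance hQ hp0 hdb B σ ω
      (jumpOp_eq_conj hH hQ hQ' hHQ A hσ ω) hgb
    have e : rate g β ω • (jumpOp H A σ ω * gibbs β H * (jumpOp H A σ ω)ᴴ)
        - rate g β (-ω) • (jumpOp H A σ ω * (jumpOp H A σ ω)ᴴ) * gibbs β H
        = rate g β ω • (jumpOp H A σ ω * gibbs β H * (jumpOp H A σ ω)ᴴ
          - (Real.exp (β * ω) : ℂ) • (jumpOp H A σ ω * (jumpOp H A σ ω)ᴴ * gibbs β H)) := by
      rw [rate_neg, smul_sub, Matrix.smul_mul, mul_smul, ofReal_smul_matrix]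
    rw [e, hdet]
    -- The square root of the Gibbs weights is placed on both factors, which makes their
    -- Hilbert–Schmidt norms dimension free.
    have ht := ((traceBound_mul_conjTranspose (specMul E B (filterFourier σ) ω * S)
      (specMul E B (filterDefect σ β) ω * S) hl).conj_unitary hQ).real_smul (rate g β ω)
    refine ht.mono (mul_le_mul_of_nonneg_right hω ?_)
    have h1 := hsSq_nonneg (specMul E B (filterFourier σ) ω * S)
    have h2 := hsSq_nonneg (specMul E B (filterDefect σ β) ω * S)
    positivity
  · rw [integral_const_mul, integral_div, integral_add (ie.const_mul l) (ix.const_mul l⁻¹),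
      integral_const_mul, integral_const_mul]
    refine mul_le_mul_of_nonneg_left ?_ hK0
    have hBA : ‖B‖ ^ 2 ≤ ‖A‖ ^ 2 := pow_le_pow_left₀ (norm_nonneg _) (norm_conj_le hQ A) 2
    have hA := sq_nonneg ‖A‖
    have n1 := ne.trans (mul_le_mul_of_nonneg_right hBA
      (integral_nonneg fun x => sq_nonneg (filterFourier σ x)))
    have n2 := nx.trans (mul_le_mul hBA hd2
      (integral_nonneg fun x => sq_nonneg (filterDefect σ β x)) hA)
    rw [hf2] at n1
    have m1 := mul_le_mul_of_nonneg_left n1 hl.le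
    have m2 := mul_le_mul_of_nonneg_left n2 (inv_pos.2 hl).le
    linarith

theorem traceBound_half_add_conjTranspose {Z : Matrix (Fin d) (Fin d) ℂ} {c : ℝ}
    (h : TraceBound Z c) : TraceBound ((1 / 2 : ℂ) • (Z + Zᴴ)) c := by
  refine ((h.add h.conjTranspose).smul (1 / 2)).mono (le_of_eq ?_)
  norm_num
  ring

/-- Gain and loss terms of one `A` do not match. Averaging over the adjoint-closed set lets the loss
term of `Aᴴ` be compared with the gain term of `A`, and then detailed balance applies. -/
theorem dissError_le_of_pos [NeZero d] (hH : H.IsHermitian)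
    {𝒜 : Finset (Matrix (Fin d) (Fin d) ℂ)} (h𝒜 : IsCouplingSet 𝒜)
    {g : ℝ → ℝ} (hg : IsProbDensity g) (hβ : 0 ≤ β) (hβσ : β < σ) {K : ℝ}
    (hK : ∀ᵐ ω, rate g β ω ≤ K) {l : ℝ} (hl : 0 < l) :
    dissError H 𝒜 g β σ ≤ K * ((l * (2 * Real.pi) + l⁻¹ * (1024 * (β / σ) ^ 2)) / 2)
      * uniformMean 𝒜 (fun A => ‖A‖ ^ 2) := by
  have hσ : 0 < σ := hβ.trans_lt hβσ
  have hr := integrable_rate hg.2.1 β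
  have hρ : (gibbs β H)ᴴ = gibbs β H := (gibbs_isState hH β).1.isHermitian
  obtain ⟨P, hP⟩ : ∃ P : Matrix (Fin d) (Fin d) ℂ → Matrix (Fin d) (Fin d) ℂ, ∀ A, P A =
    ∫ ω, rate g β ω • (jumpOp H A σ ω * gibbs β H * (jumpOp H A σ ω)ᴴ) := ⟨_, fun _ => rfl⟩
  obtain ⟨N, hN⟩ : ∃ N : Matrix (Fin d) (Fin d) ℂ → Matrix (Fin d) (Fin d) ℂ, ∀ A, N A =
    ∫ ω, rate g β ω • ((jumpOp H A σ ω)ᴴ * jumpOp H A σ ω) := ⟨_, fun _ => rfl⟩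
  have hPh : ∀ A, (P A)ᴴ = P A := fun A => by
    rw [hP, ← integral_conjTranspose]
    refine integral_congr_ae (ae_of_all _ fun ω => ?_)
    simp only [Matrix.conjTranspose_smul, Matrix.conjTranspose_mul, star_trivial,
      Matrix.conjTranspose_conjTranspose, hρ, Matrix.mul_assoc]
  have hNh : ∀ A, (N A)ᴴ = N A := fun A => by
    rw [hN, ← integral_conjTranspose]
    refine integral_congr_ae (ae_of_all _ fun ω => ?_)
    simp only [Matrix.conjTranspose_smul, Matrix.conjTranspose_mul, star_trivial,
      Matrix.conjTranspose_conjTranspose]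
  -- The anticommutator is a Hermitian part, so it suffices to bound the one-sided product with the
  -- Gibbs state.
  have hsym : uniformMean 𝒜 (fun A => ∫ ω, rate g β ω • dissipator (jumpOp H A σ ω) (gibbs β H))
      = uniformMean 𝒜 fun A => (1 / 2 : ℂ) • ((P A - N Aᴴ * gibbs β H)
        + (P A - N Aᴴ * gibbs β H)ᴴ) := by
    have h1 : ∀ A, ∫ ω, rate g β ω • dissipator (jumpOp H A σ ω) (gibbs β H)
        = P A - (1 / 2 : ℂ) • (N A * gibbs β H + gibbs β H * N A) := fun A => by
      rw [integral_smul_dissipator hH A _ hσ hr, hP, hN]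
    simp only [h1]
    have h2 := uniformMean_conjTranspose h𝒜
      fun A => (1 / 2 : ℂ) • (N A * gibbs β H + gibbs β H * N A)
    rw [uniformMean_sub, ← h2, ← uniformMean_sub]
    refine uniformMean_congr fun A _ => ?_
    rw [Matrix.conjTranspose_sub, Matrix.conjTranspose_mul, hPh, hNh, hρ]
    module
  rw [dissError, traceNorm_le_iff, hsym, ← uniformMean_mul_left]
  refine TraceBound.uniformMean fun A _ => ?_
  have ht := traceBound_jumpOp_defect hH hg hβ hβσ hK A hl
  rw [← integral_conjTranspose_mul_jumpOp hH, ← hN, ← hP] at ht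
  refine (traceBound_half_add_conjTranspose ht).mono (le_of_eq ?_)
  ring

/-- The balancing weight is `l = β / σ`, the relative size of the defect; `516` is `(2 * 4 + 1024) /
2` after bounding `π` by `4`. -/
theorem dissError_le [NeZero d] (hH : H.IsHermitian)
    {𝒜 : Finset (Matrix (Fin d) (Fin d) ℂ)} (h𝒜 : IsCouplingSet 𝒜)
    {g : ℝ → ℝ} (hg : IsProbDensity g) (hβ : 0 ≤ β) (hβσ : β < σ) {K : ℝ}
    (hK : ∀ᵐ ω, rate g β ω ≤ K) :
    dissError H 𝒜 g β σ ≤ 516 * K * (β / σ) * uniformMean 𝒜 (fun A => ‖A‖ ^ 2) := by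
  have hσ : 0 < σ := hβ.trans_lt hβσ
  have hK0 : 0 ≤ K := by
    obtain ⟨ω, hω⟩ := hK.exists
    exact (rate_nonneg hg.1 β ω).trans hω
  have hm : 0 ≤ uniformMean 𝒜 (fun A => ‖A‖ ^ 2) := uniformMean_nonneg fun A _ => sq_nonneg _
  have hpi := Real.pi_lt_four
  rcases hβ.eq_or_lt with h0 | h0
  · subst h0
    -- At `β = 0` the choice `l = β / σ` is not positive, so `l` is sent to zero instead.
    have key : ∀ l : ℝ, 0 < l → dissError H 𝒜 g 0 σ
        ≤ l * (K * Real.pi * uniformMean 𝒜 (fun A => ‖A‖ ^ 2)) := fun l hl => by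
      refine (dissError_le_of_pos hH h𝒜 hg le_rfl hβσ hK hl).trans (le_of_eq ?_)
      simp only [zero_div]; ring
    simp only [zero_div, mul_zero, zero_mul]
    have hlim : Filter.Tendsto (fun l : ℝ => l * (K * Real.pi *
        uniformMean 𝒜 (fun A => ‖A‖ ^ 2))) (nhdsWithin 0 (Set.Ioi 0)) (nhds 0) := by
      have : Filter.Tendsto (fun l : ℝ => l * (K * Real.pi *
        uniformMean 𝒜 (fun A => ‖A‖ ^ 2))) (nhds 0) (nhds (0 * _)) :=
        Filter.tendsto_id.mul_const _
      rw [zero_mul] at this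
      exact this.mono_left nhdsWithin_le_nhds
    exact ge_of_tendsto hlim (Filter.eventually_of_mem self_mem_nhdsWithin key)
  · have hl : 0 < β / σ := by positivity
    refine (dissError_le_of_pos hH h𝒜 hg hβ hβσ hK hl).trans
      (mul_le_mul_of_nonneg_right ?_ hm)
    have e : (β / σ)⁻¹ * (1024 * (β / σ) ^ 2) = 1024 * (β / σ) := by field_simp
    rw [e]
    have : K * (β / σ) * Real.pi ≤ K * (β / σ) * 4 :=
      mul_le_mul_of_nonneg_left hpi.le (by positivity)
    linarith

end DissipatorBound

/-! ### A bound on the dissipator that needs no relation between β and σ -/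

section DissipatorCrudeBound

variable {d : ℕ} {H : Matrix (Fin d) (Fin d) ℂ} {σ β : ℝ}

theorem hsSq_diagonal_sqrt {p : Fin d → ℝ} (hp : ∀ i, 0 ≤ p i) :
    hsSq (Matrix.diagonal fun i => ((√(p i) : ℝ) : ℂ)) = ∑ i, p i := by
  unfold hsSq
  refine Finset.sum_congr rfl fun i _ => ?_
  rw [Finset.sum_eq_single i (fun j _ hj => by rw [Matrix.diagonal_apply_ne _ hj.symm]; simp)
    (fun h => absurd (Finset.mem_univ i) h), Matrix.diagonal_apply_eq, Complex.norm_real,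
    Real.norm_eq_abs, sq_abs, Real.sq_sqrt (hp i)]

theorem diagonal_sqrt_mul_conjTranspose {p : Fin d → ℝ} (hp : ∀ i, 0 ≤ p i) :
    (Matrix.diagonal fun i => ((√(p i) : ℝ) : ℂ)) *
      (Matrix.diagonal fun i => ((√(p i) : ℝ) : ℂ))ᴴ = Matrix.diagonal fun i => (p i : ℂ) := by
  rw [Matrix.diagonal_conjTranspose, Matrix.diagonal_mul_diagonal]
  congr 1
  funext i
  rw [Pi.star_apply, Complex.star_def, Complex.conj_ofReal, ← Complex.ofReal_mul,
    Real.mul_self_sqrt (hp i)]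

/-- Parseval bounds the gain term and each one-sided loss term by `2π * K * ‖A‖ ^ 2` separately,
`4π` in total after the factor `1 / 2`. No detailed balance is involved. -/
theorem traceBound_dissipator_jumpOp [NeZero d] (hH : H.IsHermitian) {g : ℝ → ℝ}
    (hg : IsProbDensity g) (hσ : 0 < σ) {K : ℝ} (hK : ∀ᵐ ω, rate g β ω ≤ K)
    (A : Matrix (Fin d) (Fin d) ℂ) :
    TraceBound (∫ ω, rate g β ω • dissipator (jumpOp H A σ ω) (gibbs β H))
      (16 * K * ‖A‖ ^ 2) := by
  obtain ⟨Q, E, p, hQ, hQ', hHQ, hgb, hp, hs, -⟩ := exists_gibbs_diagonal hH β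
  have hp0 : ∀ i, 0 ≤ p i := fun i => (hp i).le
  set B := Qᴴ * A * Q with hB
  have hr := integrable_rate hg.2.1 β
  have hK0 : 0 ≤ K := by
    obtain ⟨ω, hω⟩ := hK.exists
    exact (rate_nonneg hg.1 β ω).trans hω
  have hBA : ‖B‖ ^ 2 ≤ ‖A‖ ^ 2 := pow_le_pow_left₀ (norm_nonneg _) (norm_conj_le hQ A) 2
  set S := Matrix.diagonal (fun i => ((√(p i) : ℝ) : ℂ)) with hS
  have hSS := diagonal_sqrt_mul_conjTranspose hp0
  rw [← hS] at hSS
  have hS1 : hsSq S = 1 := (hsSq_diagonal_sqrt hp0).trans hs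
  set v := fun ω => specMul E B (filterFourier σ) ω with hv
  have hV : ∀ ω, jumpOp H A σ ω = Q * v ω * Qᴴ := fun ω => jumpOp_eq_conj hH hQ hQ' hHQ A hσ ω
  have hpi := Real.pi_lt_four
  have hint : ∀ Z : Matrix (Fin d) (Fin d) ℂ, hsSq Z ≤ 1 →
      ∫ ω, hsSq (v ω * Z) ≤ 2 * Real.pi * ‖A‖ ^ 2 := fun Z hZ => by
    refine (integral_hsSq_specMul_mul_le E B Z hσ).trans ?_
    refine mul_le_mul_of_nonneg_left ?_ (by positivity)
    have := mul_le_mul hBA hZ (hsSq_nonneg Z) (sq_nonneg ‖A‖)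
    rwa [mul_one] at this
  have hii : ∀ Z : Matrix (Fin d) (Fin d) ℂ, Integrable fun ω => hsSq (v ω * Z) :=
    fun Z => integrable_hsSq_specMul_mul E B Z hσ
  have hP : TraceBound (∫ ω, rate g β ω • (jumpOp H A σ ω * gibbs β H * (jumpOp H A σ ω)ᴴ))
      (K * (2 * Real.pi * ‖A‖ ^ 2)) := by
    refine (TraceBound.integral (integrable_smul_jumpOp_conj hH A (gibbs β H) hσ hr)
      ((hii S).const_mul K) ?_).mono ?_
    · filter_upwards [ae_abs_rate_le hg hK] with ω hω
      have e : jumpOp H A σ ω * gibbs β H * (jumpOp H A σ ω)ᴴ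
          = Q * ((v ω * S) * (v ω * S)ᴴ) * Qᴴ := by
        rw [hV, hgb, ← hSS]
        simp only [Matrix.conjTranspose_mul, Matrix.conjTranspose_conjTranspose, Matrix.mul_assoc]
        rw [← Matrix.mul_assoc Qᴴ Q, hQ, Matrix.one_mul, ← Matrix.mul_assoc Qᴴ Q, hQ,
          Matrix.one_mul]
      rw [e]
      refine (((traceBound_mul_conjTranspose (v ω * S) (v ω * S) one_pos).conj_unitary
        hQ).real_smul (rate g β ω)).mono ?_
      have h1 := hsSq_nonneg (v ω * S)
      have e2 : (1 * hsSq (v ω * S) + (1 : ℝ)⁻¹ * hsSq (v ω * S)) / 2 = hsSq (v ω * S) := by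
        rw [inv_one]; ring
      rw [e2]
      exact mul_le_mul_of_nonneg_right hω h1
    · rw [integral_const_mul]
      exact mul_le_mul_of_nonneg_left (hint S hS1.le) hK0
  have hN : TraceBound ((∫ ω, rate g β ω • ((jumpOp H A σ ω)ᴴ * jumpOp H A σ ω)) * gibbs β H)
      (K * (2 * Real.pi * ‖A‖ ^ 2)) := fun W hW => by
    -- The test matrix sits between the Gibbs state and the jump operators and cannot be discarded;
    -- it is absorbed into a non-diagonal factor of Hilbert–Schmidt norm at most 1.
    set W' := Qᴴ * W * Q with hW'
    have hW'1 : ‖W'‖ ≤ 1 := (norm_conj_le hQ W).trans hW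
    have hZ : hsSq (W'ᴴ * S) ≤ 1 := by
      refine (hsSq_mul_le _ _).trans ?_
      rw [hS1, mul_one, Matrix.l2_opNorm_conjTranspose]
      exact pow_le_one₀ (norm_nonneg _) hW'1
    have i0 := integrable_smul_jumpOp_conjTranspose_mul hH A hσ hr
    rw [integral_mul_matrix i0, trace_mul_integral (integrable_mul_matrix i0 _)]
    have ic : Integrable fun ω => K * ((hsSq (v ω * S) + hsSq (v ω * (W'ᴴ * S))) / 2) :=
      (((hii S).add (hii (W'ᴴ * S))).div_const 2).const_mul K
    refine (norm_integral_le_of_norm_le ic ?_).trans ?_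
    · filter_upwards [ae_abs_rate_le hg hK] with ω hω
      have e : (W * (rate g β ω • ((jumpOp H A σ ω)ᴴ * jumpOp H A σ ω) * gibbs β H)).trace
          = rate g β ω • ((v ω * S) * (v ω * (W'ᴴ * S))ᴴ).trace := by
        rw [Matrix.smul_mul, Matrix.mul_smul, Matrix.trace_smul, hV, hgb, ← hSS]
        congr 1
        have e1 : W * ((Q * v ω * Qᴴ)ᴴ * (Q * v ω * Qᴴ) * (Q * (S * Sᴴ) * Qᴴ))
            = (W * (Q * ((v ω)ᴴ * (v ω * (S * Sᴴ))))) * Qᴴ := by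
          simp only [Matrix.conjTranspose_mul, Matrix.conjTranspose_conjTranspose,
            Matrix.mul_assoc]
          rw [← Matrix.mul_assoc Qᴴ Q, hQ, Matrix.one_mul, ← Matrix.mul_assoc Qᴴ Q, hQ,
            Matrix.one_mul]
        have e2 : Qᴴ * (W * (Q * ((v ω)ᴴ * (v ω * (S * Sᴴ)))))
            = (W' * (v ω)ᴴ) * ((v ω * S) * Sᴴ) := by
          simp only [hW', Matrix.mul_assoc]
        rw [e1, Matrix.trace_mul_comm, e2, Matrix.trace_mul_comm]
        simp only [Matrix.conjTranspose_mul, Matrix.conjTranspose_conjTranspose, Matrix.mul_assoc]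
      rw [e, norm_smul, Real.norm_eq_abs]
      have h1 := norm_trace_mul_conjTranspose_le (v ω * S) (v ω * (W'ᴴ * S)) one_pos
      rw [one_mul, inv_one, one_mul] at h1
      exact mul_le_mul hω h1 (norm_nonneg _) hK0
    · rw [integral_const_mul, integral_div, integral_add (hii S) (hii _)]
      refine mul_le_mul_of_nonneg_left ?_ hK0
      have h1 := hint S hS1.le
      have h2 := hint _ hZ
      linarith
  have hN' : TraceBound (gibbs β H * ∫ ω, rate g β ω • ((jumpOp H A σ ω)ᴴ * jumpOp H A σ ω))
      (K * (2 * Real.pi * ‖A‖ ^ 2)) := by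
    have h := hN.conjTranspose
    have e : (∫ ω, rate g β ω • ((jumpOp H A σ ω)ᴴ * jumpOp H A σ ω))ᴴ
        = ∫ ω, rate g β ω • ((jumpOp H A σ ω)ᴴ * jumpOp H A σ ω) := by
      rw [← integral_conjTranspose]
      refine integral_congr_ae (ae_of_all _ fun ω => ?_)
      simp only [Matrix.conjTranspose_smul, Matrix.conjTranspose_mul, star_trivial,
        Matrix.conjTranspose_conjTranspose]
    have hρ : (gibbs β H)ᴴ = gibbs β H := (gibbs_isState hH β).1.isHermitian
    rwa [Matrix.conjTranspose_mul, hρ, e] at h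
  rw [integral_smul_dissipator hH A _ hσ hr]
  refine (hP.sub ((hN.add hN').smul (1 / 2))).mono ?_
  have hh : ‖(1 / 2 : ℂ)‖ = 1 / 2 := by norm_num
  rw [hh]
  have := mul_le_mul_of_nonneg_left hpi.le (by positivity : 0 ≤ K * ‖A‖ ^ 2)
  linarith

theorem dissError_le_crude [NeZero d] (hH : H.IsHermitian)
    {𝒜 : Finset (Matrix (Fin d) (Fin d) ℂ)} {g : ℝ → ℝ} (hg : IsProbDensity g) (hσ : 0 < σ)
    {K : ℝ} (hK : ∀ᵐ ω, rate g β ω ≤ K) :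
    dissError H 𝒜 g β σ ≤ 16 * K * uniformMean 𝒜 (fun A => ‖A‖ ^ 2) := by
  rw [dissError, traceNorm_le_iff, ← uniformMean_mul_left]
  exact TraceBound.uniformMean fun A _ => traceBound_dissipator_jumpOp hH hg hσ hK A

end DissipatorCrudeBound

/-! ### From one step to the fixed point -/

section Iteration

variable {d : ℕ} {H : Matrix (Fin d) (Fin d) ℂ} {𝒜 : Finset (Matrix (Fin d) (Fin d) ℂ)}
  {g : ℝ → ℝ} {β σ T α : ℝ}

theorem traceNorm_channel_iterate_sub_le (hH : H.IsHermitian) (hσ : 0 < σ) (h𝒜 : 𝒜.Nonempty)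
    (hg : IsProbDensity g) (n : ℕ) (X Y : Matrix (Fin d) (Fin d) ℂ) :
    traceNorm ((channel H 𝒜 g β σ T α)^[n] X - (channel H 𝒜 g β σ T α)^[n] Y)
      ≤ traceNorm (X - Y) := by
  induction n generalizing X Y with
  | zero => exact le_rfl
  | succ n ih =>
    rw [Function.iterate_succ_apply, Function.iterate_succ_apply]
    refine (ih _ _).trans ?_
    rw [← channel_sub hH hσ hg.2.1, traceNorm_le_iff]
    exact TraceBound.channel hH hσ h𝒜 hg (traceBound_traceNorm _)

/-- Telescoping: each further step is the image of the first displacement under a contraction. -/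
theorem traceNorm_channel_iterate_sub_self_le (hH : H.IsHermitian) (hσ : 0 < σ)
    (h𝒜 : 𝒜.Nonempty) (hg : IsProbDensity g) (n : ℕ) (X : Matrix (Fin d) (Fin d) ℂ) :
    traceNorm ((channel H 𝒜 g β σ T α)^[n] X - X)
      ≤ n * traceNorm (channel H 𝒜 g β σ T α X - X) := by
  induction n with
  | zero =>
    simp only [Function.iterate_zero, id, sub_self, Nat.cast_zero, zero_mul]
    exact traceNorm_le_iff.2 TraceBound.zero
  | succ n ih =>
    rw [Function.iterate_succ_apply, ← sub_add_sub_cancel _ ((channel H 𝒜 g β σ T α)^[n] X) X]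
    refine (traceNorm_add_le _ _).trans ((add_le_add
      (traceNorm_channel_iterate_sub_le hH hσ h𝒜 hg n _ _) ih).trans (le_of_eq ?_))
    push_cast; ring

theorem channel_iterate_sub_eq_smul (hH : H.IsHermitian) (hσ : 0 < σ) (hg : IsProbDensity g)
    (n : ℕ) {X Y Z W : Matrix (Fin d) (Fin d) ℂ} {c : ℂ} (h : X - Y = c • (Z - W)) :
    (channel H 𝒜 g β σ T α)^[n] X - (channel H 𝒜 g β σ T α)^[n] Y
      = c • ((channel H 𝒜 g β σ T α)^[n] Z - (channel H 𝒜 g β σ T α)^[n] W) := by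
  induction n generalizing X Y Z W with
  | zero => exact h
  | succ n ih =>
    simp only [Function.iterate_succ_apply]
    refine ih ?_
    rw [← channel_sub hH hσ hg.2.1, h, channel_smul, channel_sub hH hσ hg.2.1]

/-- In dimension 0 the trace cannot be 1. This supplies the nonzero dimension under which the Gibbs
state is normalised. -/
theorem IsState.neZero {ρ : Matrix (Fin d) (Fin d) ℂ} (h : IsState ρ) : NeZero d := by
  refine ⟨fun h0 => ?_⟩
  subst h0
  have := h.2
  simp [Matrix.trace] at this

theorem isMixedAt_mixingTime {Φ : Matrix (Fin d) (Fin d) ℂ → Matrix (Fin d) (Fin d) ℂ}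
    {ρfix : Matrix (Fin d) (Fin d) ℂ} {ε : ℝ} (h : ∃ t, IsMixedAt Φ ρfix ε t) :
    IsMixedAt Φ ρfix ε (mixingTime Φ ρfix ε) :=
  Nat.sInf_mem (s := {t : ℕ | IsMixedAt Φ ρfix ε t}) h

theorem traceNorm_channel_gibbs_sub_le [NeZero d] (hH : H.IsHermitian) (h𝒜 : IsCouplingSet 𝒜)
    (hg : IsProbDensity g) (hσ : 0 < σ) (hT : 0 < T) (hα : 0 < α) (n : ℕ) :
    traceNorm ((channel H 𝒜 g β σ T α)^[n] (gibbs β H) - gibbs β H)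
      ≤ (lambError H 𝒜 g β σ + dissError H 𝒜 g β σ + 4096 * truncError 𝒜 σ T α)
        * (α ^ 2 * n) := by
  refine (traceNorm_channel_iterate_sub_self_le hH hσ h𝒜.1 hg n _).trans ?_
  have h := traceNorm_le_iff.2 (traceBound_channel_gibbs_sub hH h𝒜 hg hσ hT hα.le β)
  refine (mul_le_mul_of_nonneg_left h n.cast_nonneg).trans (le_of_eq ?_)
  ring

/-- After `n` steps the orbit of the Gibbs state is close both to its start and to `ρfix`. -/
theorem traceNorm_fixed_sub_gibbs_le [NeZero d] (hH : H.IsHermitian) (h𝒜 : IsCouplingSet 𝒜)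
    (hg : IsProbDensity g) (hσ : 0 < σ) (hT : 0 < T) (hα : 0 < α) {ε : ℝ} {n : ℕ}
    {ρfix : Matrix (Fin d) (Fin d) ℂ} (hmix : IsMixedAt (channel H 𝒜 g β σ T α) ρfix ε n) :
    traceNorm (ρfix - gibbs β H)
      ≤ (lambError H 𝒜 g β σ + dissError H 𝒜 g β σ + 4096 * truncError 𝒜 σ T α)
        * (α ^ 2 * n) + ε := by
  have h1 := traceNorm_channel_gibbs_sub_le (β := β) hH h𝒜 hg hσ hT hα n
  have h2 := hmix _ (gibbs_isState hH β)
  rw [traceNorm_sub_comm] at h2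
  rw [← sub_add_sub_cancel _ ((channel H 𝒜 g β σ T α)^[n] (gibbs β H)) (gibbs β H)]
  refine (traceNorm_add_le _ _).trans ?_
  linarith

/-- Mixing to `1/2` acts as a contraction by `1/2` on traceless Hermitian matrices. The distance is
then at most half of itself plus the drift, and the half can be absorbed. -/
theorem traceNorm_fixed_sub_gibbs_le_two_mul [NeZero d] (hH : H.IsHermitian)
    (h𝒜 : IsCouplingSet 𝒜) (hg : IsProbDensity g) (hσ : 0 < σ) (hT : 0 < T) (hα : 0 < α)
    {ε : ℝ} (hε : ε ≤ 1 / 2) {n : ℕ} {ρfix : Matrix (Fin d) (Fin d) ℂ} (hst : IsState ρfix)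
    (hfix : channel H 𝒜 g β σ T α ρfix = ρfix)
    (hmix : IsMixedAt (channel H 𝒜 g β σ T α) ρfix ε n) :
    traceNorm (ρfix - gibbs β H)
      ≤ 2 * ((lambError H 𝒜 g β σ + dissError H 𝒜 g β σ + 4096 * truncError 𝒜 σ T α)
        * (α ^ 2 * n)) := by
  have hgs := gibbs_isState hH β
  have h1 := traceNorm_channel_gibbs_sub_le (β := β) hH h𝒜 hg hσ hT hα n
  obtain ⟨ρ₁, ρ₂, c, hρ₁, hρ₂, hc, hcn, hX⟩ := exists_states_of_traceless
    (X := ρfix - gibbs β H) (hst.1.isHermitian.sub hgs.1.isHermitian)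
    (by rw [Matrix.trace_sub, hst.2, hgs.2, sub_self])
  have h2 := channel_iterate_sub_eq_smul (𝒜 := 𝒜) (β := β) (T := T) (α := α) hH hσ hg n hX
  rw [Function.iterate_fixed hfix] at h2
  have h3 : traceNorm (ρfix - (channel H 𝒜 g β σ T α)^[n] (gibbs β H)) ≤ c * (ε + ε) := by
    rw [h2, traceNorm_le_iff]
    have h4 := (traceNorm_le_iff.1 (hmix _ hρ₁)).sub (traceNorm_le_iff.1 (hmix _ hρ₂))
    rw [sub_sub_sub_cancel_right] at h4
    refine (h4.smul (c : ℂ)).mono (le_of_eq ?_)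
    rw [Complex.norm_real, Real.norm_of_nonneg hc]
  -- Uses `2 * c ≤ traceNorm (ρfix - gibbs β H)` and `ε ≤ 1 / 2`.
  have h5 : c * (ε + ε) ≤ traceNorm (ρfix - gibbs β H) / 2 := by
    have := mul_le_mul_of_nonneg_left hε hc
    linarith
  have h6 := traceNorm_add_le (ρfix - (channel H 𝒜 g β σ T α)^[n] (gibbs β H))
    ((channel H 𝒜 g β σ T α)^[n] (gibbs β H) - gibbs β H)
  rw [sub_add_sub_cancel] at h6
  linarith

end Iteration

/-! ### The error bound for a general density -/

section GeneralDensity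

variable {d : ℕ} {H : Matrix (Fin d) (Fin d) ℂ} {𝒜 : Finset (Matrix (Fin d) (Fin d) ℂ)}
  {g : ℝ → ℝ} {β σ T α : ℝ}

theorem lambR_nonneg (g : ℝ → ℝ) (β σ : ℝ) : 0 ≤ lambR g β σ :=
  integral_nonneg fun _ => by positivity

/-- Finiteness of the norm is essential here: `toReal` would send an infinite norm to 0. -/
theorem rate_le_eLpNorm (h : MemLp (rate g β) ⊤ volume) :
    ∀ᵐ ω, rate g β ω ≤ (eLpNorm (rate g β) ⊤ volume).toReal := by
  filter_upwards [ae_le_eLpNormEssSup (f := rate g β) (μ := volume)] with ω hω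
  rw [← eLpNorm_exponent_top] at hω
  have h1 := ENNReal.toReal_mono h.2.ne hω
  rw [toReal_enorm] at h1
  exact (Real.le_norm_self _).trans h1

theorem lambError_add_dissError_le [NeZero d] (hH : H.IsHermitian) (h𝒜 : IsCouplingSet 𝒜)
    (hg : IsProbDensity g) (hβ : 0 ≤ β) (hβσ : β < σ) (h : MemLp (rate g β) ⊤ volume) :
    lambError H 𝒜 g β σ + dissError H 𝒜 g β σ ≤ 516 * gibbsBound 𝒜 g β σ := by
  have hσ : 0 < σ := hβ.trans_lt hβσ
  have h1 := lambError_le (𝒜 := 𝒜) hH hg.2.1 hβ hσ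
  have h2 := dissError_le hH h𝒜 hg hβ hβσ (rate_le_eLpNorm h)
  unfold gibbsBound
  set m := uniformMean 𝒜 (fun A => ‖A‖ ^ 2) with hm
  have hm0 : 0 ≤ m := uniformMean_nonneg fun A _ => by positivity
  set K := (eLpNorm (rate g β) ⊤ volume).toReal with hK
  have hK0 : 0 ≤ K := ENNReal.toReal_nonneg
  have hR := lambR_nonneg g β σ
  rcases hβ.eq_or_lt with h0 | h0
  · rw [← h0] at h1 h2 ⊢
    simp only [mul_zero, zero_mul, zero_div] at h1 h2 ⊢
    linarith
  -- The bounds already proved have no logarithm; for `β < σ` the stated factor can only enlarge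
  -- them.
  · have hs : 1 ≤ √(1 + Real.log (σ / β)) := by
      rw [Real.one_le_sqrt]
      have : 0 ≤ Real.log (σ / β) := Real.log_nonneg ((one_le_div h0).2 hβσ.le)
      linarith
    have h3 : K * (1 / σ) * 1 * β * m ≤ K * (1 / σ) * √(1 + Real.log (σ / β)) * β * m := by
      gcongr
    have h4 : 516 * K * (β / σ) * m = 516 * (K * (1 / σ) * 1 * β * m) := by ring
    have h5 : 0 ≤ β * lambR g β σ * m := by positivity
    rw [h4] at h2
    linarith

end GeneralDensity

/-! ### The uniform density: rate and Fourier decay -/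

section UniformDensity

variable {β σ w : ℝ}

theorem isProbDensity_uniformDensity (hw : 0 < w) : IsProbDensity (uniformDensity w) := by
  refine ⟨fun ω => Set.indicator_nonneg (fun _ _ => by positivity) ω, ?_, ?_⟩
  · exact (integrable_indicator_iff measurableSet_Icc).2 (by simp)
  · rw [uniformDensity, integral_indicator measurableSet_Icc, setIntegral_const]
    simp [hw.le, hw.ne']

/-- For `ω ≠ 0` at most one of the two densities is nonzero; at `ω = 0` the numerator can double,
but the denominator equals 2. -/
theorem rate_uniformDensity_le (hw : 0 < w) (β ω : ℝ) :
    rate (uniformDensity w) β ω ≤ w⁻¹ := by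
  have hexp := Real.exp_pos (β * ω)
  rw [rate, div_le_iff₀ (by positivity)]
  have hwi : 0 < w⁻¹ := by positivity
  have hle : ∀ x, uniformDensity w x ≤ w⁻¹ := fun x =>
    Set.indicator_le_self' (fun _ _ => hwi.le) x
  have hz : ∀ x, x < 0 → uniformDensity w x = 0 := fun x hx =>
    Set.indicator_of_notMem (fun h => absurd h.1 (not_le.2 hx)) _
  have hpos : 0 ≤ w⁻¹ * Real.exp (β * ω) := by positivity
  rcases lt_trichotomy ω 0 with h | h | h
  · have := hz ω h; have := hle (-ω); linarith
  · subst h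
    have := hle 0
    simp only [neg_zero, mul_zero, Real.exp_zero]
    linarith
  · have := hz (-ω) (by linarith); have := hle ω; linarith

theorem hasDerivAt_bathPop (β ω : ℝ) : HasDerivAt (bathPop β)
    (-(β * Real.exp (β * ω) / (1 + Real.exp (β * ω)) ^ 2)) ω := by
  have h1 : HasDerivAt (fun ω => Real.exp (β * ω)) (Real.exp (β * ω) * β) ω := by
    simpa using ((hasDerivAt_id ω).const_mul β).exp
  have h2 := (h1.const_add 1).fun_inv (by positivity)
  refine h2.congr_deriv ?_
  ring

/-- Integration by parts. Since `bathPop` decreases in `ω`, its total variation telescopes with the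
boundary terms to `2 * bathPop β (-w) ≤ 2`, uniformly in `β` and `w`. -/
theorem norm_integral_bathPop_exp_le (hw : 0 < w) (hβ : 0 ≤ β) {q : ℝ} (hq : 0 < q) :
    ‖∫ ω in (-w)..w, (bathPop β ω : ℂ) * Complex.exp (Complex.I * ((ω * q : ℝ) : ℂ))‖
      ≤ 2 / q := by
  have hIq : Complex.I * (q : ℂ) ≠ 0 :=
    mul_ne_zero Complex.I_ne_zero (by exact_mod_cast hq.ne')
  set n' : ℝ → ℝ := fun ω => -(β * Real.exp (β * ω) / (1 + Real.exp (β * ω)) ^ 2) with hn'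
  set v : ℝ → ℂ := fun ω => Complex.exp (Complex.I * ((ω * q : ℝ) : ℂ)) / (Complex.I * q) with hv
  have hvn : ∀ ω, ‖v ω‖ = 1 / q := fun ω => by
    rw [hv]; simp only
    rw [norm_div, norm_exp_I_mul, norm_mul, Complex.norm_I, one_mul, Complex.norm_real,
      Real.norm_of_nonneg hq.le]
  have hu : ∀ ω, HasDerivAt (fun ω => (bathPop β ω : ℂ)) (n' ω : ℂ) ω := fun ω =>
    (hasDerivAt_bathPop β ω).ofReal_comp
  have hvd : ∀ ω, HasDerivAt v (Complex.exp (Complex.I * ((ω * q : ℝ) : ℂ))) ω := fun ω => by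
    have h1 : HasDerivAt (fun ω : ℝ => Complex.I * ((ω * q : ℝ) : ℂ)) (Complex.I * q) ω := by
      have h2 : HasDerivAt (fun ω : ℝ => ω * q) q ω := by
        simpa using (hasDerivAt_id ω).mul_const q
      exact h2.ofReal_comp.const_mul Complex.I
    refine (h1.cexp.div_const (Complex.I * q)).congr_deriv ?_
    field_simp
  have hpos : ∀ ω : ℝ, 0 < 1 + Real.exp (β * ω) := fun ω => by positivity
  have cn' : Continuous n' := by
    rw [hn']
    exact (Continuous.div (by fun_prop) (by fun_prop) fun ω => (pow_pos (hpos ω) 2).ne').neg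
  have cn'' : Continuous fun ω => (n' ω : ℂ) := by fun_prop
  have hn'0 : ∀ ω, n' ω ≤ 0 := fun ω => by
    rw [hn']; simp only; rw [neg_nonpos]; positivity
  rw [intervalIntegral.integral_mul_deriv_eq_deriv_mul (fun ω _ => hu ω) (fun ω _ => hvd ω)
    (cn''.intervalIntegrable _ _)
    (Continuous.intervalIntegrable (by fun_prop) _ _)]
  have hle : -w ≤ w := by linarith
  have h1 : ‖∫ ω in (-w)..w, (n' ω : ℂ) * v ω‖ ≤ ∫ ω in (-w)..w, -n' ω * (1 / q) := by
    refine intervalIntegral.norm_integral_le_of_norm_le hle (ae_of_all _ fun ω _ => ?_)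
      (Continuous.intervalIntegrable (by fun_prop) _ _)
    rw [norm_mul, hvn, Complex.norm_real, Real.norm_of_nonpos (hn'0 ω)]
  have h2 : ∫ ω in (-w)..w, -n' ω * (1 / q) = (bathPop β (-w) - bathPop β w) * (1 / q) := by
    rw [intervalIntegral.integral_mul_const, intervalIntegral.integral_neg,
      intervalIntegral.integral_eq_sub_of_hasDerivAt (fun ω _ => hasDerivAt_bathPop β ω)
        (cn'.intervalIntegrable _ _)]
    ring
  have h3 : ‖(bathPop β w : ℂ) * v w‖ = bathPop β w * (1 / q) := by
    rw [norm_mul, hvn, Complex.norm_real, Real.norm_of_nonneg (bathPop_nonneg β w)]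
  have h4 : ‖(bathPop β (-w) : ℂ) * v (-w)‖ = bathPop β (-w) * (1 / q) := by
    rw [norm_mul, hvn, Complex.norm_real, Real.norm_of_nonneg (bathPop_nonneg β (-w))]
  refine (norm_sub_le _ _).trans ((add_le_add (norm_sub_le _ _) h1).trans ?_)
  rw [h2, h3, h4]
  have h5 := mul_le_mul_of_nonneg_right (bathPop_le_one β (-w)) (by positivity : 0 ≤ 1 / q)
  have h6 : 2 / q = 2 * (1 * (1 / q)) := by ring
  rw [h6]
  linarith

theorem fourier_rate_uniformDensity (hw : 0 < w) (β q : ℝ) :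
    ∫ ω, (rate (uniformDensity w) β ω : ℂ) * Complex.exp (Complex.I * ((ω * q : ℝ) : ℂ))
      = (w⁻¹ : ℂ) * ∫ ω in (-w)..w,
        (bathPop β ω : ℂ) * Complex.exp (Complex.I * ((ω * q : ℝ) : ℂ)) := by
  rw [intervalIntegral.integral_of_le (by linarith), ← integral_Icc_eq_integral_Ioc,
    ← integral_indicator measurableSet_Icc, ← integral_const_mul]
  refine integral_congr_ae ?_
  -- At `ω = 0` both indicator functions contribute, so the origin is removed as a null set.
  filter_upwards [compl_mem_ae_iff.2 (measure_singleton (0 : ℝ))] with ω hω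
  have hω0 : ω ≠ 0 := hω
  have key : uniformDensity w (-ω) + uniformDensity w ω
      = (Set.Icc (-w) w).indicator (fun _ => w⁻¹) ω := by
    simp only [uniformDensity, Set.indicator, Set.mem_Icc]
    rcases lt_or_gt_of_ne hω0 with h | h
    · rw [if_neg (by intro h'; linarith [h'.1] : ¬(0 ≤ ω ∧ ω ≤ w)), add_zero]
      refine if_congr ⟨fun h' => ⟨by linarith [h'.2], by linarith⟩,
        fun h' => ⟨by linarith, by linarith [h'.1]⟩⟩ rfl rfl
    · rw [if_neg (by intro h'; linarith [h'.1] : ¬(0 ≤ -ω ∧ -ω ≤ w)), zero_add]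
      refine if_congr ⟨fun h' => ⟨by linarith, h'.2⟩, fun h' => ⟨h.le, h'.2⟩⟩ rfl rfl
  rw [rate_eq, ← mul_add, key]
  by_cases h : ω ∈ Set.Icc (-w) w
  · rw [Set.indicator_of_mem h, Set.indicator_of_mem h]
    push_cast; ring
  · rw [Set.indicator_of_notMem h, Set.indicator_of_notMem h]
    simp

theorem norm_fourier_rate_uniformDensity_le (hw : 0 < w) (hβ : 0 ≤ β) {q : ℝ} (hq : 0 < q) :
    ‖∫ ω, (rate (uniformDensity w) β ω : ℂ) * Complex.exp (Complex.I * ((ω * q : ℝ) : ℂ))‖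
      ≤ 4 / (1 + w * q) := by
  rw [fourier_rate_uniformDensity hw, norm_mul, norm_inv, Complex.norm_real,
    Real.norm_of_nonneg hw.le]
  set J := ‖∫ ω in (-w)..w, (bathPop β ω : ℂ) * Complex.exp (Complex.I * ((ω * q : ℝ) : ℂ))‖
    with hJ
  have h1 : J ≤ 2 / q := norm_integral_bathPop_exp_le hw hβ hq
  have h2 : J ≤ 1 * |w - -w| := by
    refine intervalIntegral.norm_integral_le_of_norm_le_const fun ω _ => ?_
    rw [norm_mul, norm_exp_I_mul, mul_one, Complex.norm_real,
      Real.norm_of_nonneg (bathPop_nonneg β ω)]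
    exact bathPop_le_one β ω
  rw [sub_neg_eq_add, abs_of_nonneg (by linarith), one_mul] at h2
  have h3 : J * q ≤ 2 := (le_div_iff₀ hq).1 h1
  rw [le_div_iff₀ (by positivity)]
  have h4 : w⁻¹ * J * (1 + w * q) = w⁻¹ * J + J * q := by field_simp
  have h5 : w⁻¹ * J ≤ w⁻¹ * (w + w) := mul_le_mul_of_nonneg_left h2 (by positivity)
  have h6 : w⁻¹ * (w + w) = 2 := by field_simp; ring
  linarith

/-- With `L = w * σ`, the transform is at most `4 / (1 + L * q)`. Integrating this over `q ≤ 1`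
yields the logarithm; for `q > 1` it is at most `4 / L` and the Gaussian weight integrates to at
most 3. -/
theorem lambR_uniformDensity_le (hw : 0 < w) (hβ : 0 ≤ β) (hσ : 0 < σ) :
    lambR (uniformDensity w) β σ ≤ 4 / (w * σ) * (3 + Real.log (1 + w * σ)) := by
  set L := w * σ with hL
  have hL0 : 0 < L := by positivity
  have ie : Integrable fun q : ℝ => Real.exp (-q ^ 2 / 8) := by
    have := integrable_exp_eight (σ := 1) one_pos
    simpa using this
  have he : ∫ q in Set.Ioi (0 : ℝ), Real.exp (-q ^ 2 / 8) ≤ 3 := by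
    have h := integral_gaussian_Ioi (1 / 8)
    have e : ∀ q : ℝ, Real.exp (-(1 / 8) * q ^ 2) = Real.exp (-q ^ 2 / 8) := fun q => by
      congr 1; ring
    simp only [e] at h
    rw [h]
    have : √(Real.pi / (1 / 8)) ≤ 6 := by
      rw [Real.sqrt_le_left (by norm_num)]
      nlinarith [Real.pi_lt_four]
    linarith
  have c1 : ContinuousOn (fun q : ℝ => 4 / (1 + L * q)) (Set.Icc 0 1) := by
    refine ContinuousOn.div (by fun_prop) (by fun_prop) fun q hq => ?_
    have := mul_nonneg hL0.le hq.1
    linarith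
  have i1 : IntegrableOn (fun q : ℝ => 4 / (1 + L * q)) (Set.Ioc 0 1) :=
    (c1.integrableOn_Icc).mono_set Set.Ioc_subset_Icc_self
  have hlog : ∫ q in Set.Ioc (0 : ℝ) 1, 4 / (1 + L * q) = 4 / L * Real.log (1 + L) := by
    rw [← intervalIntegral.integral_of_le zero_le_one]
    have hd : ∀ q ∈ Set.uIcc (0 : ℝ) 1, HasDerivAt (fun q => 4 / L * Real.log (1 + L * q))
        (4 / (1 + L * q)) q := fun q hq => by
      rw [Set.uIcc_of_le zero_le_one] at hq
      have hne : 1 + L * q ≠ 0 := by have := mul_nonneg hL0.le hq.1; linarith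
      have h1 : HasDerivAt (fun q => 1 + L * q) L q := by
        simpa using ((hasDerivAt_id q).const_mul L).const_add 1
      refine ((h1.log hne).const_mul (4 / L)).congr_deriv ?_
      field_simp
    rw [intervalIntegral.integral_eq_sub_of_hasDerivAt hd
      ((intervalIntegrable_iff_integrableOn_Ioc_of_le zero_le_one).2 i1)]
    simp
  have hbound : Integrable (fun q : ℝ => (Set.Ioc (0 : ℝ) 1).indicator (fun q => 4 / (1 + L * q)) q
      + 4 / L * Real.exp (-q ^ 2 / 8)) (volume.restrict (Set.Ioi 0)) :=
    ((integrable_indicator_iff measurableSet_Ioc).2 i1).restrict.add (ie.const_mul _).restrict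
  have hpt : ∀ q ∈ Set.Ioi (0 : ℝ), ‖∫ ω, (rate (uniformDensity w) β ω : ℂ) *
      Complex.exp (Complex.I * ((ω * σ * q : ℝ) : ℂ))‖ * Real.exp (-q ^ 2 / 8)
      ≤ (Set.Ioc (0 : ℝ) 1).indicator (fun q => 4 / (1 + L * q)) q
        + 4 / L * Real.exp (-q ^ 2 / 8) := fun q hq => by
    have hq0 : 0 < q := hq
    have h1 := norm_fourier_rate_uniformDensity_le hw hβ (mul_pos hσ hq0)
    simp only [← mul_assoc, ← hL] at h1
    have hex : Real.exp (-q ^ 2 / 8) ≤ 1 := Real.exp_le_one_iff.2 (by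
      have := sq_nonneg q; linarith)
    have hep := Real.exp_pos (-q ^ 2 / 8)
    have hfr : 0 < 4 / (1 + L * q) := by positivity
    refine (mul_le_mul_of_nonneg_right h1 hep.le).trans ?_
    by_cases h : q ≤ 1
    · rw [Set.indicator_of_mem (show q ∈ Set.Ioc (0 : ℝ) 1 from ⟨hq0, h⟩)]
      have := mul_le_of_le_one_right hfr.le hex
      have h2 : 0 ≤ 4 / L * Real.exp (-q ^ 2 / 8) := by positivity
      linarith
    · rw [Set.indicator_of_notMem (fun h' => h h'.2), zero_add]
      refine mul_le_mul_of_nonneg_right ?_ hep.le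
      refine div_le_div_of_nonneg_left (by norm_num) hL0 ?_
      have := mul_le_mul_of_nonneg_left (not_le.1 h).le hL0.le
      linarith
  have hm := integral_mono_of_nonneg (μ := volume.restrict (Set.Ioi (0 : ℝ)))
    (ae_of_all _ fun q => by positivity) hbound
    ((ae_restrict_iff' measurableSet_Ioi).2 (ae_of_all _ hpt))
  refine hm.trans ?_
  rw [integral_add ((integrable_indicator_iff measurableSet_Ioc).2 i1).restrict
    (ie.const_mul _).restrict, integral_const_mul, setIntegral_indicator measurableSet_Ioc,
    Set.inter_eq_right.2 (fun q hq => hq.1), hlog]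
  have := mul_le_mul_of_nonneg_left he (by positivity : 0 ≤ 4 / L)
  linarith

end UniformDensity

/-! ### Solving the logarithmic parameter inequalities -/

section ParameterChoice

theorem half_le_log_two_add {x : ℝ} (hx : 0 ≤ x) : 1 / 2 ≤ Real.log (2 + x) := by
  have h1 := Real.log_two_gt_d9
  have h2 : Real.log 2 ≤ Real.log (2 + x) := Real.log_le_log (by norm_num) (by linarith)
  linarith

/-- The right side of the condition must not contain `log L`. Comparing `1 + L` with `2 ^ 11 * (1 +
x)` and using `log y ≤ y - 1`, the dependence on `L` becomes a small multiple of `L`; the rest is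
logarithmic in `x`. -/
theorem mul_three_add_log_le {x s L : ℝ} (hx : 0 ≤ x) (hs : 1 ≤ s)
    (hxs : Real.log (2 + x) ≤ s) (hL : 0 < L) (h : 10000 * (x * s) ≤ L) :
    512 * x * (3 + Real.log (1 + L)) ≤ L := by
  have h1 : Real.log (1 + L) = Real.log ((1 + L) / (2 ^ 11 * (1 + x)))
      + (11 * Real.log 2 + Real.log (1 + x)) := by
    rw [Real.log_div (by positivity) (by positivity), Real.log_mul (by norm_num) (by positivity),
      Real.log_pow]
    push_cast; ring
  have h2 := Real.log_le_sub_one_of_pos (by positivity : 0 < (1 + L) / (2 ^ 11 * (1 + x)))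
  have h3 := Real.log_two_lt_d9
  have h4 : Real.log (1 + x) ≤ s :=
    (Real.log_le_log (by positivity) (by linarith)).trans hxs
  have h5 : x * ((1 + L) / (2 ^ 11 * (1 + x))) ≤ (x + L) / 2048 := by
    rw [mul_div_assoc', div_le_div_iff₀ (by positivity) (by norm_num)]
    have : 0 ≤ x * x + L := by positivity
    nlinarith
  have h6 : Real.log (1 + L) ≤ (1 + L) / (2 ^ 11 * (1 + x)) + (7 + s) := by linarith
  have h7 := mul_le_mul_of_nonneg_left h6 hx
  have h8 : x ≤ x * s := le_mul_of_one_le_right hx hs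
  linarith

/-- Sixteen powers of `2 + z` pay for `65536 = 2 ^ 16` and the seventeenth for `z`. -/
theorem mul_exp_neg_le {z : ℝ} (hz : 0 ≤ z) :
    65536 * z * Real.exp (-(17 * Real.log (2 + z))) ≤ 1 := by
  have h0 : 0 < 2 + z := by positivity
  have h1 : Real.exp (-(17 * Real.log (2 + z))) = ((2 + z) ^ 17)⁻¹ := by
    rw [Real.exp_neg]
    congr 1
    rw [show (17 : ℝ) = ((17 : ℕ) : ℝ) by norm_num, Real.exp_nat_mul, Real.exp_log h0]
  rw [h1, ← div_eq_mul_inv, div_le_one (by positivity)]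
  have h2 : (2 : ℝ) ^ 16 ≤ (2 + z) ^ 16 := pow_le_pow_left₀ (by norm_num) (by linarith) 16
  have h3 : (2 + z) ^ 17 = (2 + z) ^ 16 * (2 + z) := pow_succ _ _
  rw [h3]
  nlinarith

end ParameterChoice

/-! ### The error budget for the uniform density -/

section UniformDensityError

variable {d : ℕ} {H : Matrix (Fin d) (Fin d) ℂ} {𝒜 : Finset (Matrix (Fin d) (Fin d) ℂ)}
  {β w σ T α ε t : ℝ}

theorem uniformMean_norm_pow_le_one (h𝒜 : IsCouplingSet 𝒜) (hA : ∀ A ∈ 𝒜, ‖A‖ ≤ 1) (n : ℕ) :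
    uniformMean 𝒜 (fun A => ‖A‖ ^ n) ≤ 1 := by
  rw [← uniformMean_const h𝒜.1 (1 : ℝ)]
  exact uniformMean_mono fun A h => pow_le_one₀ (norm_nonneg _) (hA A h)

theorem one_le_log_add_log {x y : ℝ} (hx : 0 ≤ x) (hy : 0 ≤ y) :
    1 ≤ Real.log (2 + x) + Real.log (2 + y) := by
  have := half_le_log_two_add hx
  have := half_le_log_two_add hy
  linarith

theorem lambError_uniformDensity_le [NeZero d] (hH : H.IsHermitian) (h𝒜 : IsCouplingSet 𝒜)
    (hA : ∀ A ∈ 𝒜, ‖A‖ ≤ 1) (hβ : 0 ≤ β) (hw : 0 < w) (hσ : 0 < σ) (hε : 0 < ε) (ht : 0 ≤ t)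
    (h : 10000 * (β * t / (w * ε))
      * (Real.log (2 + β * t / ε) + Real.log (2 + t / (w * ε))) ≤ σ) :
    2 * (lambError H 𝒜 (uniformDensity w) β σ * t) ≤ ε / 8 := by
  set s := Real.log (2 + β * t / ε) + Real.log (2 + t / (w * ε)) with hs
  have hx : 0 ≤ β * t / ε := by positivity
  have hy : 0 ≤ t / (w * ε) := by positivity
  have hly := half_le_log_two_add hy
  have hm := uniformMean_norm_pow_le_one h𝒜 hA 2
  have hR := lambR_uniformDensity_le hw hβ hσ
  have hR0 := lambR_nonneg (uniformDensity w) β σ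
  have hlog : 0 ≤ Real.log (1 + w * σ) := Real.log_nonneg (by have := mul_pos hw hσ; linarith)
  have h1 : lambError H 𝒜 (uniformDensity w) β σ
      ≤ 8 * β * (4 / (w * σ) * (3 + Real.log (1 + w * σ))) := by
    refine (lambError_le (𝒜 := 𝒜) hH (isProbDensity_uniformDensity hw).2.1 hβ hσ).trans ?_
    refine (mul_le_of_le_one_right (by positivity) hm).trans ?_
    exact mul_le_mul_of_nonneg_left hR (by positivity)
  have h2 : 512 * (β * t / ε) * (3 + Real.log (1 + w * σ)) ≤ w * σ := by
    refine mul_three_add_log_le hx (one_le_log_add_log hx hy) (by linarith) (by positivity)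
      (s := s) ?_
    have h3 := mul_le_mul_of_nonneg_left h hw.le
    refine le_trans (le_of_eq ?_) h3
    field_simp
  have h3 := mul_le_mul_of_nonneg_right h1 ht
  have h4 : 8 * β * (4 / (w * σ) * (3 + Real.log (1 + w * σ))) * t
      = ε / (16 * (w * σ)) * (512 * (β * t / ε) * (3 + Real.log (1 + w * σ))) := by
    field_simp
    ring
  have h5 := mul_le_mul_of_nonneg_left h2 (by positivity : 0 ≤ ε / (16 * (w * σ)))
  have h6 : ε / (16 * (w * σ)) * (w * σ) = ε / 16 := by field_simp
  linarith

/-- The condition on `σ` does not force `β < σ` when `t / (w * ε)` is small, but then the crude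
bound is already good enough. Otherwise `β < σ` follows and near detailed balance applies. -/
theorem dissError_uniformDensity_le [NeZero d] (hH : H.IsHermitian) (h𝒜 : IsCouplingSet 𝒜)
    (hA : ∀ A ∈ 𝒜, ‖A‖ ≤ 1) (hβ : 0 ≤ β) (hw : 0 < w) (hσ : 0 < σ) (hε : 0 < ε) (ht : 0 ≤ t)
    (h : 10000 * (β * t / (w * ε))
      * (Real.log (2 + β * t / ε) + Real.log (2 + t / (w * ε))) ≤ σ) :
    2 * (dissError H 𝒜 (uniformDensity w) β σ * t) ≤ 3 * ε / 8 := by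
  set s := Real.log (2 + β * t / ε) + Real.log (2 + t / (w * ε)) with hs
  have hx : 0 ≤ β * t / ε := by positivity
  have hy : 0 ≤ t / (w * ε) := by positivity
  have hs1 : 1 ≤ s := one_le_log_add_log hx hy
  have hm := uniformMean_norm_pow_le_one h𝒜 hA 2
  have hm0 : 0 ≤ uniformMean 𝒜 (fun A => ‖A‖ ^ 2) := uniformMean_nonneg fun A _ => by positivity
  have hg := isProbDensity_uniformDensity hw
  have hK : ∀ᵐ ω, rate (uniformDensity w) β ω ≤ w⁻¹ :=
    ae_of_all _ fun ω => rate_uniformDensity_le hw β ω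
  have hlow : 10000 * (β * (t / (w * ε))) ≤ σ := by
    refine le_trans ?_ h
    refine le_trans (le_of_eq ?_) (le_mul_of_one_le_right (by positivity) hs1)
    ring
  rcases le_total (t / (w * ε)) (1 / 128) with hsm | hlg
  · have h1 : dissError H 𝒜 (uniformDensity w) β σ ≤ 16 * w⁻¹ :=
      (dissError_le_crude hH hg hσ hK).trans (mul_le_of_le_one_right (by positivity) hm)
    have h2 := mul_le_mul_of_nonneg_right h1 ht
    have h3 : 16 * w⁻¹ * t = 16 * ε * (t / (w * ε)) := by field_simp
    have h4 := mul_le_mul_of_nonneg_left hsm (by positivity : 0 ≤ 16 * ε)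
    linarith
  · have hβσ : β < σ := by
      rcases hβ.eq_or_lt with h0 | h0
      · rwa [← h0]
      · have := mul_le_mul_of_nonneg_left hlg hβ
        linarith
    have h1 : dissError H 𝒜 (uniformDensity w) β σ ≤ 516 * w⁻¹ * (β / σ) :=
      (dissError_le hH h𝒜 hg hβ hβσ hK).trans (mul_le_of_le_one_right (by positivity) hm)
    have h2 := mul_le_mul_of_nonneg_right h1 ht
    have h3 : 516 * w⁻¹ * (β / σ) * t = 516 * ε / (10000 * σ) * (10000 * (β * (t / (w * ε)))) := by
      field_simp
    have h4 := mul_le_mul_of_nonneg_left hlow (by positivity : 0 ≤ 516 * ε / (10000 * σ))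
    have h5 : 516 * ε / (10000 * σ) * σ = 516 * ε / 10000 := by field_simp
    linarith

/-- The lower bound on `T` makes the Gaussian tail beat a power of `2 + σ * t / ε`; squaring the
bound on `α * √t` handles the fourth order term. -/
theorem truncError_uniformDensity_le (h𝒜 : IsCouplingSet 𝒜) (hA : ∀ A ∈ 𝒜, ‖A‖ ≤ 1)
    (hσ : 0 < σ) (hT : 0 < T) (hα : 0 < α) (hε : 0 < ε) (ht : 0 ≤ t)
    (h2 : 10000 * (σ * Real.log (2 + σ * t / ε)) ≤ T)
    (h3 : α * √t ≤ 10000⁻¹ * (σ * √ε / T ^ 2)) :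
    2 * (4096 * truncError 𝒜 σ T α * t) ≤ 2 * ε / 8 := by
  have hm2 := uniformMean_norm_pow_le_one h𝒜 hA 2
  have hm4 := uniformMean_norm_pow_le_one h𝒜 hA 4
  have hz : 0 ≤ σ * t / ε := by positivity
  have hl := half_le_log_two_add hz
  set l := Real.log (2 + σ * t / ε) with hlz
  have e1 : truncError 𝒜 σ T α
      ≤ σ * Real.exp (-T ^ 2 / (4 * σ ^ 2)) + α ^ 2 * T ^ 4 / σ ^ 2 := by
    unfold truncError
    exact add_le_add (mul_le_of_le_one_right (by positivity) hm2)
      (mul_le_of_le_one_right (by positivity) hm4)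
  have e2 : α ^ 2 * T ^ 4 / σ ^ 2 * t ≤ ε / 100000000 := by
    have h4 := pow_le_pow_left₀ (by positivity) h3 2
    rw [mul_pow, Real.sq_sqrt ht, mul_pow, div_pow, mul_pow, Real.sq_sqrt hε.le] at h4
    have h5 := mul_le_mul_of_nonneg_right h4 (by positivity : 0 ≤ T ^ 4 / σ ^ 2)
    have h6 : (10000⁻¹ : ℝ) ^ 2 * (σ ^ 2 * ε / (T ^ 2) ^ 2) * (T ^ 4 / σ ^ 2)
        = ε / 100000000 := by
      field_simp
      norm_num
    rw [h6] at h5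
    refine le_trans (le_of_eq ?_) h5
    ring
  have e3 : Real.exp (-T ^ 2 / (4 * σ ^ 2)) ≤ Real.exp (-(17 * l)) := by
    refine Real.exp_le_exp.2 ?_
    rw [div_le_iff₀ (by positivity)]
    have h4 := pow_le_pow_left₀ (by positivity) h2 2
    -- The exponent is quadratic in the logarithm; since `l ≥ 1 / 2` it dominates a linear one.
    have h5 : l ≤ 2 * l ^ 2 := by nlinarith
    have h6 := mul_le_mul_of_nonneg_left h5 (sq_nonneg σ)
    have h7 : (10000 * (σ * l)) ^ 2 = 100000000 * (σ ^ 2 * l ^ 2) := by ring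
    have h8 : 0 ≤ σ ^ 2 * l ^ 2 := by positivity
    rw [h7] at h4
    linarith
  have e4 : σ * Real.exp (-T ^ 2 / (4 * σ ^ 2)) * t ≤ ε / 65536 := by
    have h4 := mul_exp_neg_le hz
    rw [← hlz] at h4
    have h5 := mul_le_mul_of_nonneg_left e3 (by positivity : 0 ≤ σ * t)
    have h6 : 65536 * (σ * t / ε) * Real.exp (-(17 * l))
        = 65536 / ε * (σ * t * Real.exp (-(17 * l))) := by ring
    rw [h6] at h4
    have h7 := mul_le_mul_of_nonneg_left h4 (by positivity : 0 ≤ ε / 65536)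
    have h8 : ε / 65536 * (65536 / ε * (σ * t * Real.exp (-(17 * l))))
        = σ * t * Real.exp (-(17 * l)) := by field_simp
    linarith
  have e5 := mul_le_mul_of_nonneg_right e1 ht
  linarith

end UniformDensityError

end ThermalPrep


theorem mainTheorem2 :
    -- general frequency density, Gaussian filter
    (∃ C : ℝ, 0 < C ∧
      ∀ (d : ℕ) (H : Matrix (Fin d) (Fin d) ℂ) (𝒜 : Finset (Matrix (Fin d) (Fin d) ℂ))
        (g : ℝ → ℝ) (β σ T α ε : ℝ) (ρfix : Matrix (Fin d) (Fin d) ℂ),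
        H.IsHermitian → ThermalPrep.IsCouplingSet 𝒜 → ThermalPrep.IsProbDensity g →
        0 ≤ β → β < σ → 0 < T → 0 < α → 0 < ε →
        ThermalPrep.IsUniqueFixedState (ThermalPrep.channel H 𝒜 g β σ T α) ρfix →
        (∃ t, ThermalPrep.IsMixedAt (ThermalPrep.channel H 𝒜 g β σ T α) ρfix ε t) →
        ∀ τ : ℕ, τ = ThermalPrep.mixingTime (ThermalPrep.channel H 𝒜 g β σ T α) ρfix ε →
        ThermalPrep.traceNorm (ρfix - ThermalPrep.gibbs β H)
            ≤ (ThermalPrep.lambError H 𝒜 g β σ + ThermalPrep.dissError H 𝒜 g β σ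
                + C * ThermalPrep.truncError 𝒜 σ T α) * (α ^ 2 * τ) + ε ∧
        (MemLp (ThermalPrep.rate g β) ⊤ volume →
          ThermalPrep.lambError H 𝒜 g β σ + ThermalPrep.dissError H 𝒜 g β σ
              ≤ C * ThermalPrep.gibbsBound 𝒜 g β σ ∧
          ThermalPrep.traceNorm (ρfix - ThermalPrep.gibbs β H)
              ≤ C * (ThermalPrep.gibbsBound 𝒜 g β σ + ThermalPrep.truncError 𝒜 σ T α)
                  * (α ^ 2 * τ) + ε)) ∧
    -- uniform frequency density on `[0, ωmax]`
    (∃ C : ℝ, 0 < C ∧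
      ∀ (d : ℕ) (H : Matrix (Fin d) (Fin d) ℂ) (𝒜 : Finset (Matrix (Fin d) (Fin d) ℂ))
        (β ωmax σ T α ε : ℝ) (ρfix : Matrix (Fin d) (Fin d) ℂ),
        H.IsHermitian → ThermalPrep.IsCouplingSet 𝒜 → (∀ A ∈ 𝒜, ‖A‖ ≤ 1) →
        0 ≤ β → 0 < ωmax → 0 < σ → 0 < T → 0 < α → 0 < ε →
        ∀ Φ, Φ = ThermalPrep.channel H 𝒜 (ThermalPrep.uniformDensity ωmax) β σ T α →
        ThermalPrep.IsUniqueFixedState Φ ρfix →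
        (∃ t, ThermalPrep.IsMixedAt Φ ρfix (min ε (1 / 2)) t) →
        ∀ tmix : ℝ, tmix = α ^ 2 * ThermalPrep.mixingTime Φ ρfix (min ε (1 / 2)) →
        C * (β * tmix / (ωmax * ε))
            * (Real.log (2 + β * tmix / ε) + Real.log (2 + tmix / (ωmax * ε))) ≤ σ →
        C * (σ * Real.log (2 + σ * tmix / ε)) ≤ T →
        α * √tmix ≤ C⁻¹ * (σ * √ε / T ^ 2) →
        ThermalPrep.traceNorm (ρfix - ThermalPrep.gibbs β H) < ε) := by
  -- `4096` is the fourth order constant and exceeds the `516` of the Gibbs bound; `10000` is the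
  -- constant used in the parameter estimates.
  refine ⟨⟨4096, by norm_num, ?_⟩, ⟨10000, by norm_num, ?_⟩⟩
  · intro d H 𝒜 g β σ T α ε ρfix hH h𝒜 hg hβ hβσ hT hα _ hfix hmix τ hτ
    have := hfix.1.neZero
    have hσ : 0 < σ := hβ.trans_lt hβσ
    have h1 : ThermalPrep.traceNorm (ρfix - ThermalPrep.gibbs β H)
        ≤ (ThermalPrep.lambError H 𝒜 g β σ + ThermalPrep.dissError H 𝒜 g β σ
            + 4096 * ThermalPrep.truncError 𝒜 σ T α) * (α ^ 2 * τ) + ε :=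
      ThermalPrep.traceNorm_fixed_sub_gibbs_le hH h𝒜 hg hσ hT hα
        (hτ ▸ ThermalPrep.isMixedAt_mixingTime hmix)
    refine ⟨h1, fun hγ => ?_⟩
    have h2 := ThermalPrep.lambError_add_dissError_le hH h𝒜 hg hβ hβσ hγ
    have h3 : 0 ≤ ThermalPrep.gibbsBound 𝒜 g β σ := by
      have h4 := ThermalPrep.lambR_nonneg g β σ
      have h5 : 0 ≤ ThermalPrep.uniformMean 𝒜 (fun A => ‖A‖ ^ 2) :=
        ThermalPrep.uniformMean_nonneg fun A _ => by positivity
      have h6 := ENNReal.toReal_nonneg (a := eLpNorm (ThermalPrep.rate g β) ⊤ volume)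
      unfold ThermalPrep.gibbsBound
      positivity
    refine ⟨by linarith, h1.trans (add_le_add (mul_le_mul_of_nonneg_right ?_ (by positivity))
      le_rfl)⟩
    linarith
  · intro d H 𝒜 β w σ T α ε ρfix hH h𝒜 hA hβ hw hσ hT hα hε Φ hΦ hfix hmix t ht h1 h2 h3
    subst hΦ
    have := hfix.1.neZero
    have ht0 : 0 ≤ t := by rw [ht]; positivity
    have h := ThermalPrep.traceNorm_fixed_sub_gibbs_le_two_mul hH h𝒜
      (ThermalPrep.isProbDensity_uniformDensity hw) hσ hT hα (min_le_right ε (1 / 2)) hfix.1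
      hfix.2.1 (ThermalPrep.isMixedAt_mixingTime hmix)
    rw [← ht] at h
    have e1 := ThermalPrep.lambError_uniformDensity_le hH h𝒜 hA hβ hw hσ hε ht0 h1
    have e2 := ThermalPrep.dissError_uniformDensity_le hH h𝒜 hA hβ hw hσ hε ht0 h1
    have e3 := ThermalPrep.truncError_uniformDensity_le h𝒜 hA hσ hT hα hε ht0 h2 h3
    -- The Lamb, dissipative and truncation shares are `1/8`, `3/8` and `2/8` of `ε`, leaving a
    -- strict margin.
    linarith
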